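/- **Setting.** Let $\tau>0$ and let $\mathbf k\in\mathbb R^3$ be a wave vector with wave number $k=|\mathbf k|$, $0<k<k_{\rm crit,min}=\sqrt{\pi/2}\,/\tau$. Let $\mathcal H$ be the complex $L^2$ space over $\mathbb R^3$ of the weight $(2\pi)^{-3/2}e^{-|\mathbf v|^2/2}d\mathbf v$, with inner product $\langle f,g\rangle=(2\pi)^{-3/2}\int f\,\overline g\,e^{-|\mathbf v|^2/2}d\mathbf v$, and let $e_0=1$, $e_j=v_j$ ($j=1,2,3$), $e_4=(|\mathbf v|^2-3)/\sqrt6$, $\mathbb P_5f=\sum_{j=0}^4\langle f,e_j\rangle e_j$, identified with the vector $(\langle f,e_j\rangle)_{0\le j\le4}\in\mathbb C^5$. Let $$\mathcal L_{\mathbf k}=-\mathrm i\,\mathbf v\cdot\mathbf k-\tfrac1\tau(1-\mathbb P_5)$$ on the maximal domain $\{f\in\mathcal H:(\mathbf v\cdot\mathbf k)f\in\mathcal H\}$. Let the hydrodynamic spectrum be $\Lambda=\{\lambda\in\sigma(\mathcal L_{\mathbf k}):\operatorname{Re}\lambda>-1/\tau\}$ (the part of the spectrum to the right of the essential spectrum).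 For a closed piecewise $C^1$ contour $\Gamma$ in the resolvent set that has winding number $1$ around every point of $\Lambda$ and $0$ around every other point of $\sigma(\mathcal L_{\mathbf k})$, let $\mathbb P_\Lambda=-\frac1{2\pi\mathrm i}\oint_\Gamma(\mathcal L_{\mathbf k}-w)^{-1}dw$ be the Riesz projection. The variables $\lambda$, $z$, $\zeta$ are related by $z=-\tau\lambda-1$ and $\zeta=\frac{z}{\mathrm ik\tau}=\mathrm i\frac{\tau\lambda+1}{k\tau}$; write $z_\lambda$ and $\zeta_\lambda$ for the values belonging to $\lambda$. Put $$Z(\zeta)=\tfrac1{\sqrt{2\pi}}\int_{\mathbb R}\frac{e^{-v^2/2}}{v-\zeta}dv,\qquad G_S(z)_{nm}=\big\langle(\mathrm i\tau\mathbf v\cdot\mathbf k-z)^{-1}e_n,e_m\big\rangle\quad(0\le n,m\le4),$$ $$G(\zeta)=\begin{pmatrix}Z&1+\zeta Z&0&0&\frac{\zeta+(\zeta^2-1)Z}{\sqrt6}\\1+\zeta Z&\zeta+\zeta^2Z&0&0&\frac{\zeta^2+(\zeta^3-\zeta)Z}{\sqrt6}\\0&0&Z&0&0\\0&0&0&Z&0\\\frac{\zeta+(\zeta^2-1)Z}{\sqrt6}&\frac{\zeta^2+(\zeta^3-\zeta)Z}{\sqrt6}&0&0&\frac{\zeta^3-\zeta+(\zeta^4-2\zeta^2+5)Z}{6}\end{pmatrix},\quad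 Z=Z(\zeta),$$ \begin{align*}\Sigma_{k,\tau}=\frac{(Z-\mathrm i\tau k)^2}{6(\mathrm ik\tau)^5}\Big(&\zeta+6\mathrm ik^3\tau^3-\zeta(\zeta^2+5)k^2\tau^2+2\mathrm i(\zeta^2+3)k\tau-4\mathrm iZ^2\big((\zeta^2+1)k\tau-\mathrm i\zeta\big)\\&+Z\big(\zeta^2-(\zeta^4+4\zeta^2+11)k^2\tau^2+2\mathrm ik\tau\zeta^3-5\big)\Big),\end{align*} regarded as a function of $z=\mathrm ik\tau\zeta$. Let $\mathbf Q$ be a real orthogonal $3\times3$ matrix with $\mathbf Q(k,0,0)^T=\mathbf k$ and $\tilde{\mathbf Q}=\mathrm{diag}(1,\mathbf Q,1)$. **Claim.** 0. For $\operatorname{Re}z<0$, $\Sigma_{k,\tau}(z)=\det(G_S(z)-\mathrm{Id})$ and $\mathrm{adj}(G_S(z)-\mathrm{Id})=(\mathrm i\tau k)^{-4}\,\tilde{\mathbf Q}\,\mathrm{adj}(G(\zeta)-\mathrm i\tau k)\,\tilde{\mathbf Q}^T$ with $\zeta=z/(\mathrm ik\tau)$. 1. The set $\Lambda$ is finite,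 and for every contour $\Gamma$ as above, with $\Gamma_\tau=-\tau\Gamma-1$, and all $0\le n,m\le4$, $$\langle\mathbb P_\Lambda e_m,e_n\rangle=\frac1{2\pi\mathrm i}\oint_{\Gamma_\tau}\big[(G_S-\mathrm{Id})^{-1}\big]_{nm}dz=\frac1{2\pi\mathrm i}\oint_{\Gamma_\tau}\Sigma_{k,\tau}^{-1}\,\mathrm{adj}(G_S-\mathrm{Id})_{nm}dz=\sum_{\lambda\in\Lambda}\operatorname{Res}_{z=z_\lambda}\Sigma_{k,\tau}^{-1}\,\mathrm{adj}(G_S-\mathrm{Id})_{nm}.$$ 2. Let $\lambda\in\Lambda$ be a simple eigenvalue (algebraic multiplicity one). Then $\Sigma_{k,\tau}^{-1}$ has a pole of order one at $z_\lambda$, and with $$\mathbf a(\zeta)=\begin{pmatrix}\frac{\mathrm i\tau k}{\sqrt6}(\zeta+(\zeta^2-1)Z)\\\frac1{\sqrt6}(1+\mathrm ik\tau\zeta)(\zeta+(\zeta^2-1)Z)\\0\\0\\-1-k^2\tau^2-\mathrm ik\tau\zeta-(\mathrm ik\tau+\zeta+\mathrm ik\tau\zeta^2)Z\end{pmatrix},\qquad\mathbf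 a=\mathbf a(\zeta_\lambda),$$ there are non-zero $g,c\in\mathbb C$ such that $\mathrm{adj}(G(\zeta_\lambda)-\mathrm i\tau k)=g\,\mathbf a\mathbf a^T$ and the matrix of residues of $\Sigma_{k,\tau}^{-1}\mathrm{adj}(G_S-\mathrm{Id})$ at $z_\lambda$ is $c\,(\tilde{\mathbf Q}\mathbf a)(\tilde{\mathbf Q}\mathbf a)^T$. The first entry of $\mathbf a$ is non-zero, and dividing $\tilde{\mathbf Q}\mathbf a$ by it gives the basis vector of the direct computation, $$\boldsymbol\eta(\lambda)=\Big(1,\tfrac{\mathrm i\lambda}{k^2}\mathbf k,\theta(\lambda)\Big),\qquad\theta(\lambda)=\frac{\frac1{k^2}\Big\langle\frac{k^2+\mathrm i\lambda\mathbf k\cdot\mathbf v}{\tau\lambda+1+\mathrm i\tau\mathbf v\cdot\mathbf k},e_4\Big\rangle}{1-\Big\langle\frac{e_4}{\tau\lambda+1+\mathrm i\tau\mathbf v\cdot\mathbf k},e_4\Big\rangle};$$ the image under $\mathbb P_5$ of the eigenspace of $\lambda$ is $\mathbb C\,\boldsymbol\eta(\lambda)$. 3. There is exactly one $\lambda_{\rm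 shear}$ with $\operatorname{Re}\lambda_{\rm shear}>-1/\tau$ and $Z(\zeta_{\lambda_{\rm shear}})=\mathrm i\tau k$. It belongs to $\Lambda$, $\Sigma_{k,\tau}^{-1}$ has a pole of order two at $z_{\lambda_{\rm shear}}$, and $$\frac{d}{d\zeta}\mathrm{adj}(G(\zeta)-\mathrm i\tau k)\Big|_{\zeta=\zeta_{\lambda_{\rm shear}}}=\mathrm{diag}(0,0,A,A,0),\qquad A=-\frac{\mathrm i\lambda_{\rm shear}\big(k^4\tau^4+(\tau\lambda_{\rm shear})^4+(\tau\lambda_{\rm shear})^3+\lambda_{\rm shear}\tau^3k^2\big)}{6k}\neq0.$$ The matrix of residues of $\Sigma_{k,\tau}^{-1}\mathrm{adj}(G_S-\mathrm{Id})$ at $z_{\lambda_{\rm shear}}$ is a non-zero multiple of $\tilde{\mathbf Q}\,\mathrm{diag}(0,0,A,A,0)\,\tilde{\mathbf Q}^T$. Its range, and also the image under $\mathbb P_5$ of the eigenspace of $\lambda_{\rm shear}$, is the span of the basis vectors $\tilde{\mathbf Q}(0,0,1,0,0)^T$ and $\tilde{\mathbf Q}(0,0,0,1,0)^T$ of the direct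 computation. -/

import Mathlib

open MeasureTheory ProbabilityTheory Set Filter Topology
open scoped Matrix

noncomputable section

namespace BGK

/-! ### Closed unbounded operators: resolvent, spectrum, eigenvectors -/

section Operators

variable {H : Type*} [NormedAddCommGroup H] [NormedSpace ℂ H]

/-- `R` is a bounded two-sided inverse of `T - w`. -/
def IsResolventAt (T : H →ₗ.[ℂ] H) (w : ℂ) (R : H →L[ℂ] H) : Prop :=
  (∀ f : H, ∃ h : R f ∈ T.domain, T ⟨R f, h⟩ - w • R f = f) ∧
    ∀ f : T.domain, R (T f - w • (f : H)) = f

/-- The spectrum of a possibly unbounded operator. -/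
def opSpectrum (T : H →ₗ.[ℂ] H) : Set ℂ :=
  {w | ¬ ∃ R : H →L[ℂ] H, IsResolventAt T w R}

open Classical in
/-- The resolvent `(T - w)⁻¹` (and `0` if `w` belongs to the spectrum). -/
def opResolvent (T : H →ₗ.[ℂ] H) (w : ℂ) : H →L[ℂ] H :=
  if h : ∃ R : H →L[ℂ] H, IsResolventAt T w R then h.choose else 0

/-- `T f = w f`, with `f` in the domain of `T` (the zero vector is allowed). -/
def InEigenspace (T : H →ₗ.[ℂ] H) (w : ℂ) (f : H) : Prop :=
  ∃ h : f ∈ T.domain, T ⟨f, h⟩ = w • f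

/-- The kernel of `(T - w) ^ n`. -/
def genKer (T : H →ₗ.[ℂ] H) (w : ℂ) : ℕ → Set H
  | 0 => {0}
  | n + 1 => {f | ∃ h : f ∈ T.domain, T ⟨f, h⟩ - w • f ∈ genKer T w n}

/-- `w` is an eigenvalue of algebraic multiplicity one: the generalized eigenspace is a line. -/
def IsSimpleEigenvalue (T : H →ₗ.[ℂ] H) (w : ℂ) : Prop :=
  ∃ f : H, f ≠ 0 ∧ (⋃ n, genKer T w n) = (Submodule.span ℂ {f} : Set H)

end Operators

/-! ### Contours, residues, Riesz projections -/

/-- A closed piecewise continuously differentiable curve parametrized by `[0, 1]`. -/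
structure IsClosedContour (γ : ℝ → ℂ) : Prop where
  closed : γ 0 = γ 1
  continuousOn : ContinuousOn γ (Icc 0 1)
  piecewise : ∃ s : Finset ℝ, ∀ a b : ℝ, 0 ≤ a → a < b → b ≤ 1 →
    Disjoint (Ioo a b) (s : Set ℝ) → ContDiffOn ℝ 1 γ (Icc a b)

/-- The contour integral `∮_γ f(w) dw`. -/
def contourIntegral {E : Type*} [NormedAddCommGroup E] [NormedSpace ℂ E]
    (γ : ℝ → ℂ) (f : ℂ → E) : E :=
  ∫ t in (0 : ℝ)..1, deriv γ t • f (γ t)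

/-- The winding number of a closed contour around a point off the contour. -/
def windingNumber (γ : ℝ → ℂ) (w : ℂ) : ℂ :=
  (2 * Real.pi * Complex.I)⁻¹ * contourIntegral γ (fun z => (z - w)⁻¹)

/-- `γ` is a closed contour in the complement of `S` that encircles the part `Λ` of `S` once in
the positive direction and no other point of `S`. -/
structure Encircles (γ : ℝ → ℂ) (Λ S : Set ℂ) : Prop where
  contour : IsClosedContour γ
  avoids : ∀ t ∈ Icc (0 : ℝ) 1, γ t ∉ S
  once : ∀ w ∈ Λ, windingNumber γ w = 1
  outside : ∀ w ∈ S \ Λ, windingNumber γ w = 0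

/-- The Riesz projection `-(2πi)⁻¹ ∮_γ (T - w)⁻¹ dw`. -/
def rieszProjection {H : Type*} [NormedAddCommGroup H] [NormedSpace ℂ H]
    (T : H →ₗ.[ℂ] H) (γ : ℝ → ℂ) : H →L[ℂ] H :=
  -((2 * Real.pi * Complex.I)⁻¹ • contourIntegral γ (opResolvent T))

/-- `f` has an isolated singularity (or none) at `z₀`, and its residue there is `c`. -/
def HasResidueAt (f : ℂ → ℂ) (z₀ c : ℂ) : Prop :=
  (∀ᶠ z in 𝓝[≠] z₀, AnalyticAt ℂ f z) ∧
    ∀ᶠ r in 𝓝[>] (0 : ℝ), (2 * Real.pi * Complex.I)⁻¹ * (∮ z in C(z₀, r), f z) = c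

/-! ### The linearized BGK operator at a wave vector -/

/-- Velocity (and wave vector) space. -/
abbrev V : Type := EuclideanSpace ℝ (Fin 3)

/-- The Maxwellian weight `(2π)^(-3/2) exp(-|v|²/2) dv`. -/
abbrev maxwellian : Measure V := stdGaussian V

/-- The Hilbert space of the deviations from the Maxwellian. Mathlib's inner product is
conjugate-linear in the first slot: `⟨f, g⟩_v` is `inner ℂ g f`. -/
abbrev Hv : Type := Lp ℂ 2 maxwellian

/-- The five collision invariants `1, v₁, v₂, v₃, (|v|² - 3)/√6`. -/
def e (j : Fin 5) (v : V) : ℝ :=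
  ![1, v 0, v 1, v 2, (‖v‖ ^ 2 - 3) / √6] j

theorem memLp_e (j : Fin 5) : MemLp (fun v => (e j v : ℂ)) 2 maxwellian := by
  have hid : ∀ p : ENNReal, p ≠ ⊤ → MemLp (fun v : V => v) p maxwellian := fun p hp =>
    IsGaussian.memLp_id maxwellian p hp
  have hcoord : ∀ i : Fin 3, MemLp (fun v : V => v i) 2 maxwellian := fun i =>
    (EuclideanSpace.proj (𝕜 := ℝ) i).comp_memLp' (hid 2 (by simp))
  have hsq : MemLp (fun v : V => ‖v‖ ^ 2) 2 maxwellian := by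
    have h4 : MemLp (fun v : V => ‖v‖) 4 maxwellian := (hid 4 (by simp)).norm
    have : ENNReal.HolderTriple 4 4 2 := ⟨by
      rw [← ENNReal.toReal_eq_toReal_iff' (by simp) (by simp), ENNReal.toReal_add (by simp)
        (by simp)]
      simp only [ENNReal.toReal_inv, ENNReal.toReal_ofNat]
      norm_num⟩
    have := h4.mul h4 (r := 2)
    refine this.ae_eq (Eventually.of_forall fun v => ?_)
    simp [pow_two]
  have hreal : MemLp (e j) 2 maxwellian := by
    fin_cases j
    · exact memLp_const (1 : ℝ)
    · exact hcoord 0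
    · exact hcoord 1
    · exact hcoord 2
    · have := (hsq.sub (memLp_const (3 : ℝ))).mul_const (√6)⁻¹
      refine this.ae_eq (Eventually.of_forall fun v => ?_)
      simp [e, div_eq_mul_inv]
  exact hreal.ofReal

/-- The collision invariants as elements of the Hilbert space. -/
def eL (j : Fin 5) : Hv := (memLp_e j).toLp _

/-- The macroscopic moments `⟨f, e_j⟩_v`, i.e. the coordinates of `ℙ₅ f`. -/
def moments (f : Hv) : Fin 5 → ℂ := fun j => inner ℂ (eL j) f

/-- The projection `ℙ₅ f = ∑ j, ⟨f, e_j⟩_v e_j`. -/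
def P5 : Hv →L[ℂ] Hv := ∑ j : Fin 5, (innerSL ℂ (eL j)).smulRight (eL j)

/-- The maximal domain of multiplication by `v ⬝ k`. -/
def transportDomain (k : V) : Submodule ℂ Hv where
  carrier := {f | MemLp (fun v => ((inner ℝ v k : ℝ) : ℂ) * f v) 2 maxwellian}
  zero_mem' := by
    refine (MemLp.zero (ε := ℂ)).ae_eq ?_
    filter_upwards [Lp.coeFn_zero ℂ 2 maxwellian] with v hv
    rw [hv]
    simp
  add_mem' := by
    intro f g hf hg
    refine (MemLp.add hf hg).ae_eq ?_
    filter_upwards [Lp.coeFn_add f g] with v hv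
    rw [hv]
    simp [mul_add]
  smul_mem' := by
    intro c f hf
    refine (MemLp.const_smul hf c).ae_eq ?_
    filter_upwards [Lp.coeFn_smul c f] with v hv
    rw [hv]
    simp [mul_left_comm]

theorem memLp_transport {k : V} (f : transportDomain k) :
    MemLp (fun v => ((inner ℝ v k : ℝ) : ℂ) * (f : Hv) v) 2 maxwellian := f.2

/-- Multiplication by `v ⬝ k` on its maximal domain. -/
def transport (k : V) : transportDomain k →ₗ[ℂ] Hv where
  toFun f := (memLp_transport f).toLp _
  map_add' f g := by
    apply Lp.ext
    filter_upwards [(memLp_transport (f + g)).coeFn_toLp, (memLp_transport f).coeFn_toLp,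
      (memLp_transport g).coeFn_toLp, Lp.coeFn_add (f : Hv) (g : Hv),
      Lp.coeFn_add ((memLp_transport f).toLp _) ((memLp_transport g).toLp _)] with v h h₁ h₂ h₃ h₄
    rw [h, h₄, Pi.add_apply, h₁, h₂, Submodule.coe_add, h₃, Pi.add_apply, mul_add]
  map_smul' c f := by
    apply Lp.ext
    filter_upwards [(memLp_transport (c • f)).coeFn_toLp, (memLp_transport f).coeFn_toLp,
      Lp.coeFn_smul c (f : Hv),
      Lp.coeFn_smul c ((memLp_transport f).toLp _)] with v h h₁ h₃ h₄
    rw [RingHom.id_apply, h, h₄, Pi.smul_apply, h₁, Submodule.coe_smul, h₃, Pi.smul_apply,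
      smul_eq_mul, smul_eq_mul, mul_left_comm]

/-- The operator `𝓛_k = -i v ⬝ k - τ⁻¹ (1 - ℙ₅)`. -/
def bgk (k : V) (τ : ℝ) : Hv →ₗ.[ℂ] Hv where
  domain := transportDomain k
  toFun := (-Complex.I) • transport k -
    ((τ : ℂ)⁻¹ • (LinearMap.id - (P5 : Hv →ₗ[ℂ] Hv))).comp (transportDomain k).subtype

/-- The hydrodynamic spectrum: the spectrum of `𝓛_k` to the right of the line `Re w = -1/τ`
(which is the essential spectrum). -/
def hydroSpectrum (k : V) (τ : ℝ) : Set ℂ :=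
  {w | w ∈ opSpectrum (bgk k τ) ∧ -(1 / τ) < w.re}

/-! ### Green's matrices and the spectral function

The spectral variables are related by `z = -τ w - 1` and `ζ = z / (i k τ) = i (τ w + 1) / (k τ)`,
where `k` denotes the wave number. -/

/-- The shifted eigenvalue parameter `z = -τ w - 1`. -/
def zOf (τ : ℝ) (w : ℂ) : ℂ := -τ * w - 1

/-- `ζ = i (τ w + 1) / (k τ)`, `k` the wave number. -/
def zetaOf (k τ : ℝ) (w : ℂ) : ℂ := Complex.I * (τ * w + 1) / (k * τ)

/-- The plasma dispersion function. -/
def Z (ζ : ℂ) : ℂ :=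
  (√(2 * Real.pi) : ℂ)⁻¹ * ∫ v : ℝ, Complex.exp (-(v : ℂ) ^ 2 / 2) / (v - ζ)

/-- Green's matrix `G_S(z, n, m) = ⟨(i τ v ⬝ k - z)⁻¹ e_n, e_m⟩_v`. -/
def greenS (k : V) (τ : ℝ) (z : ℂ) : Matrix (Fin 5) (Fin 5) ℂ :=
  Matrix.of fun n m =>
    ∫ v, (Complex.I * τ * (inner ℝ v k : ℝ) - z)⁻¹ * (e n v : ℂ) * (e m v : ℂ) ∂maxwellian

/-- The matrix `G(ζ)`. -/
def G (ζ : ℂ) : Matrix (Fin 5) (Fin 5) ℂ :=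
  !![Z ζ, 1 + ζ * Z ζ, 0, 0, (ζ + (ζ ^ 2 - 1) * Z ζ) / √6;
     1 + ζ * Z ζ, ζ + ζ ^ 2 * Z ζ, 0, 0, (ζ ^ 2 + (ζ ^ 3 - ζ) * Z ζ) / √6;
     0, 0, Z ζ, 0, 0;
     0, 0, 0, Z ζ, 0;
     (ζ + (ζ ^ 2 - 1) * Z ζ) / √6, (ζ ^ 2 + (ζ ^ 3 - ζ) * Z ζ) / √6, 0, 0,
       (ζ ^ 3 - ζ + (ζ ^ 4 - 2 * ζ ^ 2 + 5) * Z ζ) / 6]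

/-- The matrix `G(ζ) - i τ k`, `k` the wave number. -/
def shiftedG (k τ : ℝ) (ζ : ℂ) : Matrix (Fin 5) (Fin 5) ℂ :=
  G ζ - (Complex.I * τ * k) • (1 : Matrix (Fin 5) (Fin 5) ℂ)

/-- The spectral function `Σ_{k,τ}` in terms of `ζ`, `k` the wave number. -/
def spectralFunctionZeta (k τ : ℝ) (ζ : ℂ) : ℂ :=
  1 / (6 * (Complex.I * k * τ) ^ 5) * (Z ζ - Complex.I * τ * k) ^ 2 *
    (ζ + 6 * Complex.I * k ^ 3 * τ ^ 3 - ζ * (ζ ^ 2 + 5) * k ^ 2 * τ ^ 2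
      + 2 * Complex.I * (ζ ^ 2 + 3) * k * τ
      - 4 * Complex.I * Z ζ ^ 2 * ((ζ ^ 2 + 1) * k * τ - Complex.I * ζ)
      + Z ζ * (ζ ^ 2 - (ζ ^ 4 + 4 * ζ ^ 2 + 11) * k ^ 2 * τ ^ 2
        + 2 * Complex.I * k * τ * ζ ^ 3 - 5))

/-- The spectral function `Σ_{k,τ}` in terms of `z = i k τ ζ`, `k` the wave number. -/
def spectralFunction (k τ : ℝ) (z : ℂ) : ℂ :=
  spectralFunctionZeta k τ (z / (Complex.I * k * τ))

/-- The block-diagonal matrix `diag(1, Q, 1)`. -/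
def tildeQ (Q : Matrix (Fin 3) (Fin 3) ℝ) : Matrix (Fin 5) (Fin 5) ℂ :=
  !![1, 0, 0, 0, 0;
     0, (Q 0 0 : ℂ), (Q 0 1 : ℂ), (Q 0 2 : ℂ), 0;
     0, (Q 1 0 : ℂ), (Q 1 1 : ℂ), (Q 1 2 : ℂ), 0;
     0, (Q 2 0 : ℂ), (Q 2 1 : ℂ), (Q 2 2 : ℂ), 0;
     0, 0, 0, 0, 1]

/-- The vector `a(ζ)`, `k` the wave number. -/
def aVec (k τ : ℝ) (ζ : ℂ) : Fin 5 → ℂ :=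
  ![Complex.I * τ * k / √6 * (ζ + (ζ ^ 2 - 1) * Z ζ),
    1 / √6 * (1 + Complex.I * k * τ * ζ) * (ζ + (ζ ^ 2 - 1) * Z ζ),
    0,
    0,
    -1 - k ^ 2 * τ ^ 2 - Complex.I * k * τ * ζ
      - (Complex.I * k * τ + ζ + Complex.I * k * τ * ζ ^ 2) * Z ζ]

/-- The number `A` at the shear eigenvalue `w`, `k` the wave number. -/
def shearCoeff (k τ : ℝ) (w : ℂ) : ℂ :=
  -(Complex.I * w * (k ^ 4 * τ ^ 4 + (w * τ) ^ 4 + (τ * w) ^ 3 + w * τ ^ 3 * k ^ 2)) / (6 * k)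

/-- The denominator `τ w + 1 + i τ v ⬝ k`. -/
def den (k : V) (τ : ℝ) (w : ℂ) (v : V) : ℂ := τ * w + 1 + Complex.I * τ * (inner ℝ v k : ℝ)

/-- The spectral temperature `θ(w)` of the direct computation. -/
def spectralTemperature (k : V) (τ : ℝ) (w : ℂ) : ℂ :=
  (1 / (‖k‖ : ℂ) ^ 2 * ∫ v, ((‖k‖ : ℂ) ^ 2 + Complex.I * w * (inner ℝ v k : ℝ)) / den k τ w v
      * (e 4 v : ℂ) ∂maxwellian) /
    (1 - ∫ v, (e 4 v : ℂ) / den k τ w v * (e 4 v : ℂ) ∂maxwellian)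

/-- The `k`-aligned basis vector `η(w) = (1, (i w / k²) k, θ(w))` of the direct computation. -/
def alignedBasis (k : V) (τ : ℝ) (w : ℂ) : Fin 5 → ℂ :=
  ![1,
    Complex.I * w / (‖k‖ : ℂ) ^ 2 * (k 0 : ℂ),
    Complex.I * w / (‖k‖ : ℂ) ^ 2 * (k 1 : ℂ),
    Complex.I * w / (‖k‖ : ℂ) ^ 2 * (k 2 : ℂ),
    spectralTemperature k τ w]

/-- The two shear basis vectors of the direct computation. -/
def shearBasis₁ (Q : Matrix (Fin 3) (Fin 3) ℝ) : Fin 5 → ℂ := tildeQ Q *ᵥ ![0, 0, 1, 0, 0]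

/-- See `shearBasis₁`. -/
def shearBasis₂ (Q : Matrix (Fin 3) (Fin 3) ℝ) : Fin 5 → ℂ := tildeQ Q *ᵥ ![0, 0, 0, 1, 0]

end BGK

end

/-! Put x = iτk and z = -τλ - 1. Multiplied by -τ, the equation (L - λ)f = g reads (iτ v·k - z)f =
P₅f - τg. For Re z < 0 the left side is multiplication by a function bounded away from zero, so f is
determined by g and its own five moments, and these solve a linear system with matrix G_S(z) - Id.
Hence, to the right of Re λ = -1/τ, the spectrum is the zero set of det(G_S - Id)
(`mem_opSpectrum_iff`), eigenspaces project onto its kernels (`moments_image_eigenspace`), and the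
resolvent compressed to the collision invariants is τ(Id + (G_S - Id)⁻¹) (`inner_bgkRes`). The
constant part has zero integral over a closed contour and dz = -τ dλ, so the compressed Riesz
projection is the integral of (G_S - Id)⁻¹.

The residue theorem needs the contour inside Re z < 0 and finitely many poles. The line Re λ = -1/τ
lies in the spectrum (`mem_opSpectrum_of_re_eq`), so a contour winding around a point of Λ cannot
leave its half-plane. Finiteness holds because Z continues to an entire Laplace integral for which
the determinant tends to -x⁵ ≠ 0 at infinity in the closed upper half-plane
(`finite_zeros_det_shiftedMat_lapl`).

Rotation invariance of the Gaussian gives G_S - Id = x⁻¹ Q̃ (G - x) Q̃ᵀ, and G - x splits into a 3 ×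
3 longitudinal block and the scalar Z - x taken twice. At a simple eigenvalue Z ≠ x, so the
longitudinal determinant vanishes and the adjugate has rank one, its last column being (Z - x)² a.
The pole is simple, since a double zero of the determinant would produce a Jordan chain
(`IsSimpleEigenvalue.deriv_det_ne_zero`). The first entry of a is nonzero because its vanishing
would give either a purely imaginary eigenvalue, excluded by dissipation, or a zero of a positive
integral (`heatFun_ne_zero`). The denominator of θ is treated by `thermal_ne_zero`.

For the shear mode, Re Z vanishes only on the imaginary axis, so Z = x becomes an equation for
Mills' ratio, which decreases strictly from √(π/2) to 0. There the determinant contains (Z - x)² and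
the adjugate Z - x, so the quotient has a simple pole. That the remaining factor, the longitudinal
determinant, does not vanish is a quartic inequality for Mills' ratio (`shear_quartic_pos`), proved
by a differential comparison argument. -/

noncomputable section

namespace BGK

/-! ### The block structure of Green's matrix -/

section Algebra

/-- The symmetric matrix with a full block on the indices `0, 1, 4` and a scalar block on the
indices `2, 3`. -/
def blockMat {R : Type*} [CommRing R] (a b c d f h t : R) : Matrix (Fin 5) (Fin 5) R :=
  !![a, b, 0, 0, c; b, d, 0, 0, f; 0, 0, t, 0, 0; 0, 0, 0, t, 0; c, f, 0, 0, h]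

/-- The determinant of the block on the indices `0, 1, 4` of `blockMat`. -/
def blockDet {R : Type*} [CommRing R] (a b c d f h : R) : R :=
  a * (d * h - f * f) - b * (b * h - f * c) + c * (b * f - d * c)

theorem det_blockMat {R : Type*} [CommRing R] (a b c d f h t : R) :
    (blockMat a b c d f h t).det = t ^ 2 * blockDet a b c d f h := by
  simp [blockMat, blockDet, Matrix.det_succ_row_zero, Fin.sum_univ_succ, Fin.succAbove]
  ring

-- Cofactors inside the 3 × 3 block acquire the determinant t² of the scalar block, while those of
-- the scalar block lose one factor t. Every entry is therefore divisible by t, which later lowers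
-- the pole order at the shear mode.
set_option maxHeartbeats 2000000 in
theorem adjugate_blockMat {R : Type*} [CommRing R] (a b c d f h t : R) :
    (blockMat a b c d f h t).adjugate =
      blockMat (t ^ 2 * (d * h - f * f)) (t ^ 2 * (f * c - b * h)) (t ^ 2 * (b * f - d * c))
        (t ^ 2 * (a * h - c * c)) (t ^ 2 * (b * c - a * f)) (t ^ 2 * (a * d - b * b))
        (t * blockDet a b c d f h) := by
  ext i j
  rw [Matrix.adjugate_fin_succ_eq_det_submatrix]
  fin_cases i <;> fin_cases j <;>
    simp [blockMat, blockDet, Matrix.det_succ_row_zero, Fin.sum_univ_succ, Fin.succAbove] <;> ring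

/-- The function `ζ + (ζ² - 1) W`; for `W = Z ζ` it is the Hilbert transform of `v² - 1`. -/
def heatFun (ζ W : ℂ) : ℂ := ζ + (ζ ^ 2 - 1) * W

/-- The matrix `G(ζ) - x` with the value of `Z` as an independent variable. -/
def shiftedMat (x ζ W : ℂ) : Matrix (Fin 5) (Fin 5) ℂ :=
  blockMat (W - x) (1 + ζ * W) (heatFun ζ W / √6) (ζ + ζ ^ 2 * W - x) (ζ * heatFun ζ W / √6)
    (((ζ ^ 2 - 1) * heatFun ζ W + 4 * W) / 6 - x) (W - x)

/-- The determinant of the longitudinal `3 × 3` block of `shiftedMat`. -/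
def longDet (x ζ W : ℂ) : ℂ :=
  blockDet (W - x) (1 + ζ * W) (heatFun ζ W / √6) (ζ + ζ ^ 2 * W - x) (ζ * heatFun ζ W / √6)
    (((ζ ^ 2 - 1) * heatFun ζ W + 4 * W) / 6 - x)

theorem ofReal_sqrt_six_sq : ((√6 : ℝ) : ℂ) ^ 2 = 6 := by
  rw [← Complex.ofReal_pow, Real.sq_sqrt (by norm_num)]
  norm_num

theorem ofReal_sqrt_six_ne_zero : ((√6 : ℝ) : ℂ) ≠ 0 := by
  rw [Complex.ofReal_ne_zero]
  positivity

theorem shiftedG_eq (k τ : ℝ) (ζ : ℂ) :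
    shiftedG k τ ζ = shiftedMat (Complex.I * τ * k) ζ (Z ζ) := by
  ext i j
  fin_cases i <;> fin_cases j <;>
    simp [shiftedG, G, shiftedMat, blockMat, heatFun] <;> ring

theorem det_shiftedMat (x ζ W : ℂ) :
    (shiftedMat x ζ W).det = (W - x) ^ 2 * longDet x ζ W := det_blockMat ..

/-- The entries containing √6 enter the determinant only in pairs, so it is a polynomial in x, ζ and
W, accessible to `ring`. -/
theorem longDet_eq (x ζ W : ℂ) : 6 * longDet x ζ W =
    (W - x) * ((ζ + ζ ^ 2 * W - x) * ((ζ ^ 2 - 1) * heatFun ζ W + 4 * W - 6 * x)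
      - ζ ^ 2 * heatFun ζ W ^ 2)
    - (1 + ζ * W) * ((1 + ζ * W) * ((ζ ^ 2 - 1) * heatFun ζ W + 4 * W - 6 * x)
      - ζ * heatFun ζ W ^ 2)
    + heatFun ζ W ^ 2 * ((1 + ζ * W) * ζ - (ζ + ζ ^ 2 * W - x)) := by
  have h := ofReal_sqrt_six_sq
  have h0 := ofReal_sqrt_six_ne_zero
  have h1 : ∀ a b : ℂ, a / (√6 : ℝ) * (b / (√6 : ℝ)) = a * b / 6 := fun a b => by
    rw [div_mul_div_comm, ← pow_two, h]
  have h2 : ∀ a b c d : ℂ, a / (√6 : ℝ) * (b * (c / (√6 : ℝ)) - d * (a / (√6 : ℝ)))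
    = a * (b * c - d * a) / 6 := fun a b c d => by
    rw [← mul_div_assoc, ← mul_div_assoc, ← sub_div, h1]
  rw [longDet, blockDet, h1, h1, h2]
  ring

theorem spectralFunctionZeta_eq (k τ : ℝ) (ζ : ℂ) :
    spectralFunctionZeta k τ ζ =
      1 / (Complex.I * τ * k) ^ 5 * (shiftedMat (Complex.I * τ * k) ζ (Z ζ)).det := by
  have h : (ζ + 6 * Complex.I * k ^ 3 * τ ^ 3 - ζ * (ζ ^ 2 + 5) * k ^ 2 * τ ^ 2
      + 2 * Complex.I * (ζ ^ 2 + 3) * k * τ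
      - 4 * Complex.I * Z ζ ^ 2 * ((ζ ^ 2 + 1) * k * τ - Complex.I * ζ)
      + Z ζ * (ζ ^ 2 - (ζ ^ 4 + 4 * ζ ^ 2 + 11) * k ^ 2 * τ ^ 2
        + 2 * Complex.I * k * τ * ζ ^ 3 - 5)) = 6 * longDet (Complex.I * τ * k) ζ (Z ζ) := by
    rw [longDet_eq, heatFun]
    ring_nf
    simp only [Complex.I_sq, Complex.I_pow_three]
    ring
  rw [spectralFunctionZeta, h, det_shiftedMat, show Complex.I * k * τ = Complex.I * τ * k by ring]
  field

/-- The vector `a` with the value of `Z` as an independent variable. -/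
def kerVec (x ζ W : ℂ) : Fin 5 → ℂ :=
  ![x / √6 * heatFun ζ W, 1 / √6 * (1 + x * ζ) * heatFun ζ W, 0, 0,
    x ^ 2 - 1 - x * ζ - (x + ζ + x * ζ ^ 2) * W]

theorem aVec_eq_kerVec (k τ : ℝ) (ζ : ℂ) :
    aVec k τ ζ = kerVec (Complex.I * τ * k) ζ (Z ζ) := by
  ext j
  fin_cases j
  · simp [aVec, kerVec, heatFun]
  · change 1 / ((√6 : ℝ) : ℂ) * (1 + Complex.I * k * τ * ζ) * _ =
      1 / ((√6 : ℝ) : ℂ) * (1 + Complex.I * τ * k * ζ) * _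
    rw [heatFun]
    ring
  · simp [aVec, kerVec]
  · simp [aVec, kerVec]
  · simp [aVec, kerVec, mul_pow]
    ring

/-- This is the origin of a: the cofactor column of the heat index. The coupling of index 4 to index
1 is ζ times its coupling c to index 0, so the first two cofactors collapse to x c and (1 + xζ) c.
-/
theorem adjugate_shiftedMat_col (x ζ W : ℂ) (i : Fin 5) :
    (shiftedMat x ζ W).adjugate i 4 = (W - x) ^ 2 * kerVec x ζ W i := by
  rw [shiftedMat, adjugate_blockMat]
  fin_cases i <;> simp [blockMat, kerVec] <;> left <;> ring

/-- On the zero set of the longitudinal determinant the adjugate has rank one. -/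
theorem adjugate_shiftedMat_mul (x ζ W : ℂ) (h : longDet x ζ W = 0) :
    kerVec x ζ W 4 • (shiftedMat x ζ W).adjugate =
      (W - x) ^ 2 • Matrix.vecMulVec (kerVec x ζ W) (kerVec x ζ W) := by
  rw [longDet, blockDet] at h
  rw [shiftedMat, adjugate_blockMat, blockDet, h]
  generalize hs : heatFun ζ W / (√6 : ℝ) = s at *
  have hs1 : ζ * heatFun ζ W / (√6 : ℝ) = ζ * s := by rw [← hs]; ring
  have hs2 : x / (√6 : ℝ) * heatFun ζ W = x * s := by rw [← hs]; ring
  have hs3 : ((√6 : ℝ) : ℂ)⁻¹ * (1 + x * ζ) * heatFun ζ W = (1 + x * ζ) * s := by rw [← hs]; ring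
  rw [hs1] at h ⊢
  generalize ((ζ ^ 2 - 1) * heatFun ζ W + 4 * W) / 6 - x = b at *
  ext i j
  fin_cases i <;> fin_cases j <;>
    simp [blockMat, kerVec, Matrix.vecMulVec, hs2, hs3]
  -- Jacobi's identity: a 2 × 2 minor of the adjugate of a 3 × 3 matrix is the determinant times the
  -- complementary entry, which supplies the coefficients.
  · linear_combination (W - x) ^ 2 * (ζ + ζ ^ 2 * W - x) * h
  · linear_combination - (W - x) ^ 2 * (1 + ζ * W) * h
  · ring
  · linear_combination - (W - x) ^ 2 * (1 + ζ * W) * h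
  · linear_combination (W - x) ^ 2 * (W - x) * h
  · ring
  · ring
  · ring
  · ring

theorem adjugate_shiftedMat_eq_smul (x ζ W : ℂ) (hW : W ≠ x) (h : longDet x ζ W = 0)
    (h0 : kerVec x ζ W 0 ≠ 0) : ∃ g : ℂ, g ≠ 0 ∧ (shiftedMat x ζ W).adjugate =
      g • Matrix.vecMulVec (kerVec x ζ W) (kerVec x ζ W) := by
  have hm := adjugate_shiftedMat_mul x ζ W h
  have h4 : kerVec x ζ W 4 ≠ 0 := by
    intro h4
    have := congrFun (congrFun hm 0) 0
    rw [h4] at this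
    simp [Matrix.vecMulVec, sub_eq_zero, hW, h0] at this
  refine ⟨(W - x) ^ 2 / kerVec x ζ W 4, div_ne_zero (pow_ne_zero _ (sub_ne_zero.2 hW)) h4, ?_⟩
  rw [div_eq_inv_mul, mul_smul, ← hm, smul_smul, inv_mul_cancel₀ h4, one_smul]

theorem shiftedMat_mulVec_kerVec (x ζ W : ℂ) (h : longDet x ζ W = 0) (hW : W ≠ x) :
    shiftedMat x ζ W *ᵥ kerVec x ζ W = 0 := by
  have h1 : (shiftedMat x ζ W).adjugate *ᵥ Pi.single 4 1 = (W - x) ^ 2 • kerVec x ζ W := by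
    ext i
    simp [adjugate_shiftedMat_col]
  have h2 : (W - x) ^ 2 • (shiftedMat x ζ W *ᵥ kerVec x ζ W) = 0 := by
    rw [← Matrix.mulVec_smul, ← h1, Matrix.mulVec_mulVec, Matrix.mul_adjugate, det_shiftedMat, h, mul_zero,
      zero_smul, Matrix.zero_mulVec]
  exact (smul_eq_zero.1 h2).resolve_left (pow_ne_zero _ (sub_ne_zero.2 hW))

/-- When the heat function vanishes, index 4 decouples. The block determinant is then the 2 × 2
minor of indices 0, 1, which is the last entry of a, times the remaining diagonal entry. -/
theorem longDet_of_heatFun_eq_zero (x ζ W : ℂ) (h : heatFun ζ W = 0) :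
    longDet x ζ W = kerVec x ζ W 4 * (2 / 3 * W - x) := by
  have := longDet_eq x ζ W
  simp only [h] at this
  simp only [kerVec, Matrix.cons_val]
  linear_combination this / 6

theorem kerVec_four_of_heatFun_eq_zero (x ζ W : ℂ) (h : heatFun ζ W = 0) :
    (1 - ζ ^ 2) * kerVec x ζ W 4 = x ^ 2 - (1 + x * ζ) ^ 2 := by
  simp only [kerVec, Matrix.cons_val]
  rw [heatFun] at h
  linear_combination (x + ζ + x * ζ ^ 2) * h

/-- The longitudinal determinant at a double root of the transverse factor. -/
theorem longDet_self (x ζ l : ℂ) (h : l = -(1 + ζ * x)) :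
    6 * x * longDet x ζ x = x ^ 4 + l ^ 4 + l ^ 3 - l * x ^ 2 := by
  have h6 := longDet_eq x ζ x
  rw [show 6 * x * longDet x ζ x = x * (6 * longDet x ζ x) by ring, h6, heatFun, h]
  ring

end Algebra

/-! ### The plasma dispersion function as a Laplace transform -/

section Laplace

/-- The integrand of `lapl`. -/
def laplKer (n : ℕ) (ζ : ℂ) (t : ℝ) : ℂ :=
  (t : ℂ) ^ n * Complex.exp (Complex.I * t * ζ - (t : ℂ) ^ 2 / 2)

/-- The entire function `∫₀^∞ tⁿ exp(i t ζ - t²/2) dt`. -/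
def lapl (n : ℕ) (ζ : ℂ) : ℂ := ∫ t in Ioi (0 : ℝ), laplKer n ζ t

theorem continuous_laplKer (n : ℕ) (ζ : ℂ) : Continuous (laplKer n ζ) := by
  unfold laplKer
  fun_prop

theorem norm_laplKer {t : ℝ} (ht : 0 ≤ t) (n : ℕ) (ζ : ℂ) :
    ‖laplKer n ζ t‖ = t ^ n * Real.exp (-(t * ζ.im) - t ^ 2 / 2) := by
  rw [laplKer, norm_mul, norm_pow, Complex.norm_real, Real.norm_of_nonneg ht, Complex.norm_exp]
  congr 2
  have : ((t : ℂ) ^ 2 / 2).re = t ^ 2 / 2 := by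
    rw [show (t : ℂ) ^ 2 / 2 = ((t ^ 2 / 2 : ℝ) : ℂ) by push_cast; ring, Complex.ofReal_re]
  rw [Complex.sub_re, this]
  simp

theorem integrableOn_pow_mul_exp_neg_sq (n : ℕ) :
    IntegrableOn (fun t : ℝ => t ^ n * Real.exp (-(t ^ 2 / 4))) (Ioi 0) := by
  have h := integrableOn_rpow_mul_exp_neg_mul_sq (b := 1 / 4) (by norm_num) (s := n)
    (by have : (0 : ℝ) ≤ n := n.cast_nonneg
        linarith)
  refine h.congr_fun (fun t _ => ?_) measurableSet_Ioi
  simp only [Real.rpow_natCast]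
  ring_nf

/-- Half of the Gaussian exponent pays for the growth exp(-t Im ζ), by (t/2 + Im ζ)² ≥ 0. The bound
is uniform in strips and serves as the dominating function for differentiation under the integral.
-/
theorem norm_laplKer_le {t : ℝ} (ht : 0 ≤ t) (n : ℕ) {ζ : ℂ} {R : ℝ} (hR : |ζ.im| ≤ R) :
    ‖laplKer n ζ t‖ ≤ Real.exp (R ^ 2) * (t ^ n * Real.exp (-(t ^ 2 / 4))) := by
  rw [norm_laplKer ht, mul_left_comm, ← Real.exp_add]
  refine mul_le_mul_of_nonneg_left (Real.exp_le_exp.2 ?_) (by positivity)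
  have h1 : ζ.im ^ 2 ≤ R ^ 2 := sq_le_sq' (by linarith [neg_abs_le ζ.im]) (by
    linarith [le_abs_self ζ.im])
  nlinarith [sq_nonneg (t / 2 + ζ.im)]

theorem norm_laplKer_le_of_im_nonneg {t : ℝ} (ht : 0 ≤ t) (n : ℕ) {ζ : ℂ} (hζ : 0 ≤ ζ.im) :
    ‖laplKer n ζ t‖ ≤ t ^ n * Real.exp (-(t ^ 2 / 4)) := by
  rw [norm_laplKer ht]
  refine mul_le_mul_of_nonneg_left (Real.exp_le_exp.2 ?_) (by positivity)
  nlinarith [mul_nonneg ht hζ, sq_nonneg t]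

theorem integrableOn_laplKer (n : ℕ) (ζ : ℂ) : IntegrableOn (laplKer n ζ) (Ioi 0) := by
  refine Integrable.mono' ((integrableOn_pow_mul_exp_neg_sq n).const_mul (Real.exp (|ζ.im| ^ 2)))
    (continuous_laplKer n ζ).aestronglyMeasurable ?_
  filter_upwards [ae_restrict_mem measurableSet_Ioi] with t ht
  exact norm_laplKer_le (le_of_lt ht) n le_rfl

theorem exists_norm_lapl_le (n : ℕ) : ∃ C : ℝ, ∀ ζ : ℂ, 0 ≤ ζ.im → ‖lapl n ζ‖ ≤ C := by
  refine ⟨_, fun ζ hζ => norm_integral_le_of_norm_le (integrableOn_pow_mul_exp_neg_sq n) ?_⟩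
  filter_upwards [ae_restrict_mem measurableSet_Ioi] with t ht
  exact norm_laplKer_le_of_im_nonneg (le_of_lt ht) n hζ

theorem hasDerivAt_laplKer_left (n : ℕ) (ζ : ℂ) (t : ℝ) :
    HasDerivAt (fun ζ => laplKer n ζ t) (Complex.I * laplKer (n + 1) ζ t) ζ := by
  have h : HasDerivAt (fun ζ : ℂ => Complex.I * t * ζ - (t : ℂ) ^ 2 / 2) (Complex.I * t) ζ := by
    simpa using ((hasDerivAt_id ζ).const_mul (Complex.I * t)).sub_const ((t : ℂ) ^ 2 / 2)
  refine (h.cexp.const_mul ((t : ℂ) ^ n)).congr_deriv ?_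
  rw [laplKer, pow_succ]
  ring

theorem hasDerivAt_lapl (n : ℕ) (ζ : ℂ) :
    HasDerivAt (lapl n) (Complex.I * lapl (n + 1) ζ) ζ := by
  have h := hasDerivAt_integral_of_dominated_loc_of_deriv_le (μ := volume.restrict (Ioi 0))
    (F := fun ζ t => laplKer n ζ t) (F' := fun ζ t => Complex.I * laplKer (n + 1) ζ t)
    (x₀ := ζ) (s := Metric.ball ζ 1)
    (bound := fun t => Real.exp ((|ζ.im| + 1) ^ 2) * (t ^ (n + 1) * Real.exp (-(t ^ 2 / 4))))
    (Metric.ball_mem_nhds ζ one_pos)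
    (Eventually.of_forall fun ζ => (continuous_laplKer n ζ).aestronglyMeasurable)
    (integrableOn_laplKer n ζ)
    ((continuous_laplKer (n + 1) ζ).const_mul _ |>.aestronglyMeasurable) ?_
    ((integrableOn_pow_mul_exp_neg_sq (n + 1)).const_mul _)
    (Eventually.of_forall fun t ξ _ => hasDerivAt_laplKer_left n ξ t)
  · refine h.2.congr_deriv ?_
    rw [integral_const_mul, lapl]
  · filter_upwards [ae_restrict_mem measurableSet_Ioi] with t ht ξ hξ
    rw [norm_mul, Complex.norm_I, one_mul]
    refine norm_laplKer_le (le_of_lt ht) _ ?_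
    have h1 : |ξ.im - ζ.im| ≤ ‖ξ - ζ‖ := by simpa using Complex.abs_im_le_norm (ξ - ζ)
    have h2 : ‖ξ - ζ‖ < 1 := by simpa [dist_eq_norm] using hξ
    have h3 := abs_sub_abs_le_abs_sub ξ.im ζ.im
    linarith

theorem differentiable_lapl (n : ℕ) : Differentiable ℂ (lapl n) := fun ζ =>
  (hasDerivAt_lapl n ζ).differentiableAt

/-- Integration of the derivative of the integrand over the half-line. The term `0 ^ n` is the
boundary value at t = 0; for n = 0 the truncated index n - 1 is harmless because of the factor n. -/
theorem lapl_succ (n : ℕ) (ζ : ℂ) :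
    lapl (n + 1) ζ = 0 ^ n + n * lapl (n - 1) ζ + Complex.I * ζ * lapl n ζ := by
  have hd : ∀ t : ℝ, HasDerivAt (laplKer n ζ)
      (n * laplKer (n - 1) ζ t + Complex.I * ζ * laplKer n ζ t - laplKer (n + 1) ζ t) t := by
    intro t
    have h0 : HasDerivAt (fun t : ℝ => (t : ℂ)) 1 t := Complex.ofRealCLM.hasDerivAt
    have h1 : HasDerivAt (fun t : ℝ => Complex.I * t * ζ - (t : ℂ) ^ 2 / 2)
        (Complex.I * ζ - t) t := by
      refine (((h0.const_mul Complex.I).mul_const ζ).sub ((h0.pow 2).div_const 2)).congr_deriv ?_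
      simp
    refine ((h0.pow n).mul h1.cexp).congr_deriv ?_
    simp only [laplKer, Pi.pow_apply]
    ring
  have ha : IntegrableOn (fun t : ℝ => n * laplKer (n - 1) ζ t) (Ioi 0) :=
    (integrableOn_laplKer (n - 1) ζ).const_mul _
  have hb : IntegrableOn (fun t : ℝ => Complex.I * ζ * laplKer n ζ t) (Ioi 0) :=
    (integrableOn_laplKer n ζ).const_mul _
  have hab : IntegrableOn (fun t : ℝ =>
      n * laplKer (n - 1) ζ t + Complex.I * ζ * laplKer n ζ t) (Ioi 0) := ha.add hb
  have hi : IntegrableOn (fun t : ℝ =>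
      n * laplKer (n - 1) ζ t + Complex.I * ζ * laplKer n ζ t - laplKer (n + 1) ζ t) (Ioi 0) :=
    hab.sub (integrableOn_laplKer (n + 1) ζ)
  have h := integral_Ioi_of_hasDerivAt_of_tendsto' (fun t _ => hd t) hi
    (tendsto_zero_of_hasDerivAt_of_integrableOn_Ioi (fun t _ => hd t) hi
      (integrableOn_laplKer n ζ))
  rw [integral_sub hab (integrableOn_laplKer (n + 1) ζ), integral_add ha hb, integral_const_mul,
    integral_const_mul] at h
  have h2 : laplKer n ζ 0 = 0 ^ n := by simp [laplKer]
  rw [h2] at h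
  simp only [lapl]
  linear_combination -h

theorem lapl_one (ζ : ℂ) : lapl 1 ζ = 1 + Complex.I * ζ * lapl 0 ζ := by
  simpa using lapl_succ 0 ζ

theorem lapl_two (ζ : ℂ) : lapl 2 ζ = lapl 0 ζ + Complex.I * ζ * lapl 1 ζ := by
  simpa using lapl_succ 1 ζ

theorem lapl_three (ζ : ℂ) : lapl 3 ζ = 2 * lapl 1 ζ + Complex.I * ζ * lapl 2 ζ := by
  simpa using lapl_succ 2 ζ

theorem lapl_four (ζ : ℂ) : lapl 4 ζ = 3 * lapl 2 ζ + Complex.I * ζ * lapl 3 ζ := by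
  simpa using lapl_succ 3 ζ

/-- The Laplace integrals decay at infinity in the closed upper half-plane. -/
theorem tendsto_lapl (n : ℕ) :
    Tendsto (lapl n) (Bornology.cobounded ℂ ⊓ 𝓟 {ζ | 0 ≤ ζ.im}) (𝓝 0) := by
  obtain ⟨C₁, h₁⟩ := exists_norm_lapl_le (n + 1)
  obtain ⟨C₂, h₂⟩ := exists_norm_lapl_le (n - 1)
  -- The recurrence solved for ζ times the integral: its other terms are bounded in the closed upper
  -- half-plane, which gives decay of order 1/|ζ|.
  have hb : ∀ ζ : ℂ, 0 ≤ ζ.im → ‖ζ‖ * ‖lapl n ζ‖ ≤ C₁ + 1 + n * C₂ := by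
    intro ζ hζ
    have h := lapl_succ n ζ
    have h3 : ‖Complex.I * ζ * lapl n ζ‖ = ‖lapl (n + 1) ζ - 0 ^ n - n * lapl (n - 1) ζ‖ := by
      rw [h]
      ring_nf
    rw [norm_mul, norm_mul, Complex.norm_I, one_mul] at h3
    rw [h3]
    have h4 : ‖(0 : ℂ) ^ n‖ ≤ 1 := by
      rcases n.eq_zero_or_pos with rfl | hn
      · simp
      · simp [hn.ne']
    have h5 : ‖(n : ℂ) * lapl (n - 1) ζ‖ ≤ n * C₂ := by
      rw [norm_mul, Complex.norm_natCast]
      exact mul_le_mul_of_nonneg_left (h₂ ζ hζ) n.cast_nonneg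
    calc _ ≤ ‖lapl (n + 1) ζ‖ + ‖(0 : ℂ) ^ n‖ + ‖(n : ℂ) * lapl (n - 1) ζ‖ :=
          (norm_sub_le _ _).trans (add_le_add_left (norm_sub_le _ _) _)
      _ ≤ _ := by linarith [h₁ ζ hζ]
  have ht : Tendsto (fun ζ : ℂ => (C₁ + 1 + n * C₂) * ‖ζ‖⁻¹)
      (Bornology.cobounded ℂ ⊓ 𝓟 {ζ | 0 ≤ ζ.im}) (𝓝 0) := by
    have h : Tendsto (fun ζ : ℂ => ‖ζ‖⁻¹) (Bornology.cobounded ℂ) (𝓝 0) :=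
      tendsto_inv_atTop_zero.comp tendsto_norm_cobounded_atTop
    have := h.const_mul (C₁ + 1 + n * C₂)
    rw [mul_zero] at this
    exact this.mono_left inf_le_left
  refine squeeze_zero_norm' ?_ ht
  have h0 : ∀ᶠ ζ : ℂ in Bornology.cobounded ℂ, 0 < ‖ζ‖ :=
    tendsto_norm_cobounded_atTop.eventually (eventually_gt_atTop 0)
  rw [eventually_inf_principal]
  filter_upwards [h0] with ζ h0 hζ
  rw [← div_eq_mul_inv, le_div_iff₀ h0, mul_comm]
  exact hb ζ hζ

theorem Z_eq_integral_gaussianReal (ζ : ℂ) : Z ζ = ∫ v : ℝ, ((v : ℂ) - ζ)⁻¹ ∂gaussianReal 0 1 := by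
  rw [integral_gaussianReal_eq_integral_smul one_ne_zero, Z, ← integral_const_mul]
  congr 1
  ext v
  simp only [gaussianPDFReal, NNReal.coe_one, mul_one, sub_zero, Complex.real_smul]
  push_cast
  rw [show (-(v : ℂ) ^ 2 / 2) = -(v : ℂ) ^ 2 / 2 by ring]
  ring

/-- For Im ζ > 0 the kernel 1/(v - ζ) is the integral of i exp(i(ζ - v)t) over t > 0. After Fubini
the integral over v is the characteristic function exp(-t²/2) of the Gaussian. -/
theorem Z_eq_lapl {ζ : ℂ} (hζ : 0 < ζ.im) : Z ζ = Complex.I * lapl 0 ζ := by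
  have h1 : ∀ v : ℝ, ((v : ℂ) - ζ)⁻¹ =
      ∫ t in Ioi (0 : ℝ), Complex.I * Complex.exp (Complex.I * (ζ - v) * t) := by
    intro v
    have hre : (Complex.I * (ζ - v)).re < 0 := by simpa using hζ
    have hne : Complex.I * (ζ - v) ≠ 0 := fun h => by simp [h] at hre
    have hne' : (v : ℂ) - ζ ≠ 0 := fun h => hne (by rw [← neg_sub, h]; simp)
    rw [integral_const_mul, integral_exp_mul_complex_Ioi hre]
    have hne2 : ζ - v ≠ 0 := by rw [← neg_sub]; exact neg_ne_zero.2 hne'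
    have hI := Complex.I_ne_zero
    simp only [Complex.ofReal_zero, mul_zero, Complex.exp_zero]
    rw [← neg_sub ζ, inv_neg]
    field_simp
  have hint : Integrable (Function.uncurry fun (v : ℝ) (t : ℝ) =>
      Complex.I * Complex.exp (Complex.I * (ζ - v) * t))
      ((gaussianReal 0 1).prod (volume.restrict (Ioi 0))) := by
    have hb : Integrable (fun t : ℝ => Real.exp (-ζ.im * t)) (volume.restrict (Ioi 0)) := by
      have := exp_neg_integrableOn_Ioi 0 hζ
      exact this
    have := (integrable_const (1 : ℝ) (μ := gaussianReal 0 1)).mul_prod hb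
    refine this.mono' (Continuous.aestronglyMeasurable (by fun_prop)) (Eventually.of_forall ?_)
    rintro ⟨v, t⟩
    simp [Function.uncurry, Complex.norm_exp]
  rw [Z_eq_integral_gaussianReal]
  simp_rw [h1]
  rw [integral_integral_swap hint, lapl, ← integral_const_mul]
  congr 1
  ext t
  rw [integral_const_mul]
  congr 1
  have h2 : ∀ v : ℝ, Complex.exp (Complex.I * (ζ - v) * t) =
      Complex.exp (Complex.I * t * ζ) * Complex.exp (((-t : ℝ) : ℂ) * v * Complex.I) := by
    intro v
    rw [← Complex.exp_add]
    push_cast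
    ring_nf
  simp_rw [h2]
  rw [integral_const_mul, ← charFun_apply_real, charFun_gaussianReal, laplKer, ← Complex.exp_add]
  simp
  ring_nf

theorem isOpen_im_pos : IsOpen {ζ : ℂ | 0 < ζ.im} := isOpen_lt continuous_const Complex.continuous_im

theorem Z_eventuallyEq {ζ : ℂ} (hζ : 0 < ζ.im) : Z =ᶠ[𝓝 ζ] fun ξ => Complex.I * lapl 0 ξ := by
  filter_upwards [isOpen_im_pos.mem_nhds hζ] with ξ hξ using Z_eq_lapl hξ

theorem hasDerivAt_Z {ζ : ℂ} (hζ : 0 < ζ.im) : HasDerivAt Z (-(1 + ζ * Z ζ)) ζ := by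
  have h := ((hasDerivAt_lapl 0 ζ).const_mul Complex.I).congr_of_eventuallyEq (Z_eventuallyEq hζ)
  refine h.congr_deriv ?_
  rw [Z_eq_lapl hζ, lapl_one]
  linear_combination (1 + Complex.I * ζ * lapl 0 ζ) * Complex.I_mul_I

/-- On the imaginary axis the right side is -i times a positive integral, so the heat function has
no zero there. -/
theorem heatFun_eq_lapl {ζ : ℂ} (hζ : 0 < ζ.im) : heatFun ζ (Z ζ) = -Complex.I * lapl 2 ζ := by
  rw [heatFun, Z_eq_lapl hζ, lapl_two, lapl_one]
  linear_combination (ζ + Complex.I * ζ ^ 2 * lapl 0 ζ) * Complex.I_mul_I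

end Laplace

/-! ### The plasma dispersion function off and on the imaginary axis -/

section Axis

theorem integrable_exp_neg_sq_div {ζ : ℂ} (hζ : 0 < ζ.im) :
    Integrable fun v : ℝ => Complex.exp (-(v : ℂ) ^ 2 / 2) / (v - ζ) := by
  have hne : ∀ v : ℝ, (v : ℂ) - ζ ≠ 0 := fun v h => by
    have := congrArg Complex.im h
    simp at this
    exact hζ.ne' this
  have hi : Integrable fun v : ℝ => Real.exp (-(1 / 2) * v ^ 2) * ζ.im⁻¹ :=
    (integrable_exp_neg_mul_sq (by norm_num)).mul_const _
  refine hi.mono' (Continuous.aestronglyMeasurable ?_) (Eventually.of_forall fun v => ?_)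
  · exact Continuous.div (by fun_prop) (by fun_prop) hne
  · have h1 : ζ.im ≤ ‖(v : ℂ) - ζ‖ := by
      have := Complex.abs_im_le_norm ((v : ℂ) - ζ)
      simp only [Complex.sub_im, Complex.ofReal_im, zero_sub, abs_neg] at this
      exact (le_abs_self _).trans this
    rw [norm_div, div_eq_mul_inv, show -(v : ℂ) ^ 2 / 2 = ((-(1 / 2) * v ^ 2 : ℝ) : ℂ) by
      push_cast; ring, ← Complex.ofReal_exp, Complex.norm_real, Real.norm_of_nonneg
      (Real.exp_pos _).le]
    exact mul_le_mul_of_nonneg_left (inv_anti₀ hζ h1) (Real.exp_pos _).le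

theorem mul_exp_sub_exp_neg {p c : ℝ} (hc : c ≠ 0) :
    c * (Real.exp (p - c) - Real.exp (p + c)) < 0 := by
  rcases lt_or_gt_of_ne hc with h | h
  · exact mul_neg_of_neg_of_pos h (sub_pos.2 (Real.exp_lt_exp.2 (by linarith)))
  · exact mul_neg_of_pos_of_neg h (sub_neg.2 (Real.exp_lt_exp.2 (by linarith)))

/-- In the upper half-plane `Z` is not purely imaginary off the imaginary axis. -/
theorem re_eq_zero_of_re_Z_eq_zero {ζ : ℂ} (hζ : 0 < ζ.im) (h : (Z ζ).re = 0) : ζ.re = 0 := by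
  by_contra ha
  set a := ζ.re with ha'
  set b := ζ.im with hb'
  have hint := integrable_exp_neg_sq_div hζ
  set F : ℝ → ℝ := fun v => Real.exp (-v ^ 2 / 2) * ((v - a) / ((v - a) ^ 2 + b ^ 2)) with hF
  have hre : ∀ v : ℝ, (Complex.exp (-(v : ℂ) ^ 2 / 2) / (v - ζ)).re = F v := by
    intro v
    rw [show -(v : ℂ) ^ 2 / 2 = ((-v ^ 2 / 2 : ℝ) : ℂ) by push_cast; ring, ← Complex.ofReal_exp,
      div_eq_mul_inv, Complex.re_ofReal_mul, Complex.inv_re, Complex.normSq_apply]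
    simp only [hF, Complex.sub_re, Complex.ofReal_re, Complex.sub_im, Complex.ofReal_im, ← ha',
      ← hb']
    ring_nf
  have hFi : Integrable F := by
    have := hint.re
    exact this.congr (Eventually.of_forall fun v => hre v)
  have hF0 : ∫ v, F v = 0 := by
    have h1 : (∫ v : ℝ, Complex.exp (-(v : ℂ) ^ 2 / 2) / (v - ζ)).re = ∫ v, F v := by
      rw [← integral_congr_ae (Eventually.of_forall hre)]
      exact (integral_re hint).symm
    rw [← h1]
    rw [Z, ← Complex.ofReal_inv, Complex.re_ofReal_mul] at h
    refine (mul_eq_zero.1 h).resolve_left (inv_ne_zero ?_)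
    positivity
  have hs : Integrable fun u => F (u + a) := hFi.comp_add_right a
  have hs' : Integrable fun u => F (-u + a) := hs.comp_neg
  have h1 : ∫ u, F (u + a) = 0 := by rw [integral_add_right_eq_self F a, hF0]
  have h2 : ∫ u, F (-u + a) = 0 := by
    rw [integral_neg_eq_self (fun u => F (u + a)), h1]
  -- After the shift v = u + a the factor u/(u² + b²) is odd. Adding the values at u and -u leaves a
  -- difference of two Gaussian weights with the sign of -ua, so the factor -a makes the symmetrized
  -- integrand positive for u ≠ 0, although its integral is zero.
  set K : ℝ → ℝ := fun u => -(a * (F (u + a) + F (-u + a))) with hK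
  have hKi : Integrable K := ((hs.add hs').const_mul a).neg
  have hK0 : ∫ u, K u = 0 := by
    rw [hK, integral_neg, integral_const_mul, integral_add hs hs', h1, h2]
    simp
  have hKeq : ∀ u, K u = -(u * a * (Real.exp (-(u ^ 2 + a ^ 2) / 2 - u * a)
      - Real.exp (-(u ^ 2 + a ^ 2) / 2 + u * a))) / (u ^ 2 + b ^ 2) := by
    intro u
    simp only [hK, hF]
    rw [show -(u + a) ^ 2 / 2 = -(u ^ 2 + a ^ 2) / 2 - u * a by ring,
      show -(-u + a) ^ 2 / 2 = -(u ^ 2 + a ^ 2) / 2 + u * a by ring]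
    ring_nf
  have hKpos : ∀ u, u ≠ 0 → 0 < K u := by
    intro u hu
    rw [hKeq]
    exact div_pos (neg_pos.2 (mul_exp_sub_exp_neg (mul_ne_zero hu ha))) (by positivity)
  have hKnn : 0 ≤ K := by
    intro u
    rcases eq_or_ne u 0 with rfl | hu
    · rw [hKeq]; simp
    · exact (hKpos u hu).le
  have hae := (integral_eq_zero_iff_of_nonneg hKnn hKi).1 hK0
  have hKc : Continuous K := by
    have : K = fun u => _ := funext hKeq
    rw [this]
    refine Continuous.div (by fun_prop) (by fun_prop) fun u => ?_
    positivity
  have := (hKc.ae_eq_iff_eq volume (g := 0) continuous_const).1 hae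
  have h3 := hKpos 1 one_ne_zero
  rw [this] at h3
  simp at h3

/-- The real Laplace integral `∫₀^∞ tⁿ exp(-σ t - t²/2) dt`; for `n = 0` this is Mills' ratio. -/
def rlap (n : ℕ) (σ : ℝ) : ℝ := ∫ t in Ioi (0 : ℝ), t ^ n * Real.exp (-(t * σ) - t ^ 2 / 2)

theorem laplKer_I_mul (n : ℕ) (σ t : ℝ) : laplKer n (Complex.I * σ) t =
    ((t ^ n * Real.exp (-(t * σ) - t ^ 2 / 2) : ℝ) : ℂ) := by
  rw [laplKer]
  push_cast
  rw [show Complex.I * t * (Complex.I * σ) = -(t * σ) by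
    linear_combination (t * σ : ℂ) * Complex.I_mul_I]

theorem lapl_I_mul (n : ℕ) (σ : ℝ) : lapl n (Complex.I * σ) = rlap n σ := by
  rw [lapl, rlap]
  simp_rw [laplKer_I_mul]
  exact integral_ofReal

theorem integrableOn_rlap (n : ℕ) (σ : ℝ) :
    IntegrableOn (fun t : ℝ => t ^ n * Real.exp (-(t * σ) - t ^ 2 / 2)) (Ioi 0) := by
  have := (integrableOn_laplKer n (Complex.I * σ)).re
  simp_rw [laplKer_I_mul] at this
  exact this

theorem rlap_pos (n : ℕ) (σ : ℝ) : 0 < rlap n σ := by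
  rw [rlap, setIntegral_pos_iff_support_of_nonneg_ae ?_ (integrableOn_rlap n σ)]
  · have : Ioi (0 : ℝ) ⊆ Function.support
        (fun t : ℝ => t ^ n * Real.exp (-(t * σ) - t ^ 2 / 2)) ∩ Ioi 0 := fun t ht =>
      ⟨(mul_pos (pow_pos ht n) (Real.exp_pos _)).ne', ht⟩
    refine lt_of_lt_of_le ?_ (measure_mono this)
    simp
  · filter_upwards [ae_restrict_mem measurableSet_Ioi] with t ht
    exact (mul_pos (pow_pos ht n) (Real.exp_pos _)).le

theorem hasDerivAt_rlap (n : ℕ) (σ : ℝ) : HasDerivAt (rlap n) (-rlap (n + 1) σ) σ := by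
  have h1 : HasDerivAt (fun z : ℂ => lapl n (Complex.I * z)) (-(rlap (n + 1) σ : ℂ)) (σ : ℂ) := by
    have h2 : HasDerivAt (fun z : ℂ => Complex.I * z) Complex.I (σ : ℂ) := by
      simpa using (hasDerivAt_id (σ : ℂ)).const_mul Complex.I
    refine ((hasDerivAt_lapl n (Complex.I * σ)).comp (σ : ℂ) h2).congr_deriv ?_
    rw [lapl_I_mul]
    linear_combination (rlap (n + 1) σ : ℂ) * Complex.I_mul_I
  have := h1.real_of_complex
  simp_rw [lapl_I_mul] at this
  simpa using this

theorem rlap_one (σ : ℝ) : rlap 1 σ = 1 - σ * rlap 0 σ := by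
  have := lapl_one (Complex.I * σ)
  rw [lapl_I_mul, lapl_I_mul] at this
  have h : (rlap 1 σ : ℂ) = ((1 - σ * rlap 0 σ : ℝ) : ℂ) := by
    push_cast
    linear_combination this + (σ * rlap 0 σ : ℂ) * Complex.I_mul_I
  exact_mod_cast h

theorem rlap_two (σ : ℝ) : rlap 2 σ = rlap 0 σ - σ * rlap 1 σ := by
  have := lapl_two (Complex.I * σ)
  rw [lapl_I_mul, lapl_I_mul, lapl_I_mul] at this
  have h : (rlap 2 σ : ℂ) = ((rlap 0 σ - σ * rlap 1 σ : ℝ) : ℂ) := by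
    push_cast
    linear_combination this + (σ * rlap 1 σ : ℂ) * Complex.I_mul_I
  exact_mod_cast h

theorem rlap_three (σ : ℝ) : rlap 3 σ = 2 * rlap 1 σ - σ * rlap 2 σ := by
  have := lapl_three (Complex.I * σ)
  rw [lapl_I_mul, lapl_I_mul, lapl_I_mul] at this
  have h : (rlap 3 σ : ℂ) = ((2 * rlap 1 σ - σ * rlap 2 σ : ℝ) : ℂ) := by
    push_cast
    linear_combination this + (σ * rlap 2 σ : ℂ) * Complex.I_mul_I
  exact_mod_cast h

theorem rlap_zero_zero : rlap 0 0 = √(Real.pi / 2) := by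
  have h := integral_gaussian_Ioi (1 / 2)
  rw [rlap]
  have h2 : (∫ t in Ioi (0 : ℝ), t ^ 0 * Real.exp (-(t * 0) - t ^ 2 / 2)) =
      ∫ x in Ioi (0 : ℝ), Real.exp (-(1 / 2) * x ^ 2) := by
    congr 1
    ext t
    ring_nf
  rw [h2, h, show Real.pi / (1 / 2) = 2 ^ 2 * (Real.pi / 2) by ring,
    Real.sqrt_mul (by norm_num), Real.sqrt_sq (by norm_num)]
  ring

theorem Z_I_mul {σ : ℝ} (hσ : 0 < σ) : Z (Complex.I * σ) = Complex.I * rlap 0 σ := by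
  rw [Z_eq_lapl (by simpa using hσ), lapl_I_mul]

theorem strictAnti_rlap (n : ℕ) : StrictAnti (rlap n) :=
  strictAnti_of_hasDerivAt_neg (fun σ => hasDerivAt_rlap n σ) fun σ => by
    simpa using rlap_pos (n + 1) σ

/-- Existence of the shear mode below the critical wave number. -/
theorem exists_rlap_eq {y : ℝ} (hy : 0 < y) (hy' : y < √(Real.pi / 2)) :
    ∃ σ : ℝ, 0 < σ ∧ rlap 0 σ = y := by
  have hcont : ContinuousOn (rlap 0) (Icc 0 (2 / y)) := fun σ _ =>
    (hasDerivAt_rlap 0 σ).continuousAt.continuousWithinAt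
  have hpos : 0 < 2 / y := by positivity
  -- Positivity of `rlap 1` says σ · `rlap 0 σ` < 1, so the value at σ = 2/y is even below y/2.
  have hle : rlap 0 (2 / y) ≤ y := by
    have h1 := rlap_one (2 / y)
    have h2 := rlap_pos 1 (2 / y)
    have h3 : 2 / y * rlap 0 (2 / y) < 1 := by linarith
    rw [div_mul_eq_mul_div, div_lt_one hy] at h3
    linarith [rlap_pos 0 (2 / y)]
  obtain ⟨σ, hσ, h⟩ := intermediate_value_Icc' hpos.le hcont ⟨hle, by
    rw [rlap_zero_zero]; exact hy'.le⟩
  refine ⟨σ, lt_of_le_of_ne hσ.1 ?_, h⟩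
  rintro rfl
  rw [rlap_zero_zero] at h
  exact hy'.ne' h

/-- A purely imaginary value of Z forces ζ onto the imaginary axis, and the complex equation becomes
a real one for Mills' ratio. -/
theorem exists_I_mul_of_Z_eq {ζ : ℂ} {y : ℝ} (hζ : 0 < ζ.im) (h : Z ζ = Complex.I * y) :
    0 < ζ.im ∧ ζ = Complex.I * ζ.im ∧ rlap 0 ζ.im = y := by
  have h0 : ζ.re = 0 := re_eq_zero_of_re_Z_eq_zero hζ (by rw [h]; simp)
  have h1 : ζ = Complex.I * ζ.im := by
    apply Complex.ext <;> simp [h0]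
  refine ⟨hζ, h1, ?_⟩
  rw [h1, Z_I_mul hζ] at h
  exact_mod_cast mul_left_cancel₀ Complex.I_ne_zero h

end Axis

/-! ### An inequality for Mills' ratio -/

section Mills

/-- Positivity of `rlap 2`, multiplied by σ, with `rlap 0` eliminated. -/
theorem rlap_one_mul_le (σ : ℝ) (hσ : 0 < σ) : (σ ^ 2 + 1) * rlap 1 σ < 1 := by
  have h1 := rlap_one σ
  have h2 := rlap_two σ
  have h3 := rlap_pos 2 σ
  nlinarith

/-- The function whose positivity separates the shear mode from the longitudinal modes. -/
def millsGap (σ : ℝ) : ℝ :=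
  1 - rlap 1 σ / rlap 0 σ ^ 2 - (rlap 1 σ / rlap 0 σ ^ 2) ^ 2 * (rlap 1 σ * (1 - rlap 1 σ))

/-- Write m, u for `rlap 0`, `rlap 1`. Substituting σ = (1 - u)/m expresses the derivative through m
and u alone. It is grouped as the gap itself minus a positive multiple of u(1 - u) - m²(1 - 2u), so
where the gap is nonpositive only the sign of the latter matters. -/
theorem hasDerivAt_millsGap (σ : ℝ) :
    HasDerivAt millsGap ((millsGap σ - 2 * rlap 1 σ ^ 2 *
      (rlap 1 σ * (1 - rlap 1 σ) - rlap 0 σ ^ 2 * (1 - 2 * rlap 1 σ)) / rlap 0 σ ^ 4)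
        / rlap 0 σ) σ := by
  have hm := hasDerivAt_rlap 0 σ
  have hu := hasDerivAt_rlap 1 σ
  have h0 := (rlap_pos 0 σ).ne'
  have hX := hu.div (hm.pow 2) (pow_ne_zero 2 h0)
  have h := ((hX.const_sub 1).sub ((hX.pow 2).mul (hu.mul (hu.const_sub 1))))
  refine (h.congr_of_eventuallyEq (Eventually.of_forall fun s => ?_)).congr_deriv ?_
  · simp [millsGap]
  · have hσ : σ = (1 - rlap 1 σ) / rlap 0 σ := by
      rw [eq_div_iff h0]
      linarith [rlap_one σ]
    have h2 : rlap 2 σ = rlap 0 σ - (1 - rlap 1 σ) / rlap 0 σ * rlap 1 σ := by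
      rw [← hσ]; exact rlap_two σ
    simp only [zero_add, Nat.reduceAdd, Nat.reduceSub, pow_one, Nat.cast_ofNat, millsGap,
      Pi.pow_apply, Pi.div_apply, Pi.mul_apply]
    rw [h2]
    field_simp
    ring

/-- Here u and Y stand for `rlap 1` and `rlap 0` squared, and `hE` says that the gap is nonpositive.
If the conclusion failed, then P ≥ u(1 - u), both factors in `h3` would be nonnegative, and the
extra term 4u⁴(1 - u)² would make the left side positive. -/
theorem mills_aux {u Y : ℝ} (hu : 0 < u) (hu1 : u < 1) (hY : 0 < Y)
    (hE : Y ^ 2 - u * Y - u ^ 3 * (1 - u) ≤ 0) : 0 < u * (1 - u) - Y * (1 - 2 * u) := by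
  by_contra! h
  have h1 : 0 < u * (1 - u) := mul_pos hu (by linarith)
  have h2 : 0 < 1 - 2 * u := by
    by_contra! h3
    nlinarith
  set P := Y * (1 - 2 * u) with hP
  have h3 : (1 - 2 * u) ^ 2 * (Y ^ 2 - u * Y - u ^ 3 * (1 - u)) =
      (P - u * (1 - u)) * (P + u * (1 - u) - u * (1 - 2 * u)) + 4 * u ^ 4 * (1 - u) ^ 2 := by
    rw [hP]; ring
  have h4 : 0 ≤ (P - u * (1 - u)) * (P + u * (1 - u) - u * (1 - 2 * u)) := by
    apply mul_nonneg <;> nlinarith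
  have h5 : 0 < 4 * u ^ 4 * (1 - u) ^ 2 := by
    have : 0 < 1 - u := by linarith
    positivity
  nlinarith [mul_nonneg (sq_nonneg (1 - 2 * u)) (neg_nonneg.2 hE)]

theorem rlap_one_lt_one {σ : ℝ} (hσ : 0 < σ) : rlap 1 σ < 1 := by
  rw [rlap_one]
  linarith [mul_pos hσ (rlap_pos 0 σ)]

theorem deriv_millsGap_neg {σ : ℝ} (hσ : 0 < σ) (h : millsGap σ ≤ 0) :
    (millsGap σ - 2 * rlap 1 σ ^ 2 *
      (rlap 1 σ * (1 - rlap 1 σ) - rlap 0 σ ^ 2 * (1 - 2 * rlap 1 σ)) / rlap 0 σ ^ 4)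
        / rlap 0 σ < 0 := by
  have h0 := rlap_pos 0 σ
  have h1 := rlap_pos 1 σ
  have hE : (rlap 0 σ ^ 2) ^ 2 - rlap 1 σ * rlap 0 σ ^ 2 - rlap 1 σ ^ 3 * (1 - rlap 1 σ) ≤ 0 := by
    have : (rlap 0 σ ^ 2) ^ 2 - rlap 1 σ * rlap 0 σ ^ 2 - rlap 1 σ ^ 3 * (1 - rlap 1 σ) =
        rlap 0 σ ^ 4 * millsGap σ := by
      rw [millsGap]
      field_simp
    rw [this]
    exact mul_nonpos_of_nonneg_of_nonpos (by positivity) h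
  have hN := mills_aux h1 (rlap_one_lt_one hσ) (by positivity) hE
  refine div_neg_of_neg_of_pos ?_ h0
  have : 0 < 2 * rlap 1 σ ^ 2 *
      (rlap 1 σ * (1 - rlap 1 σ) - rlap 0 σ ^ 2 * (1 - 2 * rlap 1 σ)) / rlap 0 σ ^ 4 := by
    positivity
  linarith

/-- With s = 1/σ² ≤ 1 and X = u/m², where m, u are `rlap 0`, `rlap 1`: X ≤ 1 + s costs s in the
linear term, and X² ≤ 4 with u(1 - u) ≤ s costs 4s in the other. Only the resulting lower bound zero
at infinity is needed. -/
theorem neg_five_div_le_millsGap {σ : ℝ} (hσ : 1 ≤ σ) : -(5 / σ ^ 2) ≤ millsGap σ := by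
  have hσ0 : 0 < σ := by linarith
  have h0 := rlap_pos 0 σ
  have h1 := rlap_pos 1 σ
  have h1' := rlap_one_lt_one hσ0
  have hle := rlap_one_mul_le σ hσ0
  set s : ℝ := 1 / σ ^ 2 with hs
  have hs0 : 0 < s := by positivity
  have hs1 : s ≤ 1 := by
    rw [hs, div_le_one (by positivity)]
    nlinarith
  have hss : s * σ ^ 2 = 1 := by rw [hs]; field_simp
  have hu : rlap 1 σ ≤ s := by
    rw [hs, le_div_iff₀ (by positivity)]
    nlinarith
  have hX : rlap 1 σ / rlap 0 σ ^ 2 ≤ 1 + s := by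
    rw [div_le_iff₀ (by positivity)]
    have h2 : σ * rlap 0 σ = 1 - rlap 1 σ := by rw [rlap_one]; ring
    have h3 : rlap 0 σ ^ 2 = s * (1 - rlap 1 σ) ^ 2 := by
      rw [← h2, mul_pow, ← mul_assoc, hss, one_mul]
    rw [h3]
    have h4 : (1 + s) * rlap 1 σ ≤ s := by
      have : (1 + s) * rlap 1 σ = s * ((σ ^ 2 + 1) * rlap 1 σ) := by
        linear_combination -(rlap 1 σ) * hss
      rw [this]
      nlinarith
    have h5 : 1 ≤ (1 + s) * (1 - rlap 1 σ) := by linarith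
    have h6 : 0 ≤ s * (1 - rlap 1 σ) := by
      apply mul_nonneg hs0.le; linarith
    have h7 : s * (1 - rlap 1 σ) ≤ (1 + s) * (s * (1 - rlap 1 σ) ^ 2) := by nlinarith
    have h8 : rlap 1 σ ≤ s * (1 - rlap 1 σ) := by linarith
    linarith
  have hX0 : 0 < rlap 1 σ / rlap 0 σ ^ 2 := by positivity
  have hw : rlap 1 σ * (1 - rlap 1 σ) ≤ s := by nlinarith
  have hw0 : 0 ≤ rlap 1 σ * (1 - rlap 1 σ) := mul_nonneg h1.le (by linarith)
  have hX2 : (rlap 1 σ / rlap 0 σ ^ 2) ^ 2 ≤ 4 := by nlinarith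
  have hp : (rlap 1 σ / rlap 0 σ ^ 2) ^ 2 * (rlap 1 σ * (1 - rlap 1 σ)) ≤ 4 * s :=
    mul_le_mul hX2 hw hw0 (by norm_num)
  rw [millsGap, show (5 : ℝ) / σ ^ 2 = 5 * s by rw [hs]; ring]
  linarith

theorem millsGap_pos {σ₀ : ℝ} (h0 : 0 < σ₀) : 0 < millsGap σ₀ := by
  by_contra! hneg
  -- The gap decreases strictly wherever it is nonpositive. Once nonpositive it would stay below a
  -- fixed negative value, against the lower bound -5/σ².
  have key : ∀ σ, 0 < σ → millsGap σ ≤ 0 → ∀ᶠ s in 𝓝[>] σ, millsGap s < millsGap σ := by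
    intro σ hσ h
    have hd := (hasDerivAt_millsGap σ).hasDerivWithinAt (s := Ioi σ)
    rw [hasDerivWithinAt_iff_tendsto_slope' (by simp)] at hd
    filter_upwards [hd.eventually (eventually_lt_nhds (deriv_millsGap_neg hσ h)),
      self_mem_nhdsWithin] with s hs hs'
    rw [slope_def_field] at hs
    rcases div_neg_iff.1 hs with h | h
    · exact absurd h.2 (not_lt.2 (sub_nonneg.2 (le_of_lt hs')))
    · linarith [h.1]
  obtain ⟨σ₁, hσ₁, h01⟩ := ((key σ₀ h0 hneg).and self_mem_nhdsWithin).exists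
  have h01' : σ₀ < σ₁ := h01
  have hneg1 : millsGap σ₁ < 0 := lt_of_lt_of_le hσ₁ hneg
  obtain ⟨σ₂, h12, h1, hb⟩ : ∃ σ₂, σ₁ < σ₂ ∧ 1 ≤ σ₂ ∧ millsGap σ₁ < -(5 / σ₂ ^ 2) := by
    have ht : Tendsto (fun s : ℝ => -(5 / s ^ 2)) atTop (𝓝 (-0)) :=
      ((tendsto_const_nhds (x := (5 : ℝ))).div_atTop (tendsto_pow_atTop (by norm_num))).neg
    rw [neg_zero] at ht
    obtain ⟨s, h1, h2, h3⟩ := ((eventually_gt_atTop σ₁).and ((eventually_ge_atTop 1).and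
      (ht.eventually (eventually_gt_nhds hneg1)))).exists
    exact ⟨s, h1, h2, h3⟩
  -- The minimum is not at the right end, where the lower bound exceeds the value at σ₁; anywhere
  -- else `key` produces a smaller value just to the right.
  obtain ⟨c, hc, hmin⟩ := isCompact_Icc.exists_isMinOn (nonempty_Icc.2 h12.le)
    (fun s _ => (hasDerivAt_millsGap s).continuousAt.continuousWithinAt)
  have hc1 : millsGap c ≤ millsGap σ₁ := hmin (left_mem_Icc.2 h12.le)
  have hc2 : c < σ₂ := by
    refine lt_of_le_of_ne hc.2 ?_
    rintro rfl
    linarith [neg_five_div_le_millsGap h1]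
  obtain ⟨s, hs, hs'⟩ := ((key c (by linarith [hc.1]) (by linarith)).and
    (Ioo_mem_nhdsGT hc2)).exists
  exact absurd (hmin (show s ∈ Icc σ₁ σ₂ from ⟨hc.1.trans hs'.1.le, hs'.2.le⟩)) (not_le.2 hs)

theorem shear_quartic_pos {σ : ℝ} (hσ : 0 < σ) :
    0 < rlap 0 σ ^ 4 + rlap 1 σ ^ 4 - rlap 1 σ ^ 3 - rlap 1 σ * rlap 0 σ ^ 2 := by
  have h0 := rlap_pos 0 σ
  have : rlap 0 σ ^ 4 + rlap 1 σ ^ 4 - rlap 1 σ ^ 3 - rlap 1 σ * rlap 0 σ ^ 2 =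
      rlap 0 σ ^ 4 * millsGap σ := by
    rw [millsGap]
    field_simp
    ring
  rw [this]
  exact mul_pos (by positivity) (millsGap_pos hσ)

end Mills

/-! ### Non-degeneracy of the modes -/

section Modes

/-- At a zero of the heat function the longitudinal determinant factors. Vanishing of the first
factor contradicts `hne`, which in the application excludes λ = ±ik. Vanishing of the second makes Z
purely imaginary, hence puts ζ on the axis, where the heat function has no zero. -/
theorem heatFun_ne_zero {y : ℝ} {ζ : ℂ} (hζ : 0 < ζ.im)
    (h : longDet (Complex.I * y) ζ (Z ζ) = 0)
    (hne : (Complex.I * y) ^ 2 ≠ (1 + Complex.I * y * ζ) ^ 2) : heatFun ζ (Z ζ) ≠ 0 := by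
  intro hq
  rw [longDet_of_heatFun_eq_zero _ _ _ hq] at h
  rcases mul_eq_zero.1 h with h4 | hZ
  · have := kerVec_four_of_heatFun_eq_zero (Complex.I * y) ζ (Z ζ) hq
    rw [h4, mul_zero] at this
    exact hne (sub_eq_zero.1 this.symm)
  · have hZ' : Z ζ = Complex.I * ((3 / 2 * y : ℝ) : ℂ) := by
      push_cast
      linear_combination 3 / 2 * hZ
    obtain ⟨h0, h1, -⟩ := exists_I_mul_of_Z_eq hζ hZ'
    rw [heatFun_eq_lapl hζ, h1, lapl_I_mul] at hq
    simp [(rlap_pos 2 ζ.im).ne'] at hq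

/-- This entry is, up to a factor, the denominator of θ. If it vanished, the last row of the kernel
equation for a would reduce to x + ζ + xζ² = 0, which forces ζ = iσ with y(σ² - 1) = σ. Mills' ratio
is then an explicit rational function of σ, incompatible with positivity of `rlap 3`. -/
theorem thermal_ne_zero {y : ℝ} (hy : 0 < y) {ζ : ℂ} (hζ : 0 < ζ.im)
    (h : longDet (Complex.I * y) ζ (Z ζ) = 0) (hW : Z ζ ≠ Complex.I * y)
    (hq : heatFun ζ (Z ζ) ≠ 0) :
    ((ζ ^ 2 - 1) * heatFun ζ (Z ζ) + 4 * Z ζ) / 6 - Complex.I * y ≠ 0 := by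
  intro hb
  have h4 := congrFun (shiftedMat_mulVec_kerVec _ _ _ h hW) 4
  simp only [shiftedMat, hb, blockMat, kerVec, Matrix.mulVec, dotProduct, Fin.sum_univ_five,
    Matrix.of_apply, Matrix.cons_val, Pi.zero_apply] at h4
  have h6 := ofReal_sqrt_six_ne_zero
  have h5 : Complex.I * y + ζ + Complex.I * y * ζ ^ 2 = 0 := by
    field_simp at h4
    have h7 : heatFun ζ (Z ζ) ^ 2 * (Complex.I * y + ζ + Complex.I * y * ζ ^ 2) = 0 := by
      linear_combination h4
    exact (mul_eq_zero.1 h7).resolve_left (pow_ne_zero 2 hq)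
  set a := ζ.re with ha
  set σ := ζ.im with hσ
  have hζe : ζ = a + Complex.I * σ := by
    apply Complex.ext <;> simp [ha, hσ]
  have hre : a * (1 - 2 * y * σ) = 0 := by
    have := congrArg Complex.re h5
    simp [pow_two, ← ha, ← hσ] at this
    linarith
  have him : y * (1 + a ^ 2 - σ ^ 2) + σ = 0 := by
    have := congrArg Complex.im h5
    simp [pow_two, ← ha, ← hσ] at this
    nlinarith
  -- Off the axis yσ = 1/2, and the imaginary part becomes y(1 + a²) + σ/2 > 0.
  have ha0 : a = 0 := by
    by_contra hne
    have h1 := (mul_eq_zero.1 hre).resolve_left hne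
    nlinarith [mul_pos hy hζ, sq_nonneg a]
  rw [ha0, Complex.ofReal_zero, zero_add] at hζe
  rw [ha0] at him
  have hb' : rlap 0 σ * ((σ ^ 2 + 1) ^ 2 + 4) = 6 * y + σ * (σ ^ 2 + 1) := by
    rw [hζe, Z_I_mul hζ, heatFun] at hb
    have hc : Complex.I * (((rlap 0 σ * ((σ ^ 2 + 1) ^ 2 + 4) : ℝ) : ℂ)) =
        Complex.I * ((6 * y + σ * (σ ^ 2 + 1) : ℝ) : ℂ) := by
      have hI := Complex.I_sq
      have hI4 : Complex.I ^ 4 = 1 := Complex.I_pow_four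
      push_cast
      ring_nf at hb ⊢
      rw [show Complex.I ^ 5 = Complex.I by rw [pow_succ, hI4, one_mul], Complex.I_pow_three] at hb
      linear_combination 6 * hb
    exact_mod_cast mul_left_cancel₀ Complex.I_ne_zero hc
  -- Positivity of `rlap 3` as an upper bound for Mills' ratio; the value prescribed by `hb'` and
  -- `hyσ` exceeds it, since the product below equals -14σ² - 10.
  have h3 : 0 < 2 + σ ^ 2 - σ * rlap 0 σ * (3 + σ ^ 2) := by
    have := rlap_pos 3 σ
    rw [rlap_three, rlap_two, rlap_one] at this
    linarith
  have hp : 0 < σ ^ 2 - 1 := by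
    have : y * (σ ^ 2 - 1) = σ := by linarith
    by_contra! hle
    nlinarith
  have hyσ : y * (σ ^ 2 - 1) = σ := by linarith
  have hm : rlap 0 σ * ((σ ^ 2 + 1) ^ 2 + 4) * (σ ^ 2 - 1) = σ * (σ ^ 4 + 5) := by
    rw [hb']
    linear_combination 6 * hyσ
  have hpos : 0 < (2 + σ ^ 2 - σ * rlap 0 σ * (3 + σ ^ 2)) *
      (((σ ^ 2 + 1) ^ 2 + 4) * (σ ^ 2 - 1)) := mul_pos h3 (by positivity)
  have he : (2 + σ ^ 2 - σ * rlap 0 σ * (3 + σ ^ 2)) * (((σ ^ 2 + 1) ^ 2 + 4) * (σ ^ 2 - 1)) =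
      -14 * σ ^ 2 - 10 := by
    linear_combination -(σ * (3 + σ ^ 2)) * hm
  rw [he] at hpos
  nlinarith [sq_nonneg σ]

/-- At ζ = iσ and x = i `rlap 0 σ` the number -(1 + ζx) is -`rlap 1 σ`, and `longDet_self` turns the
determinant into the quartic in Mills' ratio. -/
theorem longDet_shear_ne_zero {σ : ℝ} (hσ : 0 < σ) :
    longDet (Complex.I * rlap 0 σ) (Complex.I * σ) (Complex.I * rlap 0 σ) ≠ 0 := by
  intro h
  have h1 := longDet_self (Complex.I * rlap 0 σ) (Complex.I * σ) (-(rlap 1 σ : ℂ)) (by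
    rw [rlap_one]
    push_cast
    linear_combination (σ * rlap 0 σ : ℂ) * Complex.I_mul_I)
  rw [h, mul_zero, mul_pow, mul_pow, Complex.I_sq, Complex.I_pow_four] at h1
  have h2 : ((rlap 0 σ ^ 4 + rlap 1 σ ^ 4 - rlap 1 σ ^ 3 - rlap 1 σ * rlap 0 σ ^ 2 : ℝ) : ℂ) =
      ((0 : ℝ) : ℂ) := by
    push_cast
    linear_combination -h1
  exact (shear_quartic_pos hσ).ne' (by exact_mod_cast h2)

end Modes

/-! ### Gaussian integrals -/

section Gaussian

/-- `f` is integrable with integral `c`. -/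
def HasInt {α : Type*} [MeasurableSpace α] (μ : Measure α) (f : α → ℂ) (c : ℂ) : Prop :=
  Integrable f μ ∧ ∫ x, f x ∂μ = c

theorem HasInt.add {α : Type*} [MeasurableSpace α] {μ : Measure α} {f g : α → ℂ} {a b : ℂ}
    (hf : HasInt μ f a) (hg : HasInt μ g b) : HasInt μ (fun x => f x + g x) (a + b) :=
  ⟨hf.1.add hg.1, by rw [integral_add hf.1 hg.1, hf.2, hg.2]⟩

theorem HasInt.const_mul {α : Type*} [MeasurableSpace α] {μ : Measure α} {f : α → ℂ} {a : ℂ}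
    (hf : HasInt μ f a) (c : ℂ) : HasInt μ (fun x => c * f x) (c * a) :=
  ⟨hf.1.const_mul c, by rw [integral_const_mul, hf.2]⟩

theorem HasInt.congr {α : Type*} [MeasurableSpace α] {μ : Measure α} {f g : α → ℂ} {a b : ℂ}
    (hf : HasInt μ f a) (h : ∀ x, g x = f x) (hab : b = a) : HasInt μ g b := by
  rw [show g = f from funext h, hab]
  exact hf

theorem HasInt.sum {α ι : Type*} [MeasurableSpace α] {μ : Measure α} {s : Finset ι}
    {f : ι → α → ℂ} {a : ι → ℂ} (hf : ∀ i ∈ s, HasInt μ (f i) (a i)) :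
    HasInt μ (fun x => ∑ i ∈ s, f i x) (∑ i ∈ s, a i) :=
  ⟨integrable_finsetSum s fun i hi => (hf i hi).1, by
    rw [integral_finsetSum s fun i hi => (hf i hi).1]
    exact Finset.sum_congr rfl fun i hi => (hf i hi).2⟩

/-- The standard Gaussian measure on the line. -/
abbrev gauss : Measure ℝ := gaussianReal 0 1

theorem integrable_pow_gauss (n : ℕ) : Integrable (fun t : ℝ => t ^ n) gauss := by
  have h : MemLp id (n : ENNReal) gauss := memLp_id_gaussianReal' n (by simp)
  have := h.integrable_norm_pow'
  refine this.mono' (by fun_prop) (Eventually.of_forall fun t => ?_)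
  simp

/-- The density satisfies p' = -t p; the derivative of p tⁿ integrates to zero. -/
theorem integral_pow_gauss_succ (n : ℕ) :
    ∫ t : ℝ, t ^ (n + 1) ∂gauss = n * ∫ t : ℝ, t ^ (n - 1) ∂gauss := by
  have hw : ∀ n : ℕ, Integrable fun t : ℝ => gaussianPDFReal 0 1 t * t ^ n := by
    intro n
    have h := integrable_pow_gauss n
    rw [gauss, gaussianReal_of_var_ne_zero _ one_ne_zero,
      integrable_withDensity_iff_integrable_smul' (by fun_prop)
      (ae_of_all _ fun _ => gaussianPDF_lt_top)] at h
    refine h.congr (Eventually.of_forall fun t => ?_)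
    simp [gaussianPDF, gaussianPDFReal_nonneg]
  have hd : ∀ t : ℝ, HasDerivAt (fun t : ℝ => gaussianPDFReal 0 1 t * t ^ n)
      (n * (gaussianPDFReal 0 1 t * t ^ (n - 1)) - gaussianPDFReal 0 1 t * t ^ (n + 1)) t := by
    intro t
    have h1 : HasDerivAt (fun t : ℝ => -(t - 0) ^ 2 / (2 * ((1 : NNReal) : ℝ))) (-t) t := by
      refine ((((hasDerivAt_id t).sub_const 0).pow 2).neg.div_const _).congr_deriv ?_
      simp
      ring
    have h2 := (h1.exp.const_mul (√(2 * Real.pi * ((1 : NNReal) : ℝ)))⁻¹).mul (hasDerivAt_pow n t)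
    refine h2.congr_deriv ?_
    simp only [gaussianPDFReal]
    ring
  have h := integral_eq_zero_of_hasDerivAt_of_integrable hd
    (((hw (n - 1)).const_mul _).sub (hw (n + 1))) (hw n)
  rw [integral_sub ((hw (n - 1)).const_mul _) (hw (n + 1)), integral_const_mul] at h
  rw [integral_gaussianReal_eq_integral_smul one_ne_zero,
    integral_gaussianReal_eq_integral_smul one_ne_zero]
  simp only [smul_eq_mul]
  linarith

theorem hasInt_pow_gauss (n : ℕ) {c : ℝ} (h : ∫ t : ℝ, t ^ n ∂gauss = c) :
    HasInt gauss (fun t : ℝ => (t : ℂ) ^ n) c := by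
  have hi := (integrable_pow_gauss n).ofReal (𝕜 := ℂ)
  refine ⟨by simpa using hi, ?_⟩
  rw [← h, ← integral_complex_ofReal]
  simp

theorem hasInt_gauss_zero : HasInt gauss (fun t : ℝ => (t : ℂ) ^ 0) 1 := by
  simpa using hasInt_pow_gauss 0 (c := 1) (by simp)

theorem hasInt_gauss_one : HasInt gauss (fun t : ℝ => (t : ℂ) ^ 1) 0 := by
  simpa using hasInt_pow_gauss 1 (c := 0) (by simp)

theorem hasInt_gauss_two : HasInt gauss (fun t : ℝ => (t : ℂ) ^ 2) 1 := by
  simpa using hasInt_pow_gauss 2 (c := 1) (by simpa using integral_pow_gauss_succ 1)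

theorem hasInt_gauss_three : HasInt gauss (fun t : ℝ => (t : ℂ) ^ 3) 0 := by
  have h : ∫ t : ℝ, t ^ 3 ∂gauss = 0 := by
    have := integral_pow_gauss_succ 2
    simpa using this
  simpa using hasInt_pow_gauss 3 h

theorem hasInt_gauss_four : HasInt gauss (fun t : ℝ => (t : ℂ) ^ 4) 3 := by
  have h : ∫ t : ℝ, t ^ 4 ∂gauss = 3 := by
    have := integral_pow_gauss_succ 3
    have h2 : ∫ t : ℝ, t ^ 2 ∂gauss = 1 := by simpa using integral_pow_gauss_succ 1
    simpa [h2] using this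
  simpa using hasInt_pow_gauss 4 h

/-- The product of three Gaussian lines. -/
abbrev gauss₃ : Measure (Fin 3 → ℝ) := Measure.pi fun _ => gauss

theorem hasInt_prod {f g h : ℝ → ℂ} {a b c : ℂ} (hf : HasInt gauss f a) (hg : HasInt gauss g b)
    (hh : HasInt gauss h c) :
    HasInt gauss₃ (fun x => f (x 0) * g (x 1) * h (x 2)) (a * b * c) := by
  set F : Fin 3 → ℝ → ℂ := ![f, g, h] with hF
  have h1 : ∀ x : Fin 3 → ℝ, f (x 0) * g (x 1) * h (x 2) = ∏ i, F i (x i) := by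
    intro x
    simp [hF, Fin.prod_univ_three]
  refine ⟨?_, ?_⟩
  · simp_rw [h1]
    refine Integrable.fintype_prod (f := F) (μ := fun _ => gauss) fun i => ?_
    fin_cases i
    exacts [hf.1, hg.1, hh.1]
  · simp_rw [h1]
    rw [integral_fintype_prod_eq_prod (μ := fun _ => gauss) (f := F), Fin.prod_univ_three]
    simp [hF, hf.2, hg.2, hh.2]

theorem hasInt_gauss_hermite : HasInt gauss (fun t : ℝ => (t : ℂ) ^ 2 - 1) 0 :=
  (hasInt_gauss_two.add (hasInt_gauss_zero.const_mul (-1))).congr (fun t => by ring) (by ring)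

theorem hasInt_gauss_mul_hermite : HasInt gauss (fun t : ℝ => t * ((t : ℂ) ^ 2 - 1)) 0 :=
  (hasInt_gauss_three.add (hasInt_gauss_one.const_mul (-1))).congr (fun t => by ring) (by ring)

theorem hasInt_gauss_hermite_sq : HasInt gauss (fun t : ℝ => ((t : ℂ) ^ 2 - 1) ^ 2) 2 :=
  ((hasInt_gauss_four.add (hasInt_gauss_two.const_mul (-2))).add hasInt_gauss_zero).congr
    (fun t => by ring) (by ring)

theorem e_four (x : Fin 3 → ℝ) : (e 4 (WithLp.toLp 2 x) : ℂ) =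
    (((x 0 : ℂ) ^ 2 - 1) + ((x 1 : ℂ) ^ 2 - 1) + ((x 2 : ℂ) ^ 2 - 1)) / √6 := by
  simp only [e, Matrix.cons_val, EuclideanSpace.real_norm_sq_eq, Fin.sum_univ_three]
  push_cast
  ring

/-- Gaussian integrals of products of two collision invariants with a weight that depends on the
first component of the velocity. -/
theorem hasInt_mul_e_mul_e {w : ℝ → ℂ} {A B C D F H : ℂ}
    (hA : HasInt gauss w A) (hB : HasInt gauss (fun t => w t * t) B)
    (hC : HasInt gauss (fun t => w t * ((t : ℂ) ^ 2 - 1)) C)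
    (hD : HasInt gauss (fun t => w t * (t : ℂ) ^ 2) D)
    (hF : HasInt gauss (fun t => w t * (t * ((t : ℂ) ^ 2 - 1))) F)
    (hH : HasInt gauss (fun t => w t * ((t : ℂ) ^ 2 - 1) ^ 2) H) (n m : Fin 5) :
    HasInt maxwellian (fun v => w (v 0) * (e n v : ℂ) * (e m v : ℂ))
      (blockMat A B (C / √6) D (F / √6) ((H + 4 * A) / 6) A n m) := by
  suffices h : ∀ n m : Fin 5, n ≤ m → HasInt gauss₃ (fun x => w (x 0) *
      (e n (WithLp.toLp 2 x) : ℂ) * (e m (WithLp.toLp 2 x) : ℂ))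
      (blockMat A B (C / √6) D (F / √6) ((H + 4 * A) / 6) A n m) by
    have h' : HasInt gauss₃ (fun x => w (x 0) *
        (e n (WithLp.toLp 2 x) : ℂ) * (e m (WithLp.toLp 2 x) : ℂ))
        (blockMat A B (C / √6) D (F / √6) ((H + 4 * A) / 6) A n m) := by
      rcases le_total n m with hnm | hnm
      · exact h n m hnm
      · refine (h m n hnm).congr (fun x => by ring) ?_
        fin_cases n <;> fin_cases m <;> rfl
    have hmap : maxwellian = gauss₃.map (MeasurableEquiv.toLp 2 (Fin 3 → ℝ)) :=
      map_pi_eq_stdGaussian.symm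
    rw [hmap]
    refine ⟨?_, ?_⟩
    · rw [integrable_map_equiv]
      exact h'.1
    · rw [integral_map_equiv]
      exact h'.2
  have h1 := hasInt_gauss_zero
  have ht := hasInt_gauss_one
  have h2 := hasInt_gauss_two
  have hh := hasInt_gauss_hermite
  have hth := hasInt_gauss_mul_hermite
  have hhh := hasInt_gauss_hermite_sq
  have h6 := ofReal_sqrt_six_sq
  have h60 := ofReal_sqrt_six_ne_zero
  have e0 : ∀ x : Fin 3 → ℝ, (e 0 (WithLp.toLp 2 x) : ℂ) = 1 := fun x => by simp [e]
  have e1 : ∀ x : Fin 3 → ℝ, (e 1 (WithLp.toLp 2 x) : ℂ) = x 0 := fun x => by simp [e]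
  have e2 : ∀ x : Fin 3 → ℝ, (e 2 (WithLp.toLp 2 x) : ℂ) = x 1 := fun x => by simp [e]
  have e3 : ∀ x : Fin 3 → ℝ, (e 3 (WithLp.toLp 2 x) : ℂ) = x 2 := fun x => by simp [e]
  intro n m hnm
  fin_cases n <;> fin_cases m <;> first | (exact absurd hnm (by decide)) | skip
  · exact (hasInt_prod hA h1 h1).congr (fun x => by simp [e0]) (by simp [blockMat])
  · exact (hasInt_prod hB h1 h1).congr (fun x => by simp [e0, e1]) (by simp [blockMat])
  · exact (hasInt_prod hA ht h1).congr (fun x => by simp [e0, e2]) (by simp [blockMat])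
  · exact (hasInt_prod hA h1 ht).congr (fun x => by simp [e0, e3]) (by simp [blockMat])
  · exact ((((hasInt_prod hC h1 h1).add (hasInt_prod hA hh h1)).add
      (hasInt_prod hA h1 hh)).const_mul (1 / √6)).congr
      (fun x => by simp [e0, e_four]; ring) (by simp [blockMat]; ring)
  · exact (hasInt_prod hD h1 h1).congr (fun x => by simp [e1]; ring) (by simp [blockMat])
  · exact (hasInt_prod hB ht h1).congr (fun x => by simp [e1, e2]) (by simp [blockMat])
  · exact (hasInt_prod hB h1 ht).congr (fun x => by simp [e1, e3]) (by simp [blockMat])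
  · exact ((((hasInt_prod hF h1 h1).add (hasInt_prod hB hh h1)).add
      (hasInt_prod hB h1 hh)).const_mul (1 / √6)).congr
      (fun x => by simp [e1, e_four]; ring) (by simp [blockMat]; ring)
  · exact (hasInt_prod hA h2 h1).congr (fun x => by simp [e2]; ring) (by simp [blockMat])
  · exact (hasInt_prod hA ht ht).congr (fun x => by simp [e2, e3]) (by simp [blockMat])
  · exact ((((hasInt_prod hC ht h1).add (hasInt_prod hA hth h1)).add
      (hasInt_prod hA ht hh)).const_mul (1 / √6)).congr
      (fun x => by simp [e2, e_four]; ring) (by simp [blockMat])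
  · exact (hasInt_prod hA h1 h2).congr (fun x => by simp [e3]; ring) (by simp [blockMat])
  · exact ((((hasInt_prod hC h1 ht).add (hasInt_prod hA hh ht)).add
      (hasInt_prod hA h1 hth)).const_mul (1 / √6)).congr
      (fun x => by simp [e3, e_four]; ring) (by simp [blockMat])
  -- The square of a sum of three Hermite polynomials: each transverse square contributes 2A, hence
  -- the term 4A, while every mixed product contains a transverse factor of mean zero.
  · exact (((((hasInt_prod hH h1 h1).add (hasInt_prod hA hhh h1)).add
      (hasInt_prod hA h1 hhh)).add ((((hasInt_prod hC hh h1).add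
      (hasInt_prod hC h1 hh)).add (hasInt_prod hA hh hh)).const_mul 2)).const_mul (1 / 6)).congr
      (fun x => by
        change w (x 0) * (e 4 (WithLp.toLp 2 x) : ℂ) * (e 4 (WithLp.toLp 2 x) : ℂ) = _
        rw [e_four, mul_assoc, div_mul_div_comm, ← pow_two (√6 : ℂ), h6]; ring)
      (by simp [blockMat]; ring)

theorem hasInt_e_mul_e (n m : Fin 5) :
    HasInt maxwellian (fun v => (e n v : ℂ) * (e m v : ℂ)) ((1 : Matrix (Fin 5) (Fin 5) ℂ) n m) := by
  have h := hasInt_mul_e_mul_e (w := fun _ => 1) (A := 1) (B := 0) (C := 0) (D := 1) (F := 0)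
    (H := 2) (hasInt_gauss_zero.congr (fun t => by simp) rfl)
    (hasInt_gauss_one.congr (fun t => by simp) rfl)
    (hasInt_gauss_hermite.congr (fun t => by simp) rfl)
    (hasInt_gauss_two.congr (fun t => by simp) rfl)
    (hasInt_gauss_mul_hermite.congr (fun t => by simp) rfl)
    (hasInt_gauss_hermite_sq.congr (fun t => by simp) rfl) n m
  refine h.congr (fun v => by ring) ?_
  fin_cases n <;> fin_cases m <;> simp [blockMat] <;> norm_num

/-- The Hilbert transforms of the Gaussian moments. -/
theorem hasInt_pow_div {ζ : ℂ} (hζ : 0 < ζ.im) (n : ℕ) :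
    ∃ c, HasInt gauss (fun t : ℝ => ((t : ℂ) - ζ)⁻¹ * (t : ℂ) ^ n) c := by
  refine ⟨_, ?_, rfl⟩
  have hi : Integrable (fun t : ℝ => (t : ℂ) ^ n) gauss := by
    simpa using (integrable_pow_gauss n).ofReal (𝕜 := ℂ)
  refine hi.bdd_mul (c := ζ.im⁻¹) (Measurable.aestronglyMeasurable (by fun_prop))
    (Eventually.of_forall fun v => ?_)
  have h1 : ζ.im ≤ ‖(v : ℂ) - ζ‖ := by
    have := Complex.abs_im_le_norm ((v : ℂ) - ζ)
    simp only [Complex.sub_im, Complex.ofReal_im, zero_sub, abs_neg] at this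
    exact (le_abs_self _).trans this
  rw [norm_inv]
  exact inv_anti₀ hζ h1

/-- The identity t/(t - ζ) = 1 + ζ/(t - ζ), which reduces all polynomial weights to Z. -/
theorem HasInt.mul_div {ζ : ℂ} (hζ : 0 < ζ.im) {n : ℕ} {c d : ℂ}
    (hc : HasInt gauss (fun t : ℝ => ((t : ℂ) - ζ)⁻¹ * (t : ℂ) ^ n) c)
    (hd : HasInt gauss (fun t : ℝ => (t : ℂ) ^ n) d) :
    HasInt gauss (fun t : ℝ => ((t : ℂ) - ζ)⁻¹ * (t : ℂ) ^ (n + 1)) (d + ζ * c) := by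
  refine (hd.add (hc.const_mul ζ)).congr (fun t => ?_) rfl
  have hne : (t : ℂ) - ζ ≠ 0 := fun h => by
    have := congrArg Complex.im h
    simp at this
    exact hζ.ne' this
  field_simp
  ring

/-- Green's matrix for a wave vector along the first axis, up to the factor `(i k τ)⁻¹`. -/
theorem hasInt_div_e_mul_e {ζ : ℂ} (hζ : 0 < ζ.im) (n m : Fin 5) :
    HasInt maxwellian (fun v => ((v 0 : ℂ) - ζ)⁻¹ * (e n v : ℂ) * (e m v : ℂ)) (G ζ n m) := by
  have h0 : HasInt gauss (fun t : ℝ => ((t : ℂ) - ζ)⁻¹ * (t : ℂ) ^ 0) (Z ζ) := by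
    obtain ⟨c, hc⟩ := hasInt_pow_div hζ 0
    refine ⟨hc.1, ?_⟩
    rw [Z_eq_integral_gaussianReal]
    simp
  have h1 := h0.mul_div hζ hasInt_gauss_zero
  have h2 := h1.mul_div hζ hasInt_gauss_one
  have h3 := h2.mul_div hζ hasInt_gauss_two
  have h4 := h3.mul_div hζ hasInt_gauss_three
  have h := hasInt_mul_e_mul_e (w := fun t : ℝ => ((t : ℂ) - ζ)⁻¹) (A := Z ζ) (B := 1 + ζ * Z ζ)
    (C := heatFun ζ (Z ζ)) (D := ζ + ζ ^ 2 * Z ζ) (F := ζ * heatFun ζ (Z ζ))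
    (H := (ζ ^ 2 - 1) * heatFun ζ (Z ζ))
    (h0.congr (fun t => by simp) rfl) (h1.congr (fun t => by simp) rfl)
    ((h2.add (h0.const_mul (-1))).congr (fun t => by ring) (by rw [heatFun]; ring))
    (h2.congr (fun t => by ring) (by ring))
    ((h3.add (h1.const_mul (-1))).congr (fun t => by ring) (by rw [heatFun]; ring))
    (((h4.add (h2.const_mul (-2))).add h0).congr (fun t => by ring) (by rw [heatFun]; ring)) n m
  refine h.congr (fun v => rfl) ?_
  fin_cases n <;> fin_cases m <;> simp [blockMat, G, heatFun] <;> ring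

end Gaussian

/-! ### Rotation of the wave vector -/

section Rotation

variable {Q : Matrix (Fin 3) (Fin 3) ℝ}

theorem tildeQ_transpose_mul_self (hQ : Q ∈ Matrix.orthogonalGroup (Fin 3) ℝ) :
    (tildeQ Q)ᵀ * tildeQ Q = 1 := by
  have h := (Matrix.mem_orthogonalGroup_iff' (Fin 3) ℝ).1 hQ
  have hij : ∀ i j, (Q 0 i : ℂ) * Q 0 j + (Q 1 i : ℂ) * Q 1 j + (Q 2 i : ℂ) * Q 2 j =
      (((1 : Matrix (Fin 3) (Fin 3) ℝ) i j : ℝ) : ℂ) := by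
    intro i j
    rw [← h]
    simp [Matrix.mul_apply, Fin.sum_univ_three]
  ext n m
  fin_cases n <;> fin_cases m <;>
    simp [Matrix.mul_apply, Fin.sum_univ_five, tildeQ, hij]

theorem tildeQ_mul_transpose_self (hQ : Q ∈ Matrix.orthogonalGroup (Fin 3) ℝ) :
    tildeQ Q * (tildeQ Q)ᵀ = 1 := mul_eq_one_comm.1 (tildeQ_transpose_mul_self hQ)

theorem det_tildeQ_sq (hQ : Q ∈ Matrix.orthogonalGroup (Fin 3) ℝ) : (tildeQ Q).det ^ 2 = 1 := by
  have := congrArg Matrix.det (tildeQ_transpose_mul_self hQ)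
  rw [Matrix.det_mul, Matrix.det_transpose, Matrix.det_one] at this
  rw [pow_two, this]

theorem adjugate_tildeQ (hQ : Q ∈ Matrix.orthogonalGroup (Fin 3) ℝ) :
    (tildeQ Q).adjugate = (tildeQ Q).det • (tildeQ Q)ᵀ := by
  have h : (tildeQ Q).adjugate * tildeQ Q * (tildeQ Q)ᵀ = (tildeQ Q).det • (tildeQ Q)ᵀ := by
    rw [Matrix.adjugate_mul, Matrix.smul_mul, one_mul]
  rwa [mul_assoc, tildeQ_mul_transpose_self hQ, mul_one] at h

theorem det_tildeQ_conj (hQ : Q ∈ Matrix.orthogonalGroup (Fin 3) ℝ)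
    (M : Matrix (Fin 5) (Fin 5) ℂ) : (tildeQ Q * M * (tildeQ Q)ᵀ).det = M.det := by
  rw [Matrix.det_mul, Matrix.det_mul, Matrix.det_transpose]
  linear_combination M.det * det_tildeQ_sq hQ

/-- The adjugate of an orthogonal matrix is its determinant times its transpose. The two signs
multiply to 1, so reflections are allowed. -/
theorem adjugate_tildeQ_conj (hQ : Q ∈ Matrix.orthogonalGroup (Fin 3) ℝ)
    (M : Matrix (Fin 5) (Fin 5) ℂ) :
    (tildeQ Q * M * (tildeQ Q)ᵀ).adjugate = tildeQ Q * M.adjugate * (tildeQ Q)ᵀ := by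
  rw [Matrix.adjugate_mul_distrib, Matrix.adjugate_mul_distrib, ← Matrix.adjugate_transpose,
    adjugate_tildeQ hQ, Matrix.transpose_smul, Matrix.transpose_transpose, Matrix.smul_mul,
    Matrix.mul_smul, Matrix.mul_smul, smul_smul, ← pow_two, det_tildeQ_sq hQ, one_smul, mul_assoc]

/-- The rotation of velocity space given by an orthogonal matrix. -/
def rotation (hQ : Q ∈ Matrix.orthogonalGroup (Fin 3) ℝ) : V ≃ₗᵢ[ℝ] V :=
  LinearIsometry.toLinearIsometryEquiv (E₁ := V) (F := V)
    ⟨Matrix.toEuclideanLin Q, fun v => by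
      have h := (Matrix.mem_orthogonalGroup_iff' (Fin 3) ℝ).1 hQ
      have hij : ∀ i j, Q 0 i * Q 0 j + Q 1 i * Q 1 j + Q 2 i * Q 2 j =
          (1 : Matrix (Fin 3) (Fin 3) ℝ) i j := by
        intro i j
        rw [← h]
        simp [Matrix.mul_apply, Fin.sum_univ_three]
      rw [← sq_eq_sq₀ (norm_nonneg _) (norm_nonneg _), EuclideanSpace.real_norm_sq_eq,
        EuclideanSpace.real_norm_sq_eq]
      simp only [Matrix.toLpLin_apply, Matrix.mulVec, dotProduct, Fin.sum_univ_three]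
      have h00 := hij 0 0
      have h11 := hij 1 1
      have h22 := hij 2 2
      have h01 := hij 0 1
      have h02 := hij 0 2
      have h12 := hij 1 2
      simp only [Matrix.one_apply, Fin.reduceEq, if_false, if_true] at h00 h11 h22 h01 h02 h12
      linear_combination (v 0) ^ 2 * h00 + (v 1) ^ 2 * h11 + (v 2) ^ 2 * h22 +
        2 * v 0 * v 1 * h01 + 2 * v 0 * v 2 * h02 + 2 * v 1 * v 2 * h12⟩ rfl

theorem rotation_apply (hQ : Q ∈ Matrix.orthogonalGroup (Fin 3) ℝ) (v : V) (i : Fin 3) :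
    rotation hQ v i = (Q *ᵥ v) i := rfl

theorem e_rotation (hQ : Q ∈ Matrix.orthogonalGroup (Fin 3) ℝ) (v : V) (n : Fin 5) :
    (e n (rotation hQ v) : ℂ) = ∑ m, tildeQ Q n m * (e m v : ℂ) := by
  fin_cases n
  · simp [e, tildeQ, Fin.sum_univ_five]
  · simp [e, tildeQ, Fin.sum_univ_five, rotation_apply, Matrix.mulVec, dotProduct,
      Fin.sum_univ_three]
  · simp [e, tildeQ, Fin.sum_univ_five, rotation_apply, Matrix.mulVec, dotProduct,
      Fin.sum_univ_three]
  · simp [e, tildeQ, Fin.sum_univ_five, rotation_apply, Matrix.mulVec, dotProduct,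
      Fin.sum_univ_three]
  · simp [e, tildeQ, Fin.sum_univ_five]

theorem inner_rotation {k : V} (hQ : Q ∈ Matrix.orthogonalGroup (Fin 3) ℝ)
    (hQk : ∀ i, (Q *ᵥ ![‖k‖, 0, 0]) i = k i) (v : V) :
    inner ℝ (rotation hQ v) k = ‖k‖ * v 0 := by
  have hk : k = rotation hQ (WithLp.toLp 2 ![‖k‖, 0, 0]) := by
    ext i
    rw [rotation_apply]
    exact (hQk i).symm
  conv_lhs => rw [hk]
  rw [LinearIsometryEquiv.inner_map_map, PiLp.inner_apply, Fin.sum_univ_three]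
  simp

theorem hasInt_maxwellian_rotation (hQ : Q ∈ Matrix.orthogonalGroup (Fin 3) ℝ) {f : V → ℂ} {c : ℂ}
    (h : HasInt maxwellian (fun v => f (rotation hQ v)) c) : HasInt maxwellian f c := by
  have hmap : maxwellian = maxwellian.map (rotation hQ).toHomeomorph.toMeasurableEquiv :=
    (stdGaussian_map (rotation hQ)).symm
  rw [hmap]
  refine ⟨?_, ?_⟩
  · rw [integrable_map_equiv]
    exact h.1
  · rw [integral_map_equiv]
    exact h.2

theorem zeta_im_pos {κ τ : ℝ} (hτ : 0 < τ) (hκ : 0 < κ) {z : ℂ} (hz : z.re < 0) :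
    0 < (z / (Complex.I * κ * τ)).im := by
  have hτ' : (τ : ℂ) ≠ 0 := by exact_mod_cast hτ.ne'
  have hκ' : (κ : ℂ) ≠ 0 := by exact_mod_cast hκ.ne'
  have : z / (Complex.I * κ * τ) = Complex.I * (((τ * κ)⁻¹ : ℝ) * (-z)) := by
    have hI := Complex.I_ne_zero
    push_cast
    field_simp
    linear_combination z * Complex.I_sq
  rw [this, Complex.I_mul_im, Complex.re_ofReal_mul]
  exact mul_pos (by positivity) (by simpa using hz)

/-- Green's matrix is the rotation of the explicit matrix `G`. -/
theorem hasInt_greenS {τ : ℝ} (hτ : 0 < τ) {k : V} (hk : 0 < ‖k‖)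
    (hQ : Q ∈ Matrix.orthogonalGroup (Fin 3) ℝ) (hQk : ∀ i, (Q *ᵥ ![‖k‖, 0, 0]) i = k i)
    {z : ℂ} (hz : z.re < 0) (n m : Fin 5) :
    HasInt maxwellian (fun v => (Complex.I * τ * (inner ℝ v k : ℝ) - z)⁻¹ * (e n v : ℂ) * (e m v : ℂ))
      (((Complex.I * τ * ‖k‖)⁻¹ •
        (tildeQ Q * G (z / (Complex.I * ‖k‖ * τ)) * (tildeQ Q)ᵀ)) n m) := by
  set x : ℂ := Complex.I * τ * ‖k‖ with hx
  have hτ' : (τ : ℂ) ≠ 0 := by exact_mod_cast hτ.ne'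
  have hk' : (‖k‖ : ℂ) ≠ 0 := by exact_mod_cast hk.ne'
  have hx0 : x ≠ 0 := mul_ne_zero (mul_ne_zero Complex.I_ne_zero hτ') hk'
  have hxe : Complex.I * ‖k‖ * τ = x := by rw [hx]; ring
  rw [hxe]
  have hζ : 0 < (z / x).im := by
    rw [← hxe]
    exact zeta_im_pos hτ hk hz
  -- The substitution v ↦ Qv preserves the Gaussian, turns v·k into ‖k‖ times the first coordinate
  -- and mixes the collision invariants by Q̃, leaving a double sum of axis-aligned integrals.
  apply hasInt_maxwellian_rotation hQ
  have hs : HasInt maxwellian (fun v => ∑ i, ∑ j, x⁻¹ * tildeQ Q n i * tildeQ Q m j *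
      (((v 0 : ℂ) - z / x)⁻¹ * (e i v : ℂ) * (e j v : ℂ)))
      (∑ i, ∑ j, x⁻¹ * tildeQ Q n i * tildeQ Q m j * G (z / x) i j) :=
    HasInt.sum fun i _ => HasInt.sum fun j _ => (hasInt_div_e_mul_e hζ i j).const_mul _
  refine hs.congr (fun v => ?_) ?_
  · rw [inner_rotation hQ hQk, e_rotation, e_rotation]
    have h1 : (Complex.I * τ * ((‖k‖ * v 0 : ℝ) : ℂ) - z)⁻¹ = x⁻¹ * ((v 0 : ℂ) - z / x)⁻¹ := by
      rw [← mul_inv, mul_sub, mul_div_cancel₀ _ hx0, hx]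
      push_cast
      ring_nf
    rw [h1, mul_assoc, Finset.sum_mul_sum, Finset.mul_sum]
    refine Finset.sum_congr rfl fun i _ => ?_
    rw [Finset.mul_sum]
    refine Finset.sum_congr rfl fun j _ => ?_
    ring
  · simp only [Matrix.smul_apply, smul_eq_mul, Matrix.mul_apply, Matrix.transpose_apply]
    rw [Finset.mul_sum, Finset.sum_comm]
    refine Finset.sum_congr rfl fun j _ => ?_
    rw [Finset.sum_mul, Finset.mul_sum]
    refine Finset.sum_congr rfl fun i _ => ?_
    ring

theorem greenS_sub_one {τ : ℝ} (hτ : 0 < τ) {k : V} (hk : 0 < ‖k‖)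
    (hQ : Q ∈ Matrix.orthogonalGroup (Fin 3) ℝ) (hQk : ∀ i, (Q *ᵥ ![‖k‖, 0, 0]) i = k i)
    {z : ℂ} (hz : z.re < 0) :
    greenS k τ z - 1 = (Complex.I * τ * ‖k‖)⁻¹ •
      (tildeQ Q * shiftedG ‖k‖ τ (z / (Complex.I * ‖k‖ * τ)) * (tildeQ Q)ᵀ) := by
  have hg : greenS k τ z = (Complex.I * τ * ‖k‖)⁻¹ •
      (tildeQ Q * G (z / (Complex.I * ‖k‖ * τ)) * (tildeQ Q)ᵀ) := by
    ext n m
    exact (hasInt_greenS hτ hk hQ hQk hz n m).2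
  have hτ' : (τ : ℂ) ≠ 0 := by exact_mod_cast hτ.ne'
  have hk' : (‖k‖ : ℂ) ≠ 0 := by exact_mod_cast hk.ne'
  have hx0 : Complex.I * τ * ‖k‖ ≠ 0 := mul_ne_zero (mul_ne_zero Complex.I_ne_zero hτ') hk'
  rw [hg, shiftedG, Matrix.mul_sub, Matrix.sub_mul, smul_sub, Matrix.mul_smul, Matrix.smul_mul,
    mul_one, tildeQ_mul_transpose_self hQ, smul_smul, inv_mul_cancel₀ hx0, one_smul]

theorem spectralFunction_eq_det {τ : ℝ} (hτ : 0 < τ) {k : V} (hk : 0 < ‖k‖)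
    (hQ : Q ∈ Matrix.orthogonalGroup (Fin 3) ℝ) (hQk : ∀ i, (Q *ᵥ ![‖k‖, 0, 0]) i = k i)
    {z : ℂ} (hz : z.re < 0) : spectralFunction ‖k‖ τ z = (greenS k τ z - 1).det := by
  rw [greenS_sub_one hτ hk hQ hQk hz, Matrix.det_smul, det_tildeQ_conj hQ, spectralFunction,
    spectralFunctionZeta_eq, shiftedG_eq, Fintype.card_fin, one_div, inv_pow]

theorem adjugate_greenS_sub_one {τ : ℝ} (hτ : 0 < τ) {k : V} (hk : 0 < ‖k‖)
    (hQ : Q ∈ Matrix.orthogonalGroup (Fin 3) ℝ) (hQk : ∀ i, (Q *ᵥ ![‖k‖, 0, 0]) i = k i)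
    {z : ℂ} (hz : z.re < 0) : (greenS k τ z - 1).adjugate =
        (1 / (Complex.I * τ * ‖k‖) ^ 4) • (tildeQ Q *
          (shiftedG ‖k‖ τ (z / (Complex.I * ‖k‖ * τ))).adjugate * (tildeQ Q)ᵀ) := by
  rw [greenS_sub_one hτ hk hQ hQk hz, Matrix.adjugate_smul, adjugate_tildeQ_conj hQ,
    Fintype.card_fin, one_div, inv_pow]

end Rotation

/-! ### Bounded multiplication operators -/

section Multiplication

/-- `φ` is measurable and bounded by `C`. -/
def IsBddBy (φ : V → ℂ) (C : ℝ) : Prop := Measurable φ ∧ ∀ v, ‖φ v‖ ≤ C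

theorem IsBddBy.nonneg {φ : V → ℂ} {C : ℝ} (h : IsBddBy φ C) : 0 ≤ C :=
  (norm_nonneg _).trans (h.2 0)

theorem IsBddBy.memLp {φ : V → ℂ} {C : ℝ} (h : IsBddBy φ C) (f : Hv) :
    MemLp (fun v => φ v * f v) 2 maxwellian :=
  (Lp.memLp f).of_le_mul (h.1.aestronglyMeasurable.mul (Lp.aestronglyMeasurable f))
    (Eventually.of_forall fun v => by
      rw [norm_mul]
      exact mul_le_mul_of_nonneg_right (h.2 v) (norm_nonneg _))

/-- Multiplication by a bounded measurable function. -/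
def IsBddBy.mulOp {φ : V → ℂ} {C : ℝ} (h : IsBddBy φ C) : Hv →L[ℂ] Hv :=
  LinearMap.mkContinuous
    { toFun := fun f => (h.memLp f).toLp _
      map_add' := fun f g => by
        apply Lp.ext
        filter_upwards [(h.memLp (f + g)).coeFn_toLp, (h.memLp f).coeFn_toLp,
          (h.memLp g).coeFn_toLp, Lp.coeFn_add f g,
          Lp.coeFn_add ((h.memLp f).toLp _) ((h.memLp g).toLp _)] with v h₀ h₁ h₂ h₃ h₄
        rw [h₀, h₄, Pi.add_apply, h₁, h₂, h₃, Pi.add_apply, mul_add]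
      map_smul' := fun c f => by
        apply Lp.ext
        filter_upwards [(h.memLp (c • f)).coeFn_toLp, (h.memLp f).coeFn_toLp,
          Lp.coeFn_smul c f, Lp.coeFn_smul c ((h.memLp f).toLp _)] with v h₀ h₁ h₃ h₄
        rw [RingHom.id_apply, h₀, h₄, Pi.smul_apply, h₁, h₃, Pi.smul_apply, smul_eq_mul,
          smul_eq_mul, mul_left_comm] }
    C fun f => by
      refine Lp.norm_le_mul_norm_of_ae_le_mul ?_
      filter_upwards [(h.memLp f).coeFn_toLp] with v hv
      change ‖(h.memLp f).toLp _ v‖ ≤ _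
      rw [hv, norm_mul]
      exact mul_le_mul_of_nonneg_right (h.2 v) (norm_nonneg _)

theorem IsBddBy.coeFn_mulOp {φ : V → ℂ} {C : ℝ} (h : IsBddBy φ C) (f : Hv) :
    h.mulOp f =ᵐ[maxwellian] fun v => φ v * f v := (h.memLp f).coeFn_toLp

theorem IsBddBy.norm_mulOp_le {φ : V → ℂ} {C : ℝ} (h : IsBddBy φ C) : ‖h.mulOp‖ ≤ C :=
  LinearMap.mkContinuous_norm_le _ h.nonneg _

/-- The symbol `(i τ v ⬝ k - z)⁻¹` of the resolvent of the transport operator. -/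
def freeSymbol (k : V) (τ : ℝ) (z : ℂ) (v : V) : ℂ := (Complex.I * τ * (inner ℝ v k : ℝ) - z)⁻¹

theorem freeSymbol_den_re (k : V) (τ : ℝ) (z : ℂ) (v : V) :
    (Complex.I * τ * (inner ℝ v k : ℝ) - z).re = -z.re := by
  rw [Complex.sub_re, mul_assoc, ← Complex.ofReal_mul, Complex.I_mul_re, Complex.ofReal_im]
  ring

theorem freeSymbol_den_ne_zero (k : V) (τ : ℝ) {z : ℂ} (hz : z.re < 0) (v : V) :
    Complex.I * τ * (inner ℝ v k : ℝ) - z ≠ 0 := fun h => by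
  have := freeSymbol_den_re k τ z v
  rw [h, Complex.zero_re] at this
  linarith

theorem isBddBy_freeSymbol (k : V) (τ : ℝ) {z : ℂ} (hz : z.re < 0) :
    IsBddBy (freeSymbol k τ z) (-z.re)⁻¹ := by
  refine ⟨by unfold freeSymbol; fun_prop, fun v => ?_⟩
  rw [freeSymbol, norm_inv]
  refine inv_anti₀ (by linarith) ?_
  rw [← freeSymbol_den_re k τ z v]
  exact Complex.re_le_norm _

/-- The resolvent of the transport operator (and `0` for `0 ≤ Re z`). -/
def freeRes (k : V) (τ : ℝ) (z : ℂ) : Hv →L[ℂ] Hv :=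
  if hz : z.re < 0 then (isBddBy_freeSymbol k τ hz).mulOp else 0

theorem coeFn_freeRes (k : V) (τ : ℝ) {z : ℂ} (hz : z.re < 0) (f : Hv) :
    freeRes k τ z f =ᵐ[maxwellian] fun v => freeSymbol k τ z v * f v := by
  rw [freeRes, dif_pos hz]
  exact IsBddBy.coeFn_mulOp _ f

theorem norm_freeRes_le (k : V) (τ : ℝ) {z : ℂ} (hz : z.re < 0) :
    ‖freeRes k τ z‖ ≤ (-z.re)⁻¹ := by
  rw [freeRes, dif_pos hz]
  exact IsBddBy.norm_mulOp_le _

/-- The first resolvent identity, from which continuity and differentiability in operator norm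
follow. -/
theorem freeRes_sub (k : V) (τ : ℝ) {z z₀ : ℂ} (hz : z.re < 0) (hz₀ : z₀.re < 0) :
    freeRes k τ z - freeRes k τ z₀ = (z - z₀) • (freeRes k τ z ∘L freeRes k τ z₀) := by
  ext1 f
  apply Lp.ext
  simp only [sub_apply, smul_apply,
    ContinuousLinearMap.comp_apply]
  filter_upwards [coeFn_freeRes k τ hz f, coeFn_freeRes k τ hz₀ f,
    coeFn_freeRes k τ hz (freeRes k τ z₀ f), Lp.coeFn_sub (freeRes k τ z f) (freeRes k τ z₀ f),
    Lp.coeFn_smul (z - z₀) (freeRes k τ z (freeRes k τ z₀ f))] with v h₁ h₂ h₃ h₄ h₅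
  rw [h₄, h₅, Pi.sub_apply, Pi.smul_apply, h₁, h₃, h₂, smul_eq_mul]
  have ha := freeSymbol_den_ne_zero k τ hz v
  have hb := freeSymbol_den_ne_zero k τ hz₀ v
  unfold freeSymbol
  field_simp
  ring

theorem continuousAt_freeRes (k : V) (τ : ℝ) {z₀ : ℂ} (hz₀ : z₀.re < 0) :
    ContinuousAt (freeRes k τ) z₀ := by
  have hopen : ∀ᶠ z in 𝓝 z₀, z.re < z₀.re / 2 :=
    Complex.continuous_re.continuousAt.eventually (gt_mem_nhds (by linarith))
  rw [ContinuousAt, tendsto_iff_norm_sub_tendsto_zero]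
  have ht : Tendsto (fun z : ℂ => ‖z - z₀‖ * ((-(z₀.re / 2))⁻¹ * (-z₀.re)⁻¹)) (𝓝 z₀) (𝓝 0) := by
    have h1 : Tendsto (fun z : ℂ => ‖z - z₀‖) (𝓝 z₀) (𝓝 0) := by
      rw [← tendsto_iff_norm_sub_tendsto_zero]
      exact tendsto_id
    simpa using h1.mul_const ((-(z₀.re / 2))⁻¹ * (-z₀.re)⁻¹)
  refine squeeze_zero' (Eventually.of_forall fun _ => norm_nonneg _) ?_ ht
  filter_upwards [hopen] with z hz
  have hz0 : z.re < 0 := by linarith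
  rw [freeRes_sub k τ hz0 hz₀, norm_smul]
  refine mul_le_mul_of_nonneg_left ((ContinuousLinearMap.opNorm_comp_le _ _).trans
    (mul_le_mul ((norm_freeRes_le k τ hz0).trans (inv_anti₀ (by linarith) (by linarith)))
      (norm_freeRes_le k τ hz₀) (norm_nonneg _) ?_)) (norm_nonneg _)
  exact inv_nonneg.2 (by linarith)

theorem hasDerivAt_freeRes (k : V) (τ : ℝ) {z₀ : ℂ} (hz₀ : z₀.re < 0) :
    HasDerivAt (freeRes k τ) (freeRes k τ z₀ ∘L freeRes k τ z₀) z₀ := by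
  rw [hasDerivAt_iff_tendsto_slope]
  have h1 : Tendsto (fun z => freeRes k τ z ∘L freeRes k τ z₀) (𝓝[≠] z₀)
      (𝓝 (freeRes k τ z₀ ∘L freeRes k τ z₀)) :=
    ((continuousAt_freeRes k τ hz₀).clm_comp continuousAt_const).tendsto.mono_left
      nhdsWithin_le_nhds
  refine h1.congr' ?_
  have hopen : ∀ᶠ z in 𝓝[≠] z₀, z.re < 0 :=
    nhdsWithin_le_nhds (Complex.continuous_re.continuousAt.eventually (gt_mem_nhds hz₀))
  filter_upwards [hopen, self_mem_nhdsWithin] with z hz hne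
  rw [slope_def_module, freeRes_sub k τ hz hz₀, smul_smul, inv_mul_cancel₀ (sub_ne_zero.2 hne),
    one_smul]

end Multiplication

/-! ### Moments and Green's matrix -/

section Moments

/-- The moments as a continuous linear map. -/
def momentsL : Hv →L[ℂ] (Fin 5 → ℂ) := ContinuousLinearMap.pi fun j => innerSL ℂ (eL j)

/-- The function with given coordinates in the collision invariants. -/
def embL : (Fin 5 → ℂ) →L[ℂ] Hv :=
  ∑ j, (ContinuousLinearMap.proj (R := ℂ) (φ := fun _ : Fin 5 => ℂ) j).smulRight (eL j)

theorem embL_apply (α : Fin 5 → ℂ) : embL α = ∑ j, α j • eL j := by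
  simp [embL]

theorem P5_apply (f : Hv) : P5 f = embL (moments f) := by
  rw [embL_apply]
  simp [P5, moments]

theorem inner_eL_freeRes (k : V) (τ : ℝ) {z : ℂ} (hz : z.re < 0) (n m : Fin 5) :
    inner ℂ (eL n) (freeRes k τ z (eL m)) = greenS k τ z n m := by
  rw [L2.inner_def, greenS, Matrix.of_apply]
  refine integral_congr_ae ?_
  filter_upwards [(memLp_e n).coeFn_toLp, (memLp_e m).coeFn_toLp,
    coeFn_freeRes k τ hz (eL m)] with v h₁ h₂ h₃
  rw [h₃, eL, eL, h₁, h₂, RCLike.inner_apply, Complex.conj_ofReal, freeSymbol]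
  ring

theorem orthonormal_eL : Orthonormal ℂ eL := by
  rw [orthonormal_iff_ite]
  intro n m
  rw [L2.inner_def, ← Matrix.one_apply, ← (hasInt_e_mul_e n m).2]
  refine integral_congr_ae ?_
  filter_upwards [(memLp_e n).coeFn_toLp, (memLp_e m).coeFn_toLp] with v h₁ h₂
  rw [eL, eL, h₁, h₂, RCLike.inner_apply, Complex.conj_ofReal, mul_comm]

theorem moments_freeRes_embL (k : V) (τ : ℝ) {z : ℂ} (hz : z.re < 0) (α : Fin 5 → ℂ) :
    moments (freeRes k τ z (embL α)) = greenS k τ z *ᵥ α := by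
  ext n
  simp only [moments, embL_apply, map_sum, map_smul, inner_sum, inner_smul_right,
    inner_eL_freeRes k τ hz, Matrix.mulVec, dotProduct]
  exact Finset.sum_congr rfl fun m _ => mul_comm _ _

end Moments

/-! ### The resolvent of the linearized BGK operator -/

section Resolvent

variable {H : Type*} [NormedAddCommGroup H] [NormedSpace ℂ H]

theorem IsResolventAt.unique {T : H →ₗ.[ℂ] H} {w : ℂ} {R R' : H →L[ℂ] H}
    (h : IsResolventAt T w R) (h' : IsResolventAt T w R') : R = R' := by
  ext f
  obtain ⟨hd, he⟩ := h'.1 f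
  have := h.2 ⟨R' f, hd⟩
  rwa [he] at this

theorem opResolvent_eq {T : H →ₗ.[ℂ] H} {w : ℂ} {R : H →L[ℂ] H} (h : IsResolventAt T w R) :
    opResolvent T w = R := by
  have hex : ∃ R : H →L[ℂ] H, IsResolventAt T w R := ⟨R, h⟩
  rw [opResolvent, dif_pos hex]
  exact hex.choose_spec.unique h

theorem bgk_apply (k : V) (τ : ℝ) (f : Hv) (hf : f ∈ (bgk k τ).domain) :
    bgk k τ ⟨f, hf⟩ = (-Complex.I) • transport k ⟨f, hf⟩ - (τ : ℂ)⁻¹ • (f - P5 f) := rfl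

theorem coeFn_bgk_sub (k : V) (τ : ℝ) (w : ℂ) (f : Hv) (hf : f ∈ (bgk k τ).domain) :
    ⇑(bgk k τ ⟨f, hf⟩ - w • f) =ᵐ[maxwellian] fun v =>
      -Complex.I * ((inner ℝ v k : ℝ) * f v) - (τ : ℂ)⁻¹ * (f v - P5 f v) - w * f v := by
  rw [bgk_apply]
  filter_upwards [Lp.coeFn_sub ((-Complex.I) • transport k ⟨f, hf⟩ - (τ : ℂ)⁻¹ • (f - P5 f))
      (w • f), Lp.coeFn_sub ((-Complex.I) • transport k ⟨f, hf⟩) ((τ : ℂ)⁻¹ • (f - P5 f)),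
    Lp.coeFn_smul (-Complex.I) (transport k ⟨f, hf⟩), Lp.coeFn_smul (τ : ℂ)⁻¹ (f - P5 f),
    Lp.coeFn_sub f (P5 f), Lp.coeFn_smul w f,
    (memLp_transport (⟨f, hf⟩ : transportDomain k)).coeFn_toLp] with v h₁ h₂ h₃ h₄ h₅ h₆ h₇
  rw [h₁, Pi.sub_apply, h₂, Pi.sub_apply, h₃, Pi.smul_apply, h₄, Pi.smul_apply, h₅, Pi.sub_apply,
    h₆, Pi.smul_apply]
  simp only [smul_eq_mul]
  rw [show (transport k ⟨f, hf⟩ : Hv) v = _ from h₇]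

theorem zOf_re {τ : ℝ} (hτ : 0 < τ) (w : ℂ) : (zOf τ w).re < 0 ↔ -(1 / τ) < w.re := by
  have : (zOf τ w).re = -τ * w.re - 1 := by simp [zOf]
  rw [this, neg_lt, ← sub_pos, ← sub_pos (b := -w.re)]
  have h2 : 1 / τ - -w.re = (0 - (-τ * w.re - 1)) / τ := by field_simp; ring
  rw [h2, div_pos_iff_of_pos_right hτ]

/-- The resolvent equation as a fixed point equation. -/
theorem bgk_sub_eq_iff {k : V} {τ : ℝ} (hτ : 0 < τ) {w : ℂ} (hw : (zOf τ w).re < 0) (f g : Hv) :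
    (∃ h : f ∈ (bgk k τ).domain, bgk k τ ⟨f, h⟩ - w • f = g) ↔
      f = freeRes k τ (zOf τ w) (P5 f - (τ : ℂ) • g) := by
  have hτ' : (τ : ℂ) ≠ 0 := by exact_mod_cast hτ.ne'
  have hR : ⇑(freeRes k τ (zOf τ w) (P5 f - (τ : ℂ) • g)) =ᵐ[maxwellian] fun v =>
      freeSymbol k τ (zOf τ w) v * (P5 f v - τ * g v) := by
    filter_upwards [coeFn_freeRes k τ hw (P5 f - (τ : ℂ) • g), Lp.coeFn_sub (P5 f) ((τ : ℂ) • g),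
      Lp.coeFn_smul (τ : ℂ) g] with v h₁ h₂ h₃
    rw [h₁, h₂, Pi.sub_apply, h₃, Pi.smul_apply, smul_eq_mul]
  constructor
  · rintro ⟨h, he⟩
    apply Lp.ext
    have h1 := coeFn_bgk_sub k τ w f h
    rw [he] at h1
    filter_upwards [hR, h1] with v h₂ h₃
    rw [h₂, h₃, freeSymbol, eq_inv_mul_iff_mul_eq₀ (freeSymbol_den_ne_zero k τ hw v), zOf]
    field_simp
    ring
  · intro he
    have hfe : ⇑f =ᵐ[maxwellian] fun v => freeSymbol k τ (zOf τ w) v * (P5 f v - τ * g v) := by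
      filter_upwards [hR] with v hv
      rw [← hv, ← he]
    have hd : f ∈ (bgk k τ).domain := by
      change MemLp (fun v => ((inner ℝ v k : ℝ) : ℂ) * f v) 2 maxwellian
      -- The fixed point equation itself puts f into the domain: (v·k)f = (iτ)⁻¹(P₅f - τg + zf), a
      -- combination of square-integrable functions.
      have hm := ((Lp.memLp (P5 f - (τ : ℂ) • g)).add
        ((Lp.memLp f).const_mul (zOf τ w))).const_mul ((Complex.I * τ)⁻¹)
      refine hm.ae_eq ?_
      filter_upwards [hfe, Lp.coeFn_sub (P5 f) ((τ : ℂ) • g), Lp.coeFn_smul (τ : ℂ) g]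
        with v h₁ h₂ h₃
      simp only [Pi.add_apply]
      rw [h₂, Pi.sub_apply, h₃, Pi.smul_apply, smul_eq_mul]
      rw [freeSymbol, eq_inv_mul_iff_mul_eq₀ (freeSymbol_den_ne_zero k τ hw v)] at h₁
      rw [← h₁]
      have hI := Complex.I_ne_zero
      field_simp
      ring
    refine ⟨hd, ?_⟩
    apply Lp.ext
    filter_upwards [coeFn_bgk_sub k τ w f hd, hfe] with v h₁ h₂
    rw [h₁]
    rw [freeSymbol, eq_inv_mul_iff_mul_eq₀ (freeSymbol_den_ne_zero k τ hw v), zOf] at h₂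
    field_simp
    linear_combination -h₂

end Resolvent

/-! ### Reduction of the spectral problem to Green's matrix -/

section Reduction

variable {k : V} {τ : ℝ} {w : ℂ}

theorem moments_sub (f g : Hv) : moments (f - g) = moments f - moments g :=
  map_sub momentsL f g

theorem moments_smul (c : ℂ) (f : Hv) : moments (c • f) = c • moments f :=
  map_smul momentsL c f

/-- The unknown enters the right side of the fixed point equation only through its moments, so
taking moments closes the system in dimension five. -/
theorem greenS_mulVec_moments (hw : (zOf τ w).re < 0) {f g : Hv}
    (h : f = freeRes k τ (zOf τ w) (P5 f - (τ : ℂ) • g)) :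
    (greenS k τ (zOf τ w) - 1) *ᵥ moments f =
      (τ : ℂ) • moments (freeRes k τ (zOf τ w) g) := by
  have h1 := congrArg moments h
  rw [map_sub, map_smul, moments_sub, moments_smul, P5_apply, moments_freeRes_embL k τ hw] at h1
  rw [Matrix.sub_mulVec, Matrix.one_mulVec]
  nth_rewrite 2 [h1]
  abel

/-- The converse reduction: the function generated by a solution α of the finite system has moments
exactly α, hence solves the full equation. -/
theorem eq_freeRes_of_mulVec_eq (hw : (zOf τ w).re < 0) {α : Fin 5 → ℂ} {g : Hv}
    (h : (greenS k τ (zOf τ w) - 1) *ᵥ α = (τ : ℂ) • moments (freeRes k τ (zOf τ w) g)) :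
    moments (freeRes k τ (zOf τ w) (embL α - (τ : ℂ) • g)) = α ∧
      freeRes k τ (zOf τ w) (embL α - (τ : ℂ) • g) = freeRes k τ (zOf τ w)
        (P5 (freeRes k τ (zOf τ w) (embL α - (τ : ℂ) • g)) - (τ : ℂ) • g) := by
  have h1 : moments (freeRes k τ (zOf τ w) (embL α - (τ : ℂ) • g)) = α := by
    rw [map_sub, map_smul, moments_sub, moments_smul, moments_freeRes_embL k τ hw, ← h,
      Matrix.sub_mulVec, Matrix.one_mulVec]
    abel
  refine ⟨h1, ?_⟩
  rw [P5_apply, h1]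

/-- The resolvent of the linearized BGK operator in terms of Green's matrix. -/
def bgkRes (k : V) (τ : ℝ) (z : ℂ) : Hv →L[ℂ] Hv :=
  freeRes k τ z ∘L ((∑ n, ∑ m, ((τ : ℂ) * (greenS k τ z - 1)⁻¹ n m) •
    (innerSL ℂ (eL m)).smulRight (eL n)) ∘L freeRes k τ z - (τ : ℂ) • ContinuousLinearMap.id ℂ Hv)

theorem bgkRes_apply (z : ℂ) (g : Hv) : bgkRes k τ z g = freeRes k τ z
    (embL ((τ : ℂ) • ((greenS k τ z - 1)⁻¹ *ᵥ moments (freeRes k τ z g))) - (τ : ℂ) • g) := by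
  simp only [bgkRes, ContinuousLinearMap.comp_apply, sub_apply, sum_apply, smul_apply,
    ContinuousLinearMap.smulRight_apply, innerSL_apply_apply, ContinuousLinearMap.id_apply]
  congr 2
  rw [embL_apply]
  refine Finset.sum_congr rfl fun n _ => ?_
  rw [Pi.smul_apply, Matrix.mulVec, dotProduct, smul_eq_mul, Finset.mul_sum, Finset.sum_smul]
  refine Finset.sum_congr rfl fun m _ => ?_
  rw [smul_smul, mul_assoc]
  rfl

theorem isResolventAt_bgkRes (hτ : 0 < τ) (hw : (zOf τ w).re < 0)
    (hdet : (greenS k τ (zOf τ w) - 1).det ≠ 0) :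
    IsResolventAt (bgk k τ) w (bgkRes k τ (zOf τ w)) := by
  have hu : IsUnit (greenS k τ (zOf τ w) - 1).det := isUnit_iff_ne_zero.2 hdet
  refine ⟨fun g => ?_, fun f => ?_⟩
  · rw [bgk_sub_eq_iff hτ hw, bgkRes_apply]
    refine (eq_freeRes_of_mulVec_eq hw ?_).2
    rw [Matrix.mulVec_smul, Matrix.mulVec_mulVec, Matrix.mul_nonsing_inv _ hu, Matrix.one_mulVec]
  · obtain ⟨f, hf⟩ := f
    have h1 := (bgk_sub_eq_iff hτ hw f _).1 ⟨hf, rfl⟩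
    have h2 := greenS_mulVec_moments hw h1
    rw [bgkRes_apply]
    conv_rhs => rw [show ((⟨f, hf⟩ : (bgk k τ).domain) : Hv) = f from rfl, h1, P5_apply]
    rw [← Matrix.mulVec_smul, ← h2, Matrix.mulVec_mulVec, Matrix.nonsing_inv_mul _ hu,
      Matrix.one_mulVec]

theorem inEigenspace_iff (hτ : 0 < τ) (hw : (zOf τ w).re < 0) (f : Hv) :
    InEigenspace (bgk k τ) w f ↔ f = freeRes k τ (zOf τ w) (P5 f) := by
  have h := bgk_sub_eq_iff (k := k) hτ hw f 0
  rw [smul_zero, sub_zero] at h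
  rw [← h]
  simp only [InEigenspace, sub_eq_zero]

theorem inEigenspace_freeRes_embL (hτ : 0 < τ) (hw : (zOf τ w).re < 0) {α : Fin 5 → ℂ}
    (h : (greenS k τ (zOf τ w) - 1) *ᵥ α = 0) :
    InEigenspace (bgk k τ) w (freeRes k τ (zOf τ w) (embL α)) ∧
      moments (freeRes k τ (zOf τ w) (embL α)) = α := by
  have h0 : moments (0 : Hv) = 0 := map_zero momentsL
  have := eq_freeRes_of_mulVec_eq (g := 0) hw (by rw [h, map_zero, h0, smul_zero])
  rw [smul_zero, sub_zero, sub_zero] at this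
  exact ⟨(inEigenspace_iff hτ hw _).2 this.2, this.1⟩

theorem mulVec_moments_of_inEigenspace (hτ : 0 < τ) (hw : (zOf τ w).re < 0) {f : Hv}
    (h : InEigenspace (bgk k τ) w f) : (greenS k τ (zOf τ w) - 1) *ᵥ moments f = 0 := by
  have h0 : moments (0 : Hv) = 0 := map_zero momentsL
  have := greenS_mulVec_moments (g := 0) hw
    (by rw [smul_zero, sub_zero]; exact (inEigenspace_iff hτ hw f).1 h)
  rwa [map_zero, h0, smul_zero] at this

theorem moments_image_eigenspace (hτ : 0 < τ) (hw : (zOf τ w).re < 0) :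
    moments '' {f | InEigenspace (bgk k τ) w f} =
      {α | (greenS k τ (zOf τ w) - 1) *ᵥ α = 0} := by
  ext α
  constructor
  · rintro ⟨f, hf, rfl⟩
    exact mulVec_moments_of_inEigenspace hτ hw hf
  · intro h
    obtain ⟨h1, h2⟩ := inEigenspace_freeRes_embL hτ hw h
    exact ⟨_, h1, h2⟩

/-- For nonzero determinant `bgkRes` inverts the operator. Otherwise a kernel vector lifts to an
eigenfunction with that vector as its moments, so it is nonzero and no resolvent can exist. -/
theorem mem_opSpectrum_iff (hτ : 0 < τ) (hw : (zOf τ w).re < 0) :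
    w ∈ opSpectrum (bgk k τ) ↔ (greenS k τ (zOf τ w) - 1).det = 0 := by
  constructor
  · intro h
    by_contra hdet
    exact h ⟨_, isResolventAt_bgkRes hτ hw hdet⟩
  · rintro hdet ⟨R, hR⟩
    obtain ⟨α, hα, h0⟩ := Matrix.exists_mulVec_eq_zero_iff.2 hdet
    obtain ⟨⟨hd, he⟩, h2⟩ := inEigenspace_freeRes_embL (k := k) hτ hw h0
    have := hR.2 ⟨_, hd⟩
    rw [he, sub_self, map_zero] at this
    have h3 : (0 : Hv) = freeRes k τ (zOf τ w) (embL α) := this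
    apply hα
    rw [← h2, ← h3]
    exact map_zero momentsL

/-- The moments of the free resolvent at `eL m` are column m of M + 1 with M = G_S - 1, and M⁻¹(M +
1) = 1 + M⁻¹. -/
theorem inner_bgkRes (hw : (zOf τ w).re < 0)
    (hdet : (greenS k τ (zOf τ w) - 1).det ≠ 0) (n m : Fin 5) :
    inner ℂ (eL n) (bgkRes k τ (zOf τ w) (eL m)) =
      τ * ((1 : Matrix (Fin 5) (Fin 5) ℂ) n m + (greenS k τ (zOf τ w) - 1)⁻¹ n m) := by
  have hu : IsUnit (greenS k τ (zOf τ w) - 1).det := isUnit_iff_ne_zero.2 hdet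
  set M := greenS k τ (zOf τ w) - 1 with hM
  have h1 : moments (bgkRes k τ (zOf τ w) (eL m)) =
      (τ : ℂ) • (M⁻¹ *ᵥ moments (freeRes k τ (zOf τ w) (eL m))) := by
    rw [bgkRes_apply]
    refine (eq_freeRes_of_mulVec_eq hw ?_).1
    rw [← hM, Matrix.mulVec_smul, Matrix.mulVec_mulVec, Matrix.mul_nonsing_inv _ hu,
      Matrix.one_mulVec]
  have h2 : moments (freeRes k τ (zOf τ w) (eL m)) = fun j => (M + 1) j m := by
    ext j
    rw [hM, sub_add_cancel]
    exact inner_eL_freeRes k τ hw j m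
  have h3 : M⁻¹ *ᵥ (fun j => (M + 1) j m) = fun n => (M⁻¹ * (M + 1)) n m := by
    ext n
    rw [Matrix.mulVec, Matrix.mul_apply, dotProduct]
  have h4 := congrFun h1 n
  rw [h2, h3, mul_add, mul_one, Matrix.nonsing_inv_mul _ hu] at h4
  exact h4

theorem hasDerivAt_greenS {z : ℂ} (hz : z.re < 0) (n m : Fin 5) :
    HasDerivAt (fun z => greenS k τ z n m)
      (inner ℂ (eL n) (freeRes k τ z (freeRes k τ z (eL m)))) z := by
  have h1 : HasDerivAt (fun z => freeRes k τ z (eL m)) (freeRes k τ z (freeRes k τ z (eL m))) z :=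
    (hasDerivAt_freeRes k τ hz).clm_apply (hasDerivAt_const z (eL m)) |>.congr_deriv (by simp)
  have h2 := ((innerSL ℂ (eL n)).hasFDerivAt.comp_hasDerivAt z h1)
  refine h2.congr_of_eventuallyEq ?_
  filter_upwards [(Complex.continuous_re.continuousAt (x := z)).eventually (gt_mem_nhds hz)]
    with ξ hξ
  exact (inner_eL_freeRes k τ hξ n m).symm

/-- A Jordan chain of Green's matrix yields a Jordan chain of the linearized BGK operator. -/
theorem not_isSimpleEigenvalue_of_chain (hτ : 0 < τ) (hw : (zOf τ w).re < 0) {u₀ u₁ : Fin 5 → ℂ}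
    (h0 : u₀ ≠ 0) (h1 : (greenS k τ (zOf τ w) - 1) *ᵥ u₀ = 0)
    (h2 : (greenS k τ (zOf τ w) - 1) *ᵥ u₁ +
      moments (freeRes k τ (zOf τ w) (freeRes k τ (zOf τ w) (embL u₀))) = 0) :
    ¬ IsSimpleEigenvalue (bgk k τ) w := by
  have hτ' : (τ : ℂ) ≠ 0 := by exact_mod_cast hτ.ne'
  obtain ⟨⟨hd0, he0⟩, hm0⟩ := inEigenspace_freeRes_embL (k := k) hτ hw h1
  set f₀ := freeRes k τ (zOf τ w) (embL u₀) with hf₀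
  have hf₀ne : f₀ ≠ 0 := by
    intro h
    rw [h] at hm0
    exact h0 (hm0.symm.trans (map_zero momentsL))
  -- With the datum -τ⁻¹f₀ the reduced equation is exactly the hypothesis `h2`, so f₁ is mapped by
  -- the operator minus w to a nonzero multiple of the eigenfunction f₀.
  have h3 := eq_freeRes_of_mulVec_eq (k := k) (w := w) (τ := τ) (α := u₁) (g := -(τ : ℂ)⁻¹ • f₀) hw
    (by
      rw [map_smul, moments_smul, smul_smul, mul_neg, mul_inv_cancel₀ hτ', neg_one_smul]
      exact eq_neg_of_add_eq_zero_left h2)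
  obtain ⟨hd1, he1⟩ := (bgk_sub_eq_iff hτ hw _ _).2 h3.2
  set f₁ := freeRes k τ (zOf τ w) (embL u₁ - (τ : ℂ) • -(τ : ℂ)⁻¹ • f₀) with hf₁
  rintro ⟨f, hf, hspan⟩
  have hg0 : f₀ ∈ genKer (bgk k τ) w 1 := ⟨hd0, by
    change _ ∈ ({0} : Set Hv)
    rw [he0, sub_self]
    rfl⟩
  have hT0 : bgk k τ ⟨f₀, hd0⟩ - w • f₀ = 0 := by rw [he0, sub_self]
  have hg1 : f₁ ∈ genKer (bgk k τ) w 2 := by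
    refine ⟨hd1, ?_⟩
    rw [he1]
    refine ⟨(bgk k τ).domain.smul_mem _ hd0, ?_⟩
    have : bgk k τ ⟨-(τ : ℂ)⁻¹ • f₀, (bgk k τ).domain.smul_mem _ hd0⟩ =
        -(τ : ℂ)⁻¹ • bgk k τ ⟨f₀, hd0⟩ := (bgk k τ).map_smul _ ⟨f₀, hd0⟩
    rw [this, he0, smul_comm, sub_self]
    rfl
  have hs0 : f₀ ∈ (Submodule.span ℂ {f} : Set Hv) := by
    rw [← hspan]; exact mem_iUnion.2 ⟨1, hg0⟩
  have hs1 : f₁ ∈ (Submodule.span ℂ {f} : Set Hv) := by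
    rw [← hspan]; exact mem_iUnion.2 ⟨2, hg1⟩
  obtain ⟨c, hc⟩ := Submodule.mem_span_singleton.1 hs0
  obtain ⟨d, hd⟩ := Submodule.mem_span_singleton.1 hs1
  have hc0 : c ≠ 0 := by
    rintro rfl
    exact hf₀ne (by rw [← hc, zero_smul])
  have hff : f₁ = (d * c⁻¹) • f₀ := by
    rw [← hd, ← hc, smul_smul, inv_mul_cancel_right₀ hc0]
  have h4 : bgk k τ ⟨f₁, hd1⟩ - w • f₁ = 0 := by
    have h5 : (⟨f₁, hd1⟩ : (bgk k τ).domain) = (d * c⁻¹) • ⟨f₀, hd0⟩ := Subtype.ext hff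
    rw [h5, (bgk k τ).map_smul, he0, hff, smul_comm, sub_self]
  rw [h4] at he1
  have := smul_eq_zero.1 he1.symm
  rcases this with h | h
  · exact neg_ne_zero.2 (inv_ne_zero hτ') h
  · exact hf₀ne h

/-- Kernel vectors of Green's matrix at a simple eigenvalue are proportional. -/
theorem IsSimpleEigenvalue.exists_smul (hs : IsSimpleEigenvalue (bgk k τ) w) (hτ : 0 < τ)
    (hw : (zOf τ w).re < 0) {α β : Fin 5 → ℂ} (hα : α ≠ 0)
    (h1 : (greenS k τ (zOf τ w) - 1) *ᵥ α = 0) (h2 : (greenS k τ (zOf τ w) - 1) *ᵥ β = 0) :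
    ∃ c : ℂ, β = c • α := by
  obtain ⟨f, hf, hspan⟩ := hs
  have key : ∀ α : Fin 5 → ℂ, (greenS k τ (zOf τ w) - 1) *ᵥ α = 0 →
      ∃ c : ℂ, α = c • moments f := by
    intro α h
    obtain ⟨⟨hd, he⟩, hm⟩ := inEigenspace_freeRes_embL (k := k) hτ hw h
    have hg : freeRes k τ (zOf τ w) (embL α) ∈ genKer (bgk k τ) w 1 := ⟨hd, by
      change _ ∈ ({0} : Set Hv)
      rw [he, sub_self]
      rfl⟩
    have hs : freeRes k τ (zOf τ w) (embL α) ∈ (Submodule.span ℂ {f} : Set Hv) := by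
      rw [← hspan]; exact mem_iUnion.2 ⟨1, hg⟩
    obtain ⟨c, hc⟩ := Submodule.mem_span_singleton.1 hs
    exact ⟨c, by rw [← hm, ← hc, moments_smul]⟩
  obtain ⟨c, hc⟩ := key α h1
  obtain ⟨d, hd⟩ := key β h2
  have hc0 : c ≠ 0 := by
    rintro rfl
    exact hα (by rw [hc, zero_smul])
  exact ⟨d * c⁻¹, by rw [hd, hc, smul_smul, inv_mul_cancel_right₀ hc0]⟩

end Reduction

/-! ### Dissipation and the essential spectrum -/

section Essential

variable {k : V} {τ : ℝ} {w : ℂ}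

theorem map_inner_maxwellian (hk : 0 < ‖k‖) : ∃ c : NNReal, c ≠ 0 ∧
    maxwellian.map (fun v => inner ℝ v k) = gaussianReal 0 c := by
  refine ⟨(Var[innerSL ℝ k; maxwellian]).toNNReal, ?_, ?_⟩
  · rw [variance_dual_stdGaussian, innerSL_apply_norm]
    simpa using hk
  · have h := IsGaussian.map_eq_gaussianReal (μ := maxwellian) (innerSL ℝ k)
    rw [integral_strongDual_stdGaussian] at h
    rw [← h]
    congr 1
    ext v
    rw [innerSL_apply_apply, real_inner_comm]

theorem ae_inner_ne (hk : 0 < ‖k‖) (c : ℝ) : ∀ᵐ v ∂maxwellian, (inner ℝ v k : ℝ) ≠ c := by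
  obtain ⟨s, hs, h⟩ := map_inner_maxwellian hk
  have hm : Measurable fun v : V => (inner ℝ v k : ℝ) := by fun_prop
  have h0 : (maxwellian.map (fun v => inner ℝ v k)) {c} = 0 := by
    rw [h]
    exact (gaussianReal_absolutelyContinuous 0 hs) (by simp)
  rw [Measure.map_apply hm (measurableSet_singleton c)] at h0
  rw [ae_iff]
  convert h0 using 2
  ext v
  simp

theorem maxwellian_strip_pos (hk : 0 < ‖k‖) {a b : ℝ} (hab : a < b) :
    maxwellian ((fun v : V => (inner ℝ v k : ℝ)) ⁻¹' Ioo a b) ≠ 0 := by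
  obtain ⟨s, hs, h⟩ := map_inner_maxwellian hk
  have hm : Measurable fun v : V => (inner ℝ v k : ℝ) := by fun_prop
  rw [← Measure.map_apply hm measurableSet_Ioo, h]
  intro h0
  have := gaussianReal_absolutelyContinuous' 0 hs h0
  rw [Real.volume_Ioo, ENNReal.ofReal_eq_zero] at this
  linarith

theorem inner_P5_self (f : Hv) : inner ℂ f (P5 f) = inner ℂ (P5 f) (P5 f) := by
  rw [P5_apply, embL_apply, orthonormal_eL.inner_sum, inner_sum]
  refine Finset.sum_congr rfl fun j _ => ?_
  rw [inner_smul_right, moments, inner_conj_symm, mul_comm]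

/-- The linearized BGK operator has no purely imaginary eigenvalues. -/
theorem eq_zero_of_inEigenspace (hτ : 0 < τ) (hk : 0 < ‖k‖) (hw : w.re = 0) {f : Hv}
    (h : InEigenspace (bgk k τ) w f) : f = 0 := by
  have hτ' : (τ : ℂ) ≠ 0 := by exact_mod_cast hτ.ne'
  obtain ⟨hd, he⟩ := h
  have hwi : w = Complex.I * w.im := by
    apply Complex.ext <;> simp [hw]
  have h1 := coeFn_bgk_sub k τ w f hd
  have hg : ⇑(P5 f - f) =ᵐ[maxwellian] fun v =>
      Complex.I * ((τ * (inner ℝ v k + w.im) : ℝ) * f v) := by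
    rw [he, sub_self] at h1
    filter_upwards [h1, Lp.coeFn_sub (P5 f) f, Lp.coeFn_zero ℂ 2 maxwellian] with v h₁ h₂ h₃
    rw [h₃, Pi.zero_apply] at h₁
    rw [h₂, Pi.sub_apply]
    rw [hwi] at h₁
    field_simp at h₁
    push_cast
    linear_combination -h₁
  -- Pointwise P₅f - f is i times a real multiple of f, so this inner product is purely imaginary.
  -- For an orthogonal projection it equals -‖P₅f - f‖², hence P₅f = f, and then (v·k + Im w)f = 0
  -- almost everywhere.
  have hre : (inner ℂ f (P5 f - f)).re = 0 := by
    rw [L2.inner_def]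
    have : (fun v => inner ℂ (f v) ((P5 f - f : Hv) v)) =ᵐ[maxwellian] fun v =>
        Complex.I * ((τ * (inner ℝ v k + w.im) * ‖f v‖ ^ 2 : ℝ) : ℂ) := by
      filter_upwards [hg] with v hv
      rw [hv, RCLike.inner_apply]
      have := Complex.mul_conj' (f v)
      push_cast at this ⊢
      linear_combination (Complex.I * (τ * (inner ℝ v k + w.im))) * this
    rw [integral_congr_ae this, integral_const_mul, integral_complex_ofReal]
    simp
  have hz : P5 f - f = 0 := by
    have h2 : inner ℂ (P5 f - f) (P5 f - f) = -(inner ℂ f (P5 f - f) : ℂ) := by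
      rw [inner_sub_left, inner_sub_right (P5 f), ← inner_P5_self,
        ← inner_conj_symm (P5 f) f, inner_P5_self, inner_self_conj, sub_self, zero_sub]
    have h3 := congrArg Complex.re h2
    rw [Complex.neg_re, hre, neg_zero] at h3
    have h4 : ‖P5 f - f‖ ^ 2 = 0 := by
      rw [← h3]
      exact (inner_self_eq_norm_sq (𝕜 := ℂ) (P5 f - f)).symm
    exact norm_eq_zero.1 (pow_eq_zero_iff two_ne_zero |>.1 h4)
  apply Lp.ext
  rw [hz] at hg
  filter_upwards [hg, Lp.coeFn_zero ℂ 2 maxwellian, ae_inner_ne hk (-w.im)] with v h₁ h₂ h₃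
  rw [h₂, Pi.zero_apply] at h₁ ⊢
  have h4 : ((τ * (inner ℝ v k + w.im) : ℝ) : ℂ) ≠ 0 := by
    rw [Complex.ofReal_ne_zero]
    refine mul_ne_zero hτ.ne' fun h => h₃ ?_
    linarith
  have h5 := (mul_eq_zero.1 h₁.symm).resolve_left Complex.I_ne_zero
  exact (mul_eq_zero.1 h5).resolve_left h4

/-- The vertical line through `-1/τ` belongs to the spectrum. -/
theorem mem_opSpectrum_of_re_eq (hk : 0 < ‖k‖) (hw : w.re = -(1 / τ)) :
    w ∈ opSpectrum (bgk k τ) := by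
  rintro ⟨R, hR⟩
  obtain ⟨ε, hε, hRε⟩ : ∃ ε : ℝ, 0 < ε ∧ ‖R‖ * ε < 1 := by
    refine ⟨(‖R‖ + 1)⁻¹, by positivity, ?_⟩
    rw [← div_eq_mul_inv, div_lt_one (by positivity)]
    linarith
  -- Six disjoint strips on which v·k is within ε of -Im w. Their indicators span a six-dimensional
  -- space and only five moments must vanish, so some nonzero f there has P₅f = 0. It is an
  -- approximate eigenfunction with error ε, too small for the norm of R.
  set A : Fin 6 → Set V := fun i => (fun v : V => (inner ℝ v k : ℝ)) ⁻¹'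
    Ioo (-w.im + i * (ε / 6)) (-w.im + (i + 1) * (ε / 6)) with hA
  have hAm : ∀ i, MeasurableSet (A i) := fun i =>
    (by fun_prop : Measurable fun v : V => (inner ℝ v k : ℝ)) measurableSet_Ioo
  have hA0 : ∀ i, maxwellian (A i) ≠ 0 := fun i =>
    maxwellian_strip_pos hk (by nlinarith)
  have hAt : ∀ i, maxwellian (A i) ≠ ⊤ := fun i => measure_ne_top _ _
  have hAd : ∀ i j, i ≠ j → A i ∩ A j = ∅ := by
    have key : ∀ i j : Fin 6, i < j → A i ∩ A j = ∅ := by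
      intro i j hij
      ext v
      simp only [mem_inter_iff, mem_empty_iff_false, iff_false, hA, mem_preimage, mem_Ioo]
      rintro ⟨⟨_, h1⟩, ⟨h2, _⟩⟩
      have h3 : ((i : ℕ) : ℝ) + 1 ≤ ((j : ℕ) : ℝ) := by exact_mod_cast hij
      nlinarith
    intro i j hij
    rcases lt_or_gt_of_ne hij with h | h
    · exact key i j h
    · rw [inter_comm]; exact key j i h
  set b : Fin 6 → Hv := fun i => indicatorConstLp 2 (hAm i) (hAt i) (1 : ℂ) with hb
  set L : (Fin 6 → ℂ) →ₗ[ℂ] Hv := Fintype.linearCombination ℂ b with hL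
  have hker : LinearMap.ker ((momentsL : Hv →ₗ[ℂ] (Fin 5 → ℂ)) ∘ₗ L) ≠ ⊥ :=
    LinearMap.ker_ne_bot_of_finrank_lt (by simp)
  obtain ⟨c, hc, hc0⟩ := Submodule.exists_mem_ne_zero_of_ne_bot hker
  set f := L c with hf
  have hfm : moments f = 0 := LinearMap.mem_ker.1 hc
  have hfs : f = ∑ i, c i • b i := by rw [hf, hL, Fintype.linearCombination_apply]
  have hf0 : f ≠ 0 := by
    intro h0
    apply hc0
    ext j
    have h1 : inner ℂ (b j) f = 0 := by rw [h0, inner_zero_right]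
    rw [hfs, inner_sum, Finset.sum_eq_single j] at h1
    · rw [inner_smul_right, hb, L2.inner_indicatorConstLp_indicatorConstLp] at h1
      simp only [inter_self] at h1
      have h2 : maxwellian.real (A j) ≠ 0 := by
        rw [measureReal_def, ENNReal.toReal_ne_zero]
        exact ⟨hA0 j, hAt j⟩
      simpa [h2] using h1
    · intro i _ hij
      rw [inner_smul_right, hb, L2.inner_indicatorConstLp_indicatorConstLp, hAd j i hij.symm]
      simp
    · simp
  have hfae : ⇑f =ᵐ[maxwellian] fun v => ∑ i, c i * (A i).indicator (fun _ => (1 : ℂ)) v := by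
    rw [hfs]
    have h1 : ∀ᵐ v ∂maxwellian, ∀ i, b i v = (A i).indicator (fun _ => (1 : ℂ)) v :=
      ae_all_iff.2 fun i => indicatorConstLp_coeFn
    have h2 : ∀ᵐ v ∂maxwellian, ∀ i, (c i • b i : Hv) v = c i * b i v :=
      ae_all_iff.2 fun i => Lp.coeFn_smul (c i) (b i)
    filter_upwards [h1, h2, Lp.coeFn_finsetSum Finset.univ fun i => c i • b i] with v h₁ h₂ h₃
    rw [h₃, Finset.sum_apply]
    exact Finset.sum_congr rfl fun i _ => by rw [h₂, h₁]
  have hbound : ∀ᵐ v ∂maxwellian, ‖((inner ℝ v k + w.im : ℝ) : ℂ) * f v‖ ≤ ε * ‖f v‖ := by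
    filter_upwards [hfae] with v hv
    rw [norm_mul]
    by_cases h : ∃ i, v ∈ A i
    · obtain ⟨i, hi⟩ := h
      refine mul_le_mul_of_nonneg_right ?_ (norm_nonneg _)
      obtain ⟨h1, h2⟩ := hi
      have h3 : ((i : ℕ) : ℝ) + 1 ≤ 6 := by exact_mod_cast i.2
      have h4 : (0 : ℝ) ≤ ((i : ℕ) : ℝ) := Nat.cast_nonneg _
      rw [Complex.norm_real, Real.norm_eq_abs, abs_le]
      constructor <;> nlinarith
    · have : f v = 0 := by
        rw [hv]
        refine Finset.sum_eq_zero fun i _ => ?_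
        rw [indicator_of_notMem (fun hi => h ⟨i, hi⟩), mul_zero]
      simp [this]
  have hd : f ∈ (bgk k τ).domain := by
    change MemLp (fun v => ((inner ℝ v k : ℝ) : ℂ) * f v) 2 maxwellian
    refine (Lp.memLp f).of_le_mul (c := ε + |w.im|) (by
      refine AEStronglyMeasurable.mul (Measurable.aestronglyMeasurable (by fun_prop))
        (Lp.aestronglyMeasurable f)) ?_
    filter_upwards [hbound] with v hv
    have h1 : ((inner ℝ v k : ℝ) : ℂ) * f v =
        ((inner ℝ v k + w.im : ℝ) : ℂ) * f v - (w.im : ℂ) * f v := by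
      push_cast; ring
    rw [h1]
    refine (norm_sub_le _ _).trans ?_
    rw [norm_mul (w.im : ℂ), Complex.norm_real, Real.norm_eq_abs, add_mul]
    linarith
  have hP : P5 f = 0 := by rw [P5_apply, hfm, map_zero]
  have hwi : w = -(τ : ℂ)⁻¹ + Complex.I * w.im := by
    apply Complex.ext
    · simp [hw, ← Complex.ofReal_inv]
    · simp [← Complex.ofReal_inv]
  have hle : ‖bgk k τ ⟨f, hd⟩ - w • f‖ ≤ ε * ‖f‖ := by
    refine Lp.norm_le_mul_norm_of_ae_le_mul ?_
    filter_upwards [coeFn_bgk_sub k τ w f hd, hbound, Lp.coeFn_zero ℂ 2 maxwellian] with v h₁ h₂ h₃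
    rw [h₁, hP, h₃, Pi.zero_apply, sub_zero]
    have h4 : -Complex.I * (((inner ℝ v k : ℝ) : ℂ) * f v) - (τ : ℂ)⁻¹ * f v - w * f v =
        -Complex.I * (((inner ℝ v k + w.im : ℝ) : ℂ) * f v) := by
      nth_rewrite 1 [hwi]
      push_cast
      ring
    rw [h4, norm_mul, norm_neg, Complex.norm_I, one_mul]
    exact h₂
  have h1 : R (bgk k τ ⟨f, hd⟩ - w • f) = f := hR.2 ⟨f, hd⟩
  have h2 : ‖f‖ ≤ ‖R‖ * (ε * ‖f‖) := by
    calc ‖f‖ = ‖R (bgk k τ ⟨f, hd⟩ - w • f)‖ := by rw [h1]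
      _ ≤ ‖R‖ * ‖bgk k τ ⟨f, hd⟩ - w • f‖ := R.le_opNorm _
      _ ≤ _ := mul_le_mul_of_nonneg_left hle (norm_nonneg _)
  have h3 : 0 < ‖f‖ := norm_pos_iff.2 hf0
  nlinarith

end Essential

/-! ### Contour integrals -/

section Contours

variable {γ : ℝ → ℂ}

theorem exists_isolating_radius (s : Finset ℝ) (t : ℝ) :
    ∃ ε > 0, Disjoint (Ioo (t - ε) t) (s : Set ℝ) ∧ Disjoint (Ioo t (t + ε)) (s : Set ℝ) := by
  have hfin : ((s.erase t : Finset ℝ) : Set ℝ)ᶜ ∈ 𝓝 t :=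
    (Finset.finite_toSet _).isClosed.isOpen_compl.mem_nhds (by simp)
  obtain ⟨ε, hε, hball⟩ := Metric.mem_nhds_iff.1 hfin
  refine ⟨ε, hε, Set.disjoint_left.2 fun p hp hps => ?_, Set.disjoint_left.2 fun p hp hps => ?_⟩
  · refine hball (a := p) ?_ (Finset.mem_coe.2 (Finset.mem_erase.2 ⟨hp.2.ne, hps⟩))
    rw [Metric.mem_ball, Real.dist_eq, abs_lt]
    exact ⟨by linarith [hp.1], by linarith [hp.2]⟩
  · refine hball (a := p) ?_ (Finset.mem_coe.2 (Finset.mem_erase.2 ⟨hp.1.ne', hps⟩))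
    rw [Metric.mem_ball, Real.dist_eq, abs_lt]
    exact ⟨by linarith [hp.1], by linarith [hp.2]⟩

theorem integrableOn_deriv_of_contDiffOn {a b : ℝ} (hab : a < b)
    (h : ContDiffOn ℝ 1 γ (Icc a b)) : IntegrableOn (deriv γ) (Icc a b) := by
  have hc := h.continuousOn_derivWithin (uniqueDiffOn_Icc hab) le_rfl
  have hi : IntegrableOn (derivWithin γ (Icc a b)) (Ioo a b) :=
    (hc.integrableOn_compact isCompact_Icc).mono_set Ioo_subset_Icc_self
  rw [integrableOn_Icc_iff_integrableOn_Ioo]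
  refine hi.congr_fun (fun t ht => ?_) measurableSet_Ioo
  exact derivWithin_of_mem_nhds (Icc_mem_nhds ht.1 ht.2)

/-- On a C¹ piece the derivative agrees, inside, with a continuous function on the closed piece.
Checking local integrability on both sides of each parameter avoids having to order the break
points. -/
theorem IsClosedContour.intervalIntegrable_deriv (h : IsClosedContour γ) :
    IntervalIntegrable (deriv γ) volume 0 1 := by
  obtain ⟨s, hs⟩ := h.piecewise
  have hpiece : ∀ a b : ℝ, 0 ≤ a → a ≤ b → b ≤ 1 → Disjoint (Ioo a b) (s : Set ℝ) →
      IntegrableOn (deriv γ) (Icc a b) := by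
    intro a b ha hab hb hd
    rcases hab.eq_or_lt with rfl | hab
    · simp
    · exact integrableOn_deriv_of_contDiffOn hab (hs a b ha hab hb hd)
  have hloc : LocallyIntegrableOn (deriv γ) (Icc (0 : ℝ) 1) := by
    intro t ht
    obtain ⟨ε, hε, hl, hr⟩ := exists_isolating_radius s t
    have h1 := hpiece (max 0 (t - ε)) t (le_max_left _ _) (max_le ht.1 (by linarith)) ht.2
      (hl.mono_left (Ioo_subset_Ioo_left (le_max_right _ _)))
    have h2 := hpiece t (min 1 (t + ε)) ht.1 (le_min ht.2 (by linarith)) (min_le_left _ _)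
      (hr.mono_left (Ioo_subset_Ioo_right (min_le_right _ _)))
    refine ⟨_, ?_, h1.union h2⟩
    have hI : Icc (0 : ℝ) 1 ∩ Ioo (t - ε) (t + ε) ∈ 𝓝[Icc 0 1] t :=
      Filter.inter_mem self_mem_nhdsWithin
        (mem_nhdsWithin_of_mem_nhds (Ioo_mem_nhds (by linarith) (by linarith)))
    refine Filter.mem_of_superset hI ?_
    rintro p ⟨hp, hp'⟩
    rcases le_total p t with hpt | hpt
    · exact Or.inl ⟨max_le hp.1 hp'.1.le, hpt⟩
    · exact Or.inr ⟨hpt, le_min hp.2 hp'.2.le⟩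
  rw [intervalIntegrable_iff_integrableOn_Icc_of_le zero_le_one]
  exact hloc.integrableOn_isCompact isCompact_Icc

theorem IsClosedContour.exists_differentiableAt (h : IsClosedContour γ) :
    ∃ s : Finset ℝ, ∀ t ∈ Ioo (0 : ℝ) 1 \ s, DifferentiableAt ℝ γ t := by
  obtain ⟨s, hs⟩ := h.piecewise
  refine ⟨s, fun t ht => ?_⟩
  have hopen : Ioo (0 : ℝ) 1 ∩ (s : Set ℝ)ᶜ ∈ 𝓝 t :=
    Filter.inter_mem (Ioo_mem_nhds ht.1.1 ht.1.2)
      ((Finset.finite_toSet s).isClosed.isOpen_compl.mem_nhds ht.2)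
  obtain ⟨ε, hε, hball⟩ := Metric.mem_nhds_iff.1 hopen
  have hsub : Icc (t - ε / 2) (t + ε / 2) ⊆ Ioo (0 : ℝ) 1 ∩ (s : Set ℝ)ᶜ := by
    intro p hp
    refine hball ?_
    rw [Metric.mem_ball, Real.dist_eq, abs_lt]
    exact ⟨by linarith [hp.1], by linarith [hp.2]⟩
  have h0 := (hsub (left_mem_Icc.2 (by linarith))).1.1
  have h1 := (hsub (right_mem_Icc.2 (by linarith))).1.2
  have hd := hs (t - ε / 2) (t + ε / 2) h0.le (by linarith) h1.le
    (Set.disjoint_left.2 fun p hp hps => (hsub (Ioo_subset_Icc_self hp)).2 hps)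
  exact (hd.differentiableOn one_ne_zero).differentiableAt
    (Icc_mem_nhds (by linarith) (by linarith))

variable {E : Type*} [NormedAddCommGroup E] [NormedSpace ℂ E]

theorem IsClosedContour.intervalIntegrable (h : IsClosedContour γ) {f : ℂ → E}
    (hf : ContinuousOn (fun t => f (γ t)) (Icc 0 1)) :
    IntervalIntegrable (fun t => deriv γ t • f (γ t)) volume 0 1 := by
  refine h.intervalIntegrable_deriv.smul_continuousOn ?_
  rwa [uIcc_of_le zero_le_one]

theorem contourIntegral_congr {f g : ℂ → E} (hfg : ∀ t ∈ Icc (0 : ℝ) 1, f (γ t) = g (γ t)) :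
    contourIntegral γ f = contourIntegral γ g := by
  refine intervalIntegral.integral_congr fun t ht => ?_
  rw [uIcc_of_le zero_le_one] at ht
  simp only [hfg t ht]

/-- The fundamental theorem of calculus along γ; finitely many corners are harmless because the
primitive is continuous along the curve. -/
theorem IsClosedContour.contourIntegral_eq_zero [CompleteSpace E] (h : IsClosedContour γ)
    {f g : ℂ → E} (hg : ∀ t ∈ Icc (0 : ℝ) 1, HasDerivAt g (f (γ t)) (γ t))
    (hf : ContinuousOn (fun t => f (γ t)) (Icc 0 1)) : contourIntegral γ f = 0 := by
  obtain ⟨s, hs⟩ := h.exists_differentiableAt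
  have key := MeasureTheory.integral_eq_of_hasDerivAt_off_countable_of_le (fun t => g (γ t))
    (fun t => deriv γ t • f (γ t)) zero_le_one (s.countable_toSet)
    (fun t ht => (hg t ht).continuousAt.comp_continuousWithinAt (h.continuousOn t ht))
    (fun t ht => (hg t (Ioo_subset_Icc_self ht.1)).scomp t (hs t ht).hasDerivAt)
    (h.intervalIntegrable hf)
  rw [contourIntegral, key]
  simp only [h.closed, sub_self]

theorem contourIntegral_zOf (τ : ℝ) (γ : ℝ → ℂ) (f : ℂ → E) :
    contourIntegral (fun t => zOf τ (γ t)) f = (-τ : ℂ) • contourIntegral γ (fun w => f (zOf τ w)) := by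
  rw [contourIntegral, contourIntegral, ← intervalIntegral.integral_smul]
  congr 1
  ext t
  have : deriv (fun t => zOf τ (γ t)) t = -τ * deriv γ t := by
    simp only [zOf]
    rw [deriv_sub_const, deriv_const_mul_field]
  rw [this, mul_smul]

theorem IsClosedContour.zOf (h : IsClosedContour γ) (τ : ℝ) :
    IsClosedContour (fun t => BGK.zOf τ (γ t)) := by
  refine ⟨by rw [h.closed], ?_, ?_⟩
  · exact (continuousOn_const.mul h.continuousOn).sub continuousOn_const
  · obtain ⟨s, hs⟩ := h.piecewise
    refine ⟨s, fun a b ha hab hb hd => ?_⟩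
    exact (contDiffOn_const.mul (hs a b ha hab hb hd)).sub contDiffOn_const

theorem windingNumber_zOf {τ : ℝ} (hτ : τ ≠ 0) (γ : ℝ → ℂ) (w : ℂ) :
    windingNumber (fun t => zOf τ (γ t)) (zOf τ w) = windingNumber γ w := by
  have hτ' : (τ : ℂ) ≠ 0 := by exact_mod_cast hτ
  rw [windingNumber, windingNumber, contourIntegral_zOf, contourIntegral, contourIntegral,
    ← intervalIntegral.integral_smul]
  congr 2
  ext t
  have : zOf τ (γ t) - zOf τ w = -τ * (γ t - w) := by simp only [zOf]; ring
  rw [this, mul_inv, smul_eq_mul, smul_eq_mul, smul_eq_mul]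
  field_simp

end Contours

/-! ### Principal parts and residues -/

/-- `f` has at most a pole at `s`, with residue `ρ`: the Laurent principal part is explicit. -/
def HasPolarPart (f : ℂ → ℂ) (s ρ : ℂ) : Prop :=
  ∃ (N : ℕ) (a : ℕ → ℂ) (g : ℂ → ℂ), a 0 = ρ ∧ AnalyticAt ℂ g s ∧
    ∀ᶠ z in 𝓝[≠] s, f z = ∑ j ∈ Finset.range (N + 1), a j * ((z - s) ^ (j + 1))⁻¹ + g z

theorem analyticAt_dslope {F : ℂ → ℂ} {s : ℂ} (hF : AnalyticAt ℂ F s) :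
    AnalyticAt ℂ (dslope F s) s := by
  obtain ⟨p, hp⟩ := hF
  exact ⟨_, hp.has_fpower_series_dslope_fslope⟩

/-- Repeated division: F = F(s) + (z - s) `dslope F s`. The value F(s) is the coefficient of the
pole of highest order, and the slope is treated by induction. -/
theorem exists_laurent (n : ℕ) {F : ℂ → ℂ} {s : ℂ} (hF : AnalyticAt ℂ F s) :
    ∃ (a : ℕ → ℂ) (g : ℂ → ℂ), AnalyticAt ℂ g s ∧ ∀ z ≠ s,
      ((z - s) ^ n)⁻¹ * F z = ∑ j ∈ Finset.range n, a j * ((z - s) ^ (j + 1))⁻¹ + g z := by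
  induction n generalizing F with
  | zero => exact ⟨0, F, hF, fun z _ => by simp⟩
  | succ n ih =>
    obtain ⟨a, g, hg, h⟩ := ih (analyticAt_dslope hF)
    refine ⟨Function.update a n (F s), g, hg, fun z hz => ?_⟩
    have hzs : z - s ≠ 0 := sub_ne_zero.2 hz
    have hF' : F z = F s + (z - s) * dslope F s z := by
      have := sub_smul_dslope F s z
      rw [smul_eq_mul] at this
      rw [this]; ring
    have hsum : ∑ j ∈ Finset.range n, Function.update a n (F s) j * ((z - s) ^ (j + 1))⁻¹
        = ∑ j ∈ Finset.range n, a j * ((z - s) ^ (j + 1))⁻¹ :=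
      Finset.sum_congr rfl fun j hj => by
        rw [Function.update_of_ne (Finset.mem_range.1 hj).ne]
    rw [Finset.sum_range_succ, hsum, Function.update_self, hF', add_right_comm, ← h z hz]
    field_simp
    ring

theorem _root_.MeromorphicAt.exists_hasPolarPart {f : ℂ → ℂ} {s : ℂ} (hf : MeromorphicAt f s) :
    ∃ ρ, HasPolarPart f s ρ := by
  obtain ⟨n, hn⟩ := hf
  -- The extra factor z - s makes the principal part have at least one term, so that the coefficient
  -- `a 0` is meaningful even for n = 0.
  have h1 : AnalyticAt ℂ (fun z => (z - s) * ((z - s) ^ n • f z)) s :=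
    (analyticAt_id.sub analyticAt_const).mul hn
  obtain ⟨a, g, hg, h⟩ := exists_laurent (n + 1) h1
  refine ⟨a 0, n, a, g, rfl, hg, ?_⟩
  filter_upwards [self_mem_nhdsWithin] with z hz
  rw [← h z hz]
  have hzs : z - s ≠ 0 := sub_ne_zero.2 hz
  rw [smul_eq_mul]
  field_simp
  ring

theorem HasPolarPart.congr {f f' : ℂ → ℂ} {s ρ : ℂ} (h : HasPolarPart f s ρ)
    (hff' : f =ᶠ[𝓝[≠] s] f') : HasPolarPart f' s ρ := by
  obtain ⟨N, a, g, ha, hg, h⟩ := h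
  refine ⟨N, a, g, ha, hg, ?_⟩
  filter_upwards [h, hff'] with z h1 h2
  rw [← h2, h1]

theorem HasPolarPart.sub_analyticAt {f u : ℂ → ℂ} {s ρ : ℂ} (h : HasPolarPart f s ρ)
    (hu : AnalyticAt ℂ u s) : HasPolarPart (fun z => f z - u z) s ρ := by
  obtain ⟨N, a, g, ha, hg, h⟩ := h
  refine ⟨N, a, fun z => g z - u z, ha, hg.sub hu, ?_⟩
  filter_upwards [h] with z hz
  rw [hz]; ring

theorem hasPolarPart_sub_inv_mul {F : ℂ → ℂ} {s : ℂ} (hF : AnalyticAt ℂ F s) :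
    HasPolarPart (fun z => (z - s)⁻¹ * F z) s (F s) := by
  refine ⟨0, fun _ => F s, dslope F s, rfl, analyticAt_dslope hF, ?_⟩
  filter_upwards [self_mem_nhdsWithin] with z hz
  have hzs : z - s ≠ 0 := sub_ne_zero.2 hz
  have := sub_smul_dslope F s z
  rw [smul_eq_mul] at this
  have hF' : F z = F s + (z - s) * dslope F s z := by rw [this]; ring
  rw [hF']
  simp
  field_simp

theorem hasPolarPart_inv_mul_of_simple_zero {D F : ℂ → ℂ} {s D' : ℂ} (hD : AnalyticAt ℂ D s)
    (hF : AnalyticAt ℂ F s) (h0 : D s = 0) (h1 : HasDerivAt D D' s) (hD' : D' ≠ 0) :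
    HasPolarPart (fun z => (D z)⁻¹ * F z) s (D'⁻¹ * F s) := by
  have hs : dslope D s s = D' := by rw [dslope_same, h1.deriv]
  have := hasPolarPart_sub_inv_mul (s := s)
    (((analyticAt_dslope hD).inv (by rwa [hs])).mul hF)
  simp only [Pi.mul_apply, Pi.inv_apply, hs] at this
  refine this.congr ?_
  filter_upwards [self_mem_nhdsWithin] with z hz
  have h2 := sub_smul_dslope D s z
  rw [smul_eq_mul, h0, sub_zero] at h2
  rw [← h2, mul_inv, mul_assoc]

theorem HasPolarPart.hasResidueAt {f : ℂ → ℂ} {s ρ : ℂ} (h : HasPolarPart f s ρ)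
    (hf : ∀ᶠ z in 𝓝[≠] s, AnalyticAt ℂ f z) : HasResidueAt f s ρ := by
  refine ⟨hf, ?_⟩
  obtain ⟨N, a, g, rfl, hg, h⟩ := h
  obtain ⟨ε, hε, hball⟩ := Metric.mem_nhds_iff.1
    (Filter.inter_mem hg.eventually_analyticAt (eventually_nhdsWithin_iff.1 h))
  have hmem : Ioo (0 : ℝ) ε ∈ 𝓝[>] (0 : ℝ) := Ioo_mem_nhdsGT hε
  filter_upwards [hmem] with r hr
  have hsub : Metric.closedBall s r ⊆ Metric.ball s ε := Metric.closedBall_subset_ball hr.2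
  have hne : ∀ z ∈ Metric.sphere s r, z - s ≠ 0 := fun z hz h0 => by
    rw [mem_sphere_iff_norm, h0, norm_zero] at hz
    exact hr.1.ne hz
  have hcont : ∀ j, ContinuousOn (fun z => a j * ((z - s) ^ (j + 1))⁻¹) (Metric.sphere s r) :=
    fun j => continuousOn_const.mul (((continuousOn_id.sub continuousOn_const).pow _).inv₀
      fun z hz => pow_ne_zero _ (hne z hz))
  have hgc : ContinuousOn g (Metric.closedBall s r) := fun z hz =>
    (hball (hsub hz)).1.continuousAt.continuousWithinAt
  have hg0 : ∮ z in C(s, r), g z = 0 :=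
    Complex.circleIntegral_eq_zero_of_differentiable_on_off_countable hr.1.le
      Set.countable_empty hgc
      fun z hz => (hball (hsub (Metric.ball_subset_closedBall hz.1))).1.differentiableAt
  have hI : ∮ z in C(s, r), f z = ∮ z in C(s, r),
      ((∑ j ∈ Finset.range (N + 1), a j * ((z - s) ^ (j + 1))⁻¹) + g z) := by
    refine circleIntegral.integral_congr hr.1.le fun z hz => ?_
    exact (hball (hsub (Metric.sphere_subset_closedBall hz))).2 (sub_ne_zero.1 (hne z hz))
  rw [hI, circleIntegral.integral_add
      ((continuousOn_finsetSum _ fun j _ => hcont j).circleIntegrable hr.1.le)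
      ((hgc.mono Metric.sphere_subset_closedBall).circleIntegrable hr.1.le), hg0, add_zero,
    circleIntegral.integral_fun_sum fun j _ => (hcont j).circleIntegrable hr.1.le,
    Finset.sum_eq_single 0]
  · simp only [zero_add, pow_one]
    rw [circleIntegral.integral_const_mul, circleIntegral.integral_sub_center_inv s hr.1.ne']
    field_simp
  · intro j _ hj
    rw [circleIntegral.integral_const_mul]
    have : ∮ z in C(s, r), ((z - s) ^ (j + 1))⁻¹ = ∮ z in C(s, r), (z - s) ^ (-(j + 1 : ℤ)) := by
      congr 1
    rw [this, circleIntegral.integral_sub_zpow_of_ne (by omega), mul_zero]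
  · intro h0
    simp at h0

theorem IsClosedContour.contourIntegral_principalPart {γ : ℝ → ℂ} (h : IsClosedContour γ) {s : ℂ}
    (hs : ∀ t ∈ Icc (0 : ℝ) 1, γ t ≠ s) (N : ℕ) (a : ℕ → ℂ) :
    contourIntegral γ (fun z => ∑ j ∈ Finset.range (N + 1), a j * ((z - s) ^ (j + 1))⁻¹) =
      a 0 * contourIntegral γ (fun z => (z - s)⁻¹) := by
  have hne : ∀ t ∈ Icc (0 : ℝ) 1, γ t - s ≠ 0 := fun t ht => sub_ne_zero.2 (hs t ht)
  have hc : ∀ j : ℕ, ContinuousOn (fun t => ((γ t - s) ^ (j + 1))⁻¹) (Icc (0 : ℝ) 1) := fun j =>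
    ((h.continuousOn.sub continuousOn_const).pow _).inv₀ fun t ht => pow_ne_zero _ (hne t ht)
  have hz : ∀ j : ℕ, j ≠ 0 → contourIntegral γ (fun z => ((z - s) ^ (j + 1))⁻¹) = 0 := by
    intro j hj
    have hj' : (j : ℂ) ≠ 0 := by exact_mod_cast hj
    refine h.contourIntegral_eq_zero (g := fun z => -(j : ℂ)⁻¹ * ((z - s) ^ j)⁻¹)
      (fun t ht => ?_) (hc j)
    have h1 := ((((hasDerivAt_id (γ t)).sub_const s).pow j).inv
      (pow_ne_zero j (hne t ht))).const_mul (-(j : ℂ)⁻¹)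
    refine h1.congr_deriv ?_
    have := hne t ht
    obtain ⟨i, rfl⟩ := Nat.exists_eq_succ_of_ne_zero hj
    simp only [id, Nat.succ_eq_add_one, Nat.add_sub_cancel, Pi.pow_apply] at *
    field_simp
    ring
  have hsum : contourIntegral γ (fun z => ∑ j ∈ Finset.range (N + 1), a j * ((z - s) ^ (j + 1))⁻¹)
      = ∑ j ∈ Finset.range (N + 1), a j * contourIntegral γ (fun z => ((z - s) ^ (j + 1))⁻¹) := by
    simp only [contourIntegral, smul_eq_mul, Finset.mul_sum]
    rw [intervalIntegral.integral_finsetSum]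
    · refine Finset.sum_congr rfl fun j _ => ?_
      rw [← intervalIntegral.integral_const_mul]
      congr 1
      ext t
      ring
    · intro j _
      have := (h.intervalIntegrable (f := fun z => ((z - s) ^ (j + 1))⁻¹) (hc j)).const_mul (a j)
      refine this.congr fun t _ => ?_
      simp only [smul_eq_mul]
      ring
  rw [hsum, Finset.sum_eq_single 0]
  · simp
  · intro j _ hj
    rw [hz j hj, mul_zero]
  · intro h0
    simp at h0

/-- The residue theorem in a disc. -/
theorem IsClosedContour.contourIntegral_eq_sum {γ : ℝ → ℂ} (h : IsClosedContour γ) {c : ℂ} {r : ℝ}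
    (hγ : ∀ t ∈ Icc (0 : ℝ) 1, γ t ∈ Metric.ball c r) (T : Finset ℂ)
    (hT : ∀ t ∈ Icc (0 : ℝ) 1, γ t ∉ T) (ρ : ℂ → ℂ) {f : ℂ → ℂ}
    (hf : ∀ z ∈ Metric.ball c r, z ∉ T → AnalyticAt ℂ f z)
    (hρ : ∀ s ∈ T, s ∈ Metric.ball c r → HasPolarPart f s (ρ s))
    (hTb : ∀ s ∈ T, s ∈ Metric.ball c r) :
    contourIntegral γ f = ∑ s ∈ T, ρ s * contourIntegral γ (fun z => (z - s)⁻¹) := by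
  classical
  induction T using Finset.induction_on generalizing f with
  | empty =>
    have hd : DifferentiableOn ℂ f (Metric.ball c r) := fun z hz =>
      (hf z hz (by simp)).differentiableAt.differentiableWithinAt
    obtain ⟨g, hg⟩ := hd.isExactOn_ball
    simpa using h.contourIntegral_eq_zero (fun t ht => hg _ (hγ t ht))
      (hd.continuousOn.comp h.continuousOn hγ)
  | insert s T hsT ih =>
    obtain ⟨N, a, g, ha, hg, hloc⟩ := hρ s (by simp) (hTb s (by simp))
    set p : ℂ → ℂ := fun z => ∑ j ∈ Finset.range (N + 1), a j * ((z - s) ^ (j + 1))⁻¹ with hp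
    have hpa : ∀ z, z ≠ s → AnalyticAt ℂ p z := by
      intro z hz
      refine Finset.analyticAt_fun_sum _ fun j _ => ?_
      exact analyticAt_const.mul (((analyticAt_id.sub analyticAt_const).pow _).inv
        (pow_ne_zero _ (sub_ne_zero.2 hz)))
    -- Subtracting the principal part leaves a removable singularity. Filling in the value g(s)
    -- makes the difference analytic at s, so the induction hypothesis applies with one pole less.
    set f₁ : ℂ → ℂ := Function.update (fun z => f z - p z) s (g s) with hf₁
    have hf₁ne : ∀ z, z ≠ s → f₁ z = f z - p z := fun z hz => by
      rw [hf₁, Function.update_of_ne hz]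
    have hf₁ev : ∀ z, z ≠ s → f₁ =ᶠ[𝓝 z] fun z => f z - p z := fun z hz => by
      filter_upwards [isOpen_ne.mem_nhds hz] with u hu using hf₁ne u hu
    have hf₁s : f₁ =ᶠ[𝓝 s] g := by
      have := eventually_nhdsWithin_iff.1 hloc
      filter_upwards [this] with z hz
      rcases eq_or_ne z s with rfl | hzs
      · rw [hf₁, Function.update_self]
      · rw [hf₁ne z hzs, hz hzs, hp]
        ring
    have key := ih (f := f₁) (fun t ht hm => hT t ht (Finset.mem_insert_of_mem hm))
      (fun z hz hzT => by
        rcases eq_or_ne z s with rfl | hzs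
        · exact hg.congr hf₁s.symm
        · exact ((hf z hz (by simp [hzs, hzT])).sub (hpa z hzs)).congr (hf₁ev z hzs).symm)
      (fun s' hs' hb => by
        have hne : s' ≠ s := fun h => hsT (h ▸ hs')
        exact ((hρ s' (Finset.mem_insert_of_mem hs') hb).sub_analyticAt (hpa s' hne)).congr
          ((hf₁ev s' hne).symm.filter_mono nhdsWithin_le_nhds))
      (fun s' hs' => hTb s' (Finset.mem_insert_of_mem hs'))
    have hγs : ∀ t ∈ Icc (0 : ℝ) 1, γ t ≠ s := fun t ht h => hT t ht (by simp [h])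
    have hfc : ContinuousOn (fun t => f (γ t)) (Icc 0 1) := fun t ht =>
      (hf _ (hγ t ht) (hT t ht)).continuousAt.comp_continuousWithinAt (h.continuousOn t ht)
    have hpc : ContinuousOn (fun t => p (γ t)) (Icc 0 1) := fun t ht =>
      (hpa _ (hγs t ht)).continuousAt.comp_continuousWithinAt (h.continuousOn t ht)
    rw [Finset.sum_insert hsT, ← key, ← ha, ← h.contourIntegral_principalPart hγs N a,
      contourIntegral_congr (f := f₁) (g := fun z => f z - p z)
        (fun t ht => hf₁ne _ (hγs t ht))]
    have hi := intervalIntegral.integral_sub (h.intervalIntegrable hfc) (h.intervalIntegrable hpc)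
    simp only [← smul_sub] at hi
    simp only [contourIntegral] at hi ⊢
    rw [hi]
    ring

/-- A compact subset of the open left half-plane lies in a disc contained in it. -/
theorem exists_ball_of_isCompact {K : Set ℂ} (hK : IsCompact K) (hneg : ∀ z ∈ K, z.re < 0) :
    ∃ r : ℝ, ∀ z ∈ K, z ∈ Metric.ball (-r : ℂ) r := by
  have hc : ContinuousOn (fun z : ℂ => ‖z‖ ^ 2 / (-2 * z.re)) K :=
    (by fun_prop : Continuous fun z : ℂ => ‖z‖ ^ 2).continuousOn.div
      (by fun_prop : Continuous fun z : ℂ => -2 * z.re).continuousOn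
      fun z hz => by have := hneg z hz; nlinarith
  obtain ⟨M, hM⟩ := hK.bddAbove_image hc
  -- The condition |z + r| < r means |z|² < -2r Re z, so any positive r above the maximum of
  -- |z|²/(-2 Re z) on K works.
  refine ⟨max M 0 + 1, fun z hz => ?_⟩
  have h1 : ‖z‖ ^ 2 / (-2 * z.re) ≤ M := hM ⟨z, hz, rfl⟩
  have h2 := hneg z hz
  set r := max M 0 + 1
  have hr : M < r := (le_max_left M 0).trans_lt (lt_add_one _)
  have hr0 : 0 < r := (le_max_right M 0).trans_lt (lt_add_one _)
  have h3 : ‖z‖ ^ 2 < r * (-2 * z.re) := (div_lt_iff₀ (by linarith)).1 (h1.trans_lt hr)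
  rw [mem_ball_iff_norm, sub_neg_eq_add]
  refine lt_of_pow_lt_pow_left₀ 2 hr0.le ?_
  rw [← Complex.normSq_eq_norm_sq, Complex.normSq_apply] at h3 ⊢
  simp
  nlinarith

theorem re_lt_zero_of_mem_ball {r : ℝ} {z : ℂ} (hz : z ∈ Metric.ball (-r : ℂ) r) : z.re < 0 := by
  rw [mem_ball_iff_norm, sub_neg_eq_add] at hz
  have := (Complex.abs_re_le_norm (z + r)).trans_lt hz
  rw [abs_lt] at this
  simp at this
  linarith [this.2]

/-- A closed contour that avoids a vertical line and winds around a point to the right of it stays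
to the right of it. -/
theorem IsClosedContour.re_lt_of_windingNumber {γ : ℝ → ℂ} (h : IsClosedContour γ) {x : ℝ}
    (hx : ∀ t ∈ Icc (0 : ℝ) 1, (γ t).re ≠ x) {w : ℂ} (hw : x < w.re)
    (hwind : windingNumber γ w ≠ 0) : ∀ t ∈ Icc (0 : ℝ) 1, x < (γ t).re := by
  by_contra! hcon
  obtain ⟨t₀, ht₀, hle⟩ := hcon
  have hre : ContinuousOn (fun t => (γ t).re) (Icc 0 1) :=
    Complex.continuous_re.comp_continuousOn h.continuousOn
  have hall : ∀ t ∈ Icc (0 : ℝ) 1, (γ t).re < x := by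
    intro t ht
    by_contra! hge
    obtain ⟨u, hu, hux⟩ := isPreconnected_Icc.intermediate_value ht₀ ht hre ⟨hle, hge⟩
    exact hx u hu hux
  apply hwind
  have hne : ∀ t ∈ Icc (0 : ℝ) 1, γ t - w ≠ 0 := fun t ht h0 => by
    have := hall t ht
    rw [sub_eq_zero.1 h0] at this
    linarith
  -- On the left of the line w - γ(t) has positive real part, so the principal logarithm of w - z is
  -- a primitive along the whole contour.
  rw [windingNumber, h.contourIntegral_eq_zero (g := fun z => Complex.log (w - z)), mul_zero]
  · intro t ht
    have hs : w - γ t ∈ Complex.slitPlane := Or.inl (by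
      have := hall t ht
      simp only [Complex.sub_re]
      linarith)
    refine (((hasDerivAt_id (γ t)).const_sub w).clog hs).congr_deriv ?_
    have := hne t ht
    have h2 : w - γ t ≠ 0 := fun h0 => this (by linear_combination -h0)
    simp only [id]
    field_simp
    ring
  · exact (h.continuousOn.sub continuousOn_const).inv₀ hne

/-! ### Finiteness of the hydrodynamic spectrum -/

section Finiteness

/-- The recurrences absorb all powers of ζ: every entry is a constant combination of `lapl 0` to
`lapl 4`, shifted by -x on the diagonal. The matrix thus tends to -x times the identity. -/
theorem tendsto_det_shiftedMat_lapl (x : ℂ) :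
    Tendsto (fun ζ => (shiftedMat x ζ (Complex.I * lapl 0 ζ)).det)
      (Bornology.cobounded ℂ ⊓ 𝓟 {ζ | 0 ≤ ζ.im}) (𝓝 (-x ^ 5)) := by
  set l : Filter ℂ := Bornology.cobounded ℂ ⊓ 𝓟 {ζ | 0 ≤ ζ.im}
  have h0 : Tendsto (lapl 0) l (𝓝 0) := tendsto_lapl 0
  have h1 : Tendsto (lapl 1) l (𝓝 0) := tendsto_lapl 1
  have h2 : Tendsto (lapl 2) l (𝓝 0) := tendsto_lapl 2
  have h3 : Tendsto (lapl 3) l (𝓝 0) := tendsto_lapl 3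
  have h4 : Tendsto (lapl 4) l (𝓝 0) := tendsto_lapl 4
  have hq : ∀ ζ, heatFun ζ (Complex.I * lapl 0 ζ) = -Complex.I * lapl 2 ζ := fun ζ => by
    rw [heatFun, lapl_two, lapl_one]
    linear_combination (ζ + ζ ^ 2 * Complex.I * lapl 0 ζ) * Complex.I_sq
  have hb : ∀ ζ, 1 + ζ * (Complex.I * lapl 0 ζ) = lapl 1 ζ := fun ζ => by
    rw [lapl_one]; ring
  have hd : ∀ ζ, ζ + ζ ^ 2 * (Complex.I * lapl 0 ζ) = -Complex.I * (lapl 2 ζ - lapl 0 ζ) :=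
    fun ζ => by
      rw [lapl_two, lapl_one]
      linear_combination (ζ + ζ ^ 2 * Complex.I * lapl 0 ζ) * Complex.I_sq
  have hf : ∀ ζ, ζ * heatFun ζ (Complex.I * lapl 0 ζ) = 2 * lapl 1 ζ - lapl 3 ζ := fun ζ => by
    rw [hq, lapl_three]; ring
  have hh : ∀ ζ, (ζ ^ 2 - 1) * heatFun ζ (Complex.I * lapl 0 ζ) + 4 * (Complex.I * lapl 0 ζ) =
      Complex.I * (lapl 4 ζ - 4 * lapl 2 ζ + 6 * lapl 0 ζ) := fun ζ => by
    have e : (ζ ^ 2 - 1) * heatFun ζ (Complex.I * lapl 0 ζ) =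
        ζ * (2 * lapl 1 ζ - lapl 3 ζ) + Complex.I * lapl 2 ζ := by
      rw [← hf, hq]; ring
    rw [e, lapl_four]
    have e2 := lapl_two ζ
    linear_combination ζ * lapl 3 ζ * (-Complex.I_sq) + 2 * (Complex.I * e2)
      - 2 * ζ * lapl 1 ζ * (-Complex.I_sq)
  have ha' : Tendsto (fun ζ => Complex.I * lapl 0 ζ - x) l (𝓝 (-x)) := by
    simpa using (h0.const_mul Complex.I).sub_const x
  have hc' : Tendsto (fun ζ => -Complex.I * lapl 2 ζ / √6) l (𝓝 0) := by
    simpa using (h2.const_mul (-Complex.I)).div_const ((√6 : ℝ) : ℂ)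
  have hd' : Tendsto (fun ζ => -Complex.I * (lapl 2 ζ - lapl 0 ζ) - x) l (𝓝 (-x)) := by
    simpa using ((h2.sub h0).const_mul (-Complex.I)).sub_const x
  have hf' : Tendsto (fun ζ => (2 * lapl 1 ζ - lapl 3 ζ) / √6) l (𝓝 0) := by
    simpa using ((h1.const_mul 2).sub h3).div_const ((√6 : ℝ) : ℂ)
  have hh' : Tendsto (fun ζ => Complex.I * (lapl 4 ζ - 4 * lapl 2 ζ + 6 * lapl 0 ζ) / 6 - x) l
      (𝓝 (-x)) := by
    simpa using ((((h4.sub (h2.const_mul 4)).add (h0.const_mul 6)).const_mul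
      Complex.I).div_const 6).sub_const x
  have hdet : ∀ ζ, (shiftedMat x ζ (Complex.I * lapl 0 ζ)).det =
      (Complex.I * lapl 0 ζ - x) ^ 2 *
        blockDet (Complex.I * lapl 0 ζ - x) (lapl 1 ζ) (-Complex.I * lapl 2 ζ / √6)
          (-Complex.I * (lapl 2 ζ - lapl 0 ζ) - x) ((2 * lapl 1 ζ - lapl 3 ζ) / √6)
          (Complex.I * (lapl 4 ζ - 4 * lapl 2 ζ + 6 * lapl 0 ζ) / 6 - x) := fun ζ => by
    rw [det_shiftedMat, longDet, hh, hf, hd, hb, hq]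
  simp only [hdet, blockDet]
  have key := (ha'.pow 2).mul (((ha'.mul ((hd'.mul hh').sub (hf'.mul hf'))).sub
    (h1.mul ((h1.mul hh').sub (hf'.mul hc')))).add (hc'.mul ((h1.mul hf').sub (hd'.mul hc'))))
  refine key.congr' (Eventually.of_forall fun _ => rfl) |>.trans (le_of_eq ?_)
  congr 1
  ring

/-- With `lapl` in place of Z the determinant is entire, so accumulation at the real axis needs no
separate treatment. The nonzero limit bounds the zeros; infinitely many would accumulate, and the
identity theorem would make the determinant vanish identically, against the limit. -/
theorem finite_zeros_det_shiftedMat_lapl {x : ℂ} (hx : x ≠ 0) :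
    {ζ : ℂ | 0 ≤ ζ.im ∧ (shiftedMat x ζ (Complex.I * lapl 0 ζ)).det = 0}.Finite := by
  set Φ : ℂ → ℂ := fun ζ => (shiftedMat x ζ (Complex.I * lapl 0 ζ)).det with hΦ
  have hd : Differentiable ℂ Φ := by
    have := differentiable_lapl 0
    simp only [hΦ, det_shiftedMat, longDet, blockDet, heatFun]
    fun_prop
  have han : AnalyticOnNhd ℂ Φ univ := fun z _ => hd.analyticAt z
  have hx5 : -x ^ 5 ≠ 0 := neg_ne_zero.2 (pow_ne_zero 5 hx)
  have hev := (tendsto_det_shiftedMat_lapl x).eventually_ne hx5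
  rw [Filter.eventually_inf_principal] at hev
  obtain ⟨M, -, hM⟩ := (Metric.hasBasis_cobounded_compl_closedBall (0 : ℂ)).eventually_iff.1 hev
  have hsub : {ζ : ℂ | 0 ≤ ζ.im ∧ Φ ζ = 0} ⊆ Metric.closedBall 0 M := by
    rintro ζ ⟨h1, h2⟩
    by_contra hcon
    exact hM hcon h1 h2
  by_contra hinf
  obtain ⟨ξ, -, hacc⟩ := Set.Infinite.exists_accPt_of_subset_isCompact hinf
    (isCompact_closedBall (0 : ℂ) M) hsub
  have hfr : ∃ᶠ ζ in 𝓝[≠] ξ, Φ ζ = 0 := by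
    rw [accPt_iff_frequently_nhdsNE] at hacc
    exact hacc.mono fun ζ h => h.2
  have hzero := han.eqOn_zero_of_preconnected_of_frequently_eq_zero isPreconnected_univ
    (mem_univ ξ) hfr
  have hbig : Complex.I * ((|M| + 1 : ℝ) : ℂ) ∈ (Metric.closedBall (0 : ℂ) M)ᶜ := by
    simp only [mem_compl_iff, Metric.mem_closedBall, dist_zero_right, norm_mul, Complex.norm_I,
      Complex.norm_real, one_mul, not_le, Real.norm_eq_abs]
    calc M ≤ |M| := le_abs_self M
      _ < |M| + 1 := lt_add_one _
      _ ≤ |(|M| + 1)| := le_abs_self _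
  refine hM hbig ?_ (hzero (mem_univ _))
  show 0 ≤ (Complex.I * ((|M| + 1 : ℝ) : ℂ)).im
  simp
  positivity

theorem zetaOf_eq {κ τ : ℝ} (hτ : 0 < τ) (hκ : 0 < κ) (w : ℂ) :
    zOf τ w / (Complex.I * κ * τ) = zetaOf κ τ w := by
  have hτ' : (τ : ℂ) ≠ 0 := by exact_mod_cast hτ.ne'
  have hκ' : (κ : ℂ) ≠ 0 := by exact_mod_cast hκ.ne'
  have hI := Complex.I_ne_zero
  rw [zOf, zetaOf, div_eq_div_iff (by simp [*]) (by simp [*])]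
  linear_combination (-(τ * w + 1) * κ * τ) * Complex.I_sq

end Finiteness

/-! ### The spectral problem at a fixed wave vector -/

section Wavenumber

variable {k : V} {τ : ℝ} {Q : Matrix (Fin 3) (Fin 3) ℝ}

theorem I_mul_ne_zero (hτ : 0 < τ) (hk : 0 < ‖k‖) : Complex.I * τ * ‖k‖ ≠ 0 := by
  have hτ' : (τ : ℂ) ≠ 0 := by exact_mod_cast hτ.ne'
  have hκ' : (‖k‖ : ℂ) ≠ 0 := by exact_mod_cast hk.ne'
  simp [*]

theorem zetaOf_im_pos (hτ : 0 < τ) (hk : 0 < ‖k‖) {w : ℂ} (hw : (zOf τ w).re < 0) :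
    0 < (zetaOf ‖k‖ τ w).im := by
  rw [← zetaOf_eq hτ hk]
  exact zeta_im_pos hτ hk hw

theorem det_greenS_sub_one (hτ : 0 < τ) (hk : 0 < ‖k‖)
    (hQ : Q ∈ Matrix.orthogonalGroup (Fin 3) ℝ) (hQk : ∀ i, (Q *ᵥ ![‖k‖, 0, 0]) i = k i)
    {z : ℂ} (hz : z.re < 0) : (greenS k τ z - 1).det = 1 / (Complex.I * τ * ‖k‖) ^ 5 *
      (shiftedMat (Complex.I * τ * ‖k‖) (z / (Complex.I * ‖k‖ * τ))
        (Z (z / (Complex.I * ‖k‖ * τ)))).det := by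
  rw [← spectralFunction_eq_det hτ hk hQ hQk hz, spectralFunction, spectralFunctionZeta_eq]

theorem finite_hydroSpectrum (hτ : 0 < τ) (hk : 0 < ‖k‖)
    (hQ : Q ∈ Matrix.orthogonalGroup (Fin 3) ℝ) (hQk : ∀ i, (Q *ᵥ ![‖k‖, 0, 0]) i = k i) :
    (hydroSpectrum k τ).Finite := by
  have hx := I_mul_ne_zero hτ hk
  have hτ' : (τ : ℂ) ≠ 0 := by exact_mod_cast hτ.ne'
  have hκ' : (‖k‖ : ℂ) ≠ 0 := by exact_mod_cast hk.ne'
  refine Set.Finite.of_finite_image (f := zetaOf ‖k‖ τ)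
    ((finite_zeros_det_shiftedMat_lapl hx).subset ?_) ?_
  · rintro _ ⟨w, ⟨hw1, hw2⟩, rfl⟩
    have hz := (zOf_re hτ w).2 hw2
    have hζ := zetaOf_im_pos hτ hk hz
    rw [mem_opSpectrum_iff hτ hz, det_greenS_sub_one hτ hk hQ hQk hz, zetaOf_eq hτ hk,
      Z_eq_lapl hζ] at hw1
    exact ⟨hζ.le, (mul_eq_zero.1 hw1).resolve_left (one_div_ne_zero (pow_ne_zero 5 hx))⟩
  · intro w _ w' _ h
    simp only [zetaOf] at h
    have hI := Complex.I_ne_zero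
    field_simp at h
    simpa [hτ.ne'] using h

/-! ### Analyticity of Green's matrix -/

theorem isOpen_re_neg : IsOpen {z : ℂ | z.re < 0} :=
  isOpen_lt Complex.continuous_re continuous_const

theorem analyticAt_greenS (k : V) (τ : ℝ) {z : ℂ} (hz : z.re < 0) (n m : Fin 5) :
    AnalyticAt ℂ (fun z => greenS k τ z n m) z := by
  have : DifferentiableOn ℂ (fun z => greenS k τ z n m) {z : ℂ | z.re < 0} := fun u hu =>
    (hasDerivAt_greenS hu n m).differentiableAt.differentiableWithinAt
  exact this.analyticAt (isOpen_re_neg.mem_nhds hz)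

theorem analyticAt_det {n : ℕ} {M : ℂ → Matrix (Fin n) (Fin n) ℂ} {z : ℂ}
    (h : ∀ i j, AnalyticAt ℂ (fun z => M z i j) z) : AnalyticAt ℂ (fun z => (M z).det) z := by
  simp only [Matrix.det_apply']
  refine Finset.analyticAt_fun_sum _ fun σ _ => analyticAt_const.mul ?_
  exact Finset.analyticAt_fun_prod _ fun i _ => h _ _

theorem analyticAt_adjugate {n : ℕ} {M : ℂ → Matrix (Fin n) (Fin n) ℂ} {z : ℂ}
    (h : ∀ i j, AnalyticAt ℂ (fun z => M z i j) z) (i j : Fin n) :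
    AnalyticAt ℂ (fun z => (M z).adjugate i j) z := by
  simp only [Matrix.adjugate_apply]
  refine analyticAt_det fun a b => ?_
  by_cases ha : a = j
  · subst ha
    simp only [Matrix.updateRow_self]
    exact analyticAt_const
  · simp only [Matrix.updateRow_ne ha]
    exact h a b

theorem analyticAt_greenS_sub_one (k : V) (τ : ℝ) {z : ℂ} (hz : z.re < 0) (n m : Fin 5) :
    AnalyticAt ℂ (fun z => (greenS k τ z - 1) n m) z :=
  (analyticAt_greenS k τ hz n m).sub analyticAt_const

theorem analyticAt_spectralFunction (hτ : 0 < τ) (hk : 0 < ‖k‖)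
    (hQ : Q ∈ Matrix.orthogonalGroup (Fin 3) ℝ) (hQk : ∀ i, (Q *ᵥ ![‖k‖, 0, 0]) i = k i)
    {z : ℂ} (hz : z.re < 0) : AnalyticAt ℂ (spectralFunction ‖k‖ τ) z := by
  refine (analyticAt_det (analyticAt_greenS_sub_one k τ hz)).congr ?_
  filter_upwards [isOpen_re_neg.mem_nhds hz] with u hu
  exact (spectralFunction_eq_det hτ hk hQ hQk hu).symm

theorem inv_greenS_sub_one_apply (k : V) (τ : ℝ) (z : ℂ) (n m : Fin 5) :
    (greenS k τ z - 1)⁻¹ n m =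
      (greenS k τ z - 1).det⁻¹ * (greenS k τ z - 1).adjugate n m := by
  rw [Matrix.inv_def, Ring.inverse_eq_inv]
  rfl

/-! ### The compression of the Riesz projection -/

theorem continuousAt_bgkRes (k : V) (τ : ℝ) {z : ℂ} (hz : z.re < 0)
    (hdet : (greenS k τ z - 1).det ≠ 0) : ContinuousAt (bgkRes k τ) z := by
  have hf := continuousAt_freeRes k τ hz
  have hi : ∀ n m, ContinuousAt (fun z => (greenS k τ z - 1)⁻¹ n m) z := fun n m => by
    simp only [inv_greenS_sub_one_apply]
    exact ((analyticAt_det (analyticAt_greenS_sub_one k τ hz)).continuousAt.inv₀ hdet).mul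
      (analyticAt_adjugate (analyticAt_greenS_sub_one k τ hz) n m).continuousAt
  unfold bgkRes
  refine hf.clm_comp (ContinuousAt.sub (ContinuousAt.clm_comp ?_ hf) continuousAt_const)
  refine tendsto_finsetSum _ fun n _ => tendsto_finsetSum _ fun m _ => ?_
  exact (continuousAt_const.mul (hi n m)).smul continuousAt_const

variable {γ : ℝ → ℂ}

/-- A matrix coefficient is a bounded functional and commutes with the integral. In τ(δ + (G_S -
1)⁻¹) the constant has a primitive and drops out; the factor τ and the sign of the Riesz projection
are absorbed by dz = -τ dw. -/
theorem inner_rieszProjection (hτ : 0 < τ) (h : IsClosedContour γ)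
    (hre : ∀ t ∈ Icc (0 : ℝ) 1, (zOf τ (γ t)).re < 0)
    (hdet : ∀ t ∈ Icc (0 : ℝ) 1, (greenS k τ (zOf τ (γ t)) - 1).det ≠ 0) (n m : Fin 5) :
    inner ℂ (eL n) (rieszProjection (bgk k τ) γ (eL m)) =
      (2 * Real.pi * Complex.I)⁻¹ * contourIntegral (fun t => zOf τ (γ t))
        (fun z => (greenS k τ z - 1)⁻¹ n m) := by
  set L : (Hv →L[ℂ] Hv) →L[ℂ] ℂ :=
    (innerSL ℂ (eL n)) ∘L (ContinuousLinearMap.apply ℂ Hv (eL m)) with hL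
  have hLa : ∀ A : Hv →L[ℂ] Hv, L A = inner ℂ (eL n) (A (eL m)) := fun A => rfl
  have hz : ContinuousOn (fun t => zOf τ (γ t)) (Icc 0 1) := (h.zOf τ).continuousOn
  have hres : contourIntegral γ (opResolvent (bgk k τ)) =
      contourIntegral γ (fun w => bgkRes k τ (zOf τ w)) :=
    contourIntegral_congr fun t ht => opResolvent_eq (isResolventAt_bgkRes hτ (hre t ht) (hdet t ht))
  have hcont : ContinuousOn (fun t => bgkRes k τ (zOf τ (γ t))) (Icc 0 1) := fun t ht =>
    (continuousAt_bgkRes k τ (hre t ht) (hdet t ht)).comp_continuousWithinAt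
      (f := fun t => zOf τ (γ t)) (hz t ht)
  have hinv : ContinuousOn (fun t => (greenS k τ (zOf τ (γ t)) - 1)⁻¹ n m) (Icc 0 1) := by
    intro t ht
    have := ((analyticAt_det (analyticAt_greenS_sub_one k τ (hre t ht))).continuousAt.inv₀
      (hdet t ht)).mul (analyticAt_adjugate (analyticAt_greenS_sub_one k τ (hre t ht)) n m).continuousAt
    simp only [inv_greenS_sub_one_apply]
    exact this.comp_continuousWithinAt (f := fun t => zOf τ (γ t)) (hz t ht)
  have hcomm : L (contourIntegral γ (fun w => bgkRes k τ (zOf τ w))) =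
      contourIntegral γ (fun w => L (bgkRes k τ (zOf τ w))) := by
    refine (ContinuousLinearMap.intervalIntegral_comp_comm L
      (h.intervalIntegrable (f := fun w => bgkRes k τ (zOf τ w)) hcont)).symm.trans ?_
    simp only [contourIntegral, map_smul]
  have hsplit : contourIntegral γ (fun w => L (bgkRes k τ (zOf τ w))) =
      τ * contourIntegral γ (fun w => (greenS k τ (zOf τ w) - 1)⁻¹ n m) := by
    rw [contourIntegral_congr (g := fun w => (τ * (1 : Matrix (Fin 5) (Fin 5) ℂ) n m) +
      τ * (greenS k τ (zOf τ w) - 1)⁻¹ n m) fun t ht => by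
        rw [hLa, inner_bgkRes (hre t ht) (hdet t ht), mul_add]]
    have hconst : contourIntegral γ (fun _ => (τ : ℂ) * (1 : Matrix (Fin 5) (Fin 5) ℂ) n m) = 0 :=
      h.contourIntegral_eq_zero
        (g := fun z => z * ((τ : ℂ) * (1 : Matrix (Fin 5) (Fin 5) ℂ) n m))
        (fun t _ => by simpa using (hasDerivAt_id (γ t)).mul_const _) continuousOn_const
    have hadd := intervalIntegral.integral_add
      (h.intervalIntegrable (f := fun _ => (τ : ℂ) * (1 : Matrix (Fin 5) (Fin 5) ℂ) n m)
        continuousOn_const)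
      (h.intervalIntegrable (f := fun w => τ * (greenS k τ (zOf τ w) - 1)⁻¹ n m)
        (continuousOn_const.mul hinv))
    simp only [← smul_add] at hadd
    simp only [contourIntegral] at hadd hconst ⊢
    rw [hadd, hconst, zero_add, ← intervalIntegral.integral_const_mul]
    congr 1
    ext t
    simp only [smul_eq_mul]
    ring
  rw [rieszProjection, hres, ← hLa, map_neg, map_smul, hcomm, hsplit, contourIntegral_zOf,
    smul_eq_mul, smul_eq_mul]
  ring

/-- The vertical line belongs to the spectrum, so the contour cannot meet it, and winding around a
point on the right fixes its side. With empty Λ nothing would determine the side. -/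
theorem Encircles.zOf_re_neg (hτ : 0 < τ) (hk : 0 < ‖k‖)
    (h : Encircles γ (hydroSpectrum k τ) (opSpectrum (bgk k τ)))
    (hne : (hydroSpectrum k τ).Nonempty) : ∀ t ∈ Icc (0 : ℝ) 1, (zOf τ (γ t)).re < 0 := by
  obtain ⟨w, hw⟩ := hne
  intro t ht
  rw [zOf_re hτ]
  refine h.contour.re_lt_of_windingNumber (w := w) (fun t ht he => ?_) hw.2 ?_ t ht
  · exact h.avoids t ht (mem_opSpectrum_of_re_eq hk he)
  · rw [h.once w hw]
    exact one_ne_zero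

/-- The compressed Riesz projection is a sum of residues. -/
theorem Encircles.inner_rieszProjection (hτ : 0 < τ) (hk : 0 < ‖k‖)
    (hQ : Q ∈ Matrix.orthogonalGroup (Fin 3) ℝ) (hQk : ∀ i, (Q *ᵥ ![‖k‖, 0, 0]) i = k i)
    (h : Encircles γ (hydroSpectrum k τ) (opSpectrum (bgk k τ)))
    {S : Finset ℂ} (hS : (S : Set ℂ) = hydroSpectrum k τ) (hne : S.Nonempty)
    {n m : Fin 5} {ρ : ℂ → ℂ} (hρ : ∀ w ∈ S, HasPolarPart
      (fun z => (spectralFunction ‖k‖ τ z)⁻¹ * (greenS k τ z - 1).adjugate n m) (zOf τ w) (ρ w)) :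
    inner ℂ (eL n) (rieszProjection (bgk k τ) γ (eL m)) =
        (2 * Real.pi * Complex.I)⁻¹ * contourIntegral (fun t => zOf τ (γ t))
          (fun z => (greenS k τ z - 1)⁻¹ n m) ∧
      inner ℂ (eL n) (rieszProjection (bgk k τ) γ (eL m)) =
        (2 * Real.pi * Complex.I)⁻¹ * contourIntegral (fun t => zOf τ (γ t))
          (fun z => (spectralFunction ‖k‖ τ z)⁻¹ * (greenS k τ z - 1).adjugate n m) ∧
      inner ℂ (eL n) (rieszProjection (bgk k τ) γ (eL m)) = ∑ w ∈ S, ρ w := by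
  classical
  have hτ' : (τ : ℂ) ≠ 0 := by exact_mod_cast hτ.ne'
  have hmem : ∀ w, w ∈ S ↔ w ∈ hydroSpectrum k τ := fun w => by rw [← hS]; rfl
  have hre := h.zOf_re_neg hτ hk (hS ▸ hne)
  have hdet : ∀ t ∈ Icc (0 : ℝ) 1, (greenS k τ (zOf τ (γ t)) - 1).det ≠ 0 := fun t ht h0 =>
    h.avoids t ht ((mem_opSpectrum_iff hτ (hre t ht)).2 h0)
  have h1 := BGK.inner_rieszProjection hτ h.contour hre hdet n m
  have hcongr : contourIntegral (fun t => zOf τ (γ t)) (fun z => (greenS k τ z - 1)⁻¹ n m) =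
      contourIntegral (fun t => zOf τ (γ t))
        (fun z => (spectralFunction ‖k‖ τ z)⁻¹ * (greenS k τ z - 1).adjugate n m) :=
    contourIntegral_congr fun t ht => by
      rw [inv_greenS_sub_one_apply, spectralFunction_eq_det hτ hk hQ hQk (hre t ht)]
  refine ⟨h1, by rw [h1, hcongr], ?_⟩
  have hinj : Function.Injective (zOf τ) := fun a b hab => by
    simp only [zOf] at hab
    have : (τ : ℂ) * a = τ * b := by linear_combination -hab
    exact mul_left_cancel₀ hτ' this
  have hneg : ∀ w ∈ S, (zOf τ w).re < 0 := fun w hw => (zOf_re hτ w).2 ((hmem w).1 hw).2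
  -- The residue theorem is available in discs: one disc inside the half-plane contains both the
  -- contour and all shifted eigenvalues.
  obtain ⟨r, hr⟩ := exists_ball_of_isCompact
    (((isCompact_Icc (a := (0 : ℝ)) (b := 1)).image_of_continuousOn
      (h.contour.zOf τ).continuousOn).union (S.image (zOf τ)).finite_toSet.isCompact) (by
    rintro z (⟨t, ht, rfl⟩ | hz)
    · exact hre t ht
    · obtain ⟨w, hw, rfl⟩ := Finset.mem_image.1 (Finset.mem_coe.1 hz)
      exact hneg w hw)
  have hinv : ∀ z, zOf τ (-(z + 1) / τ) = z := fun z => by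
    simp only [zOf]
    field_simp
    ring
  have hres := (h.contour.zOf τ).contourIntegral_eq_sum
    (fun t ht => hr _ (Or.inl ⟨t, ht, rfl⟩)) (S.image (zOf τ))
    (fun t ht hm => by
      obtain ⟨w, hw, he⟩ := Finset.mem_image.1 hm
      rw [hinj he] at hw
      exact h.avoids t ht ((hmem _).1 hw).1)
    (fun z => ρ (-(z + 1) / τ))
    (f := fun z => (spectralFunction ‖k‖ τ z)⁻¹ * (greenS k τ z - 1).adjugate n m)
    (fun z hz hzS => by
      have hzre := re_lt_zero_of_mem_ball hz
      refine ((analyticAt_spectralFunction hτ hk hQ hQk hzre).inv ?_).mul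
        (analyticAt_adjugate (analyticAt_greenS_sub_one k τ hzre) n m)
      intro h0
      apply hzS
      refine Finset.mem_image.2 ⟨-(z + 1) / τ, (hmem _).2 ⟨?_, ?_⟩, hinv z⟩
      · rw [mem_opSpectrum_iff hτ (by rwa [hinv]), hinv,
          ← spectralFunction_eq_det hτ hk hQ hQk hzre, h0]
      · rw [← zOf_re hτ, hinv]
        exact hzre)
    (fun s hs _ => by
      obtain ⟨w, hw, rfl⟩ := Finset.mem_image.1 hs
      have : -(zOf τ w + 1) / τ = w := hinj (hinv _)
      rw [this]
      exact hρ w hw)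
    (fun s hs => hr _ (Or.inr hs))
  rw [h1, hcongr, hres, Finset.sum_image hinj.injOn, Finset.mul_sum]
  refine Finset.sum_congr rfl fun w hw => ?_
  have hwind : windingNumber (fun t => zOf τ (γ t)) (zOf τ w) = 1 := by
    rw [windingNumber_zOf hτ.ne', h.once w ((hmem w).1 hw)]
  have hw' : -(zOf τ w + 1) / τ = w := hinj (hinv _)
  rw [windingNumber] at hwind
  rw [hw', mul_left_comm, hwind, mul_one]

theorem HasResidueAt.unique {f : ℂ → ℂ} {s a b : ℂ} (ha : HasResidueAt f s a)
    (hb : HasResidueAt f s b) : a = b := by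
  obtain ⟨r, h1, h2⟩ := (ha.2.and hb.2).exists
  rw [← h1, h2]

theorem det_greenS_sub_one_eventually_ne (hτ : 0 < τ) (hk : 0 < ‖k‖)
    (hQ : Q ∈ Matrix.orthogonalGroup (Fin 3) ℝ) (hQk : ∀ i, (Q *ᵥ ![‖k‖, 0, 0]) i = k i)
    {w : ℂ} (hw : (zOf τ w).re < 0) :
    ∀ᶠ z in 𝓝[≠] zOf τ w, z.re < 0 ∧ spectralFunction ‖k‖ τ z ≠ 0 := by
  have hτ' : (τ : ℂ) ≠ 0 := by exact_mod_cast hτ.ne'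
  have hfin : (zOf τ '' hydroSpectrum k τ \ {zOf τ w}).Finite :=
    ((finite_hydroSpectrum hτ hk hQ hQk).image _).subset sdiff_subset
  have h1 : (zOf τ '' hydroSpectrum k τ \ {zOf τ w})ᶜ ∈ 𝓝 (zOf τ w) :=
    hfin.isClosed.isOpen_compl.mem_nhds (by simp)
  filter_upwards [mem_nhdsWithin_of_mem_nhds h1, self_mem_nhdsWithin,
    mem_nhdsWithin_of_mem_nhds (isOpen_re_neg.mem_nhds hw)] with z hz hne hzre
  refine ⟨hzre, fun h0 => hz ⟨⟨-(z + 1) / τ, ?_, ?_⟩, hne⟩⟩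
  · have hinv : zOf τ (-(z + 1) / τ) = z := by
      simp only [zOf]
      field_simp
      ring
    refine ⟨?_, ?_⟩
    · rw [mem_opSpectrum_iff hτ (by rwa [hinv]), hinv,
        ← spectralFunction_eq_det hτ hk hQ hQk hzre, h0]
    · rw [← zOf_re hτ, hinv]
      exact hzre
  · simp only [zOf]
    field_simp
    ring

theorem hasResidueAt_of_hasPolarPart (hτ : 0 < τ) (hk : 0 < ‖k‖)
    (hQ : Q ∈ Matrix.orthogonalGroup (Fin 3) ℝ) (hQk : ∀ i, (Q *ᵥ ![‖k‖, 0, 0]) i = k i)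
    {w ρ : ℂ} (hw : (zOf τ w).re < 0) {n m : Fin 5} (hρ : HasPolarPart
      (fun z => (spectralFunction ‖k‖ τ z)⁻¹ * (greenS k τ z - 1).adjugate n m) (zOf τ w) ρ) :
    HasResidueAt (fun z => (spectralFunction ‖k‖ τ z)⁻¹ * (greenS k τ z - 1).adjugate n m)
      (zOf τ w) ρ := by
  refine hρ.hasResidueAt ?_
  filter_upwards [det_greenS_sub_one_eventually_ne hτ hk hQ hQk hw] with z hz
  exact ((analyticAt_spectralFunction hτ hk hQ hQk hz.1).inv hz.2).mul
    (analyticAt_adjugate (analyticAt_greenS_sub_one k τ hz.1) n m)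

theorem exists_hasPolarPart (hτ : 0 < τ) (hk : 0 < ‖k‖)
    (hQ : Q ∈ Matrix.orthogonalGroup (Fin 3) ℝ) (hQk : ∀ i, (Q *ᵥ ![‖k‖, 0, 0]) i = k i)
    {w : ℂ} (hw : (zOf τ w).re < 0) (n m : Fin 5) : ∃ ρ, HasPolarPart
      (fun z => (spectralFunction ‖k‖ τ z)⁻¹ * (greenS k τ z - 1).adjugate n m) (zOf τ w) ρ :=
  ((analyticAt_spectralFunction hτ hk hQ hQk hw).meromorphicAt.inv.mul
    (analyticAt_adjugate (analyticAt_greenS_sub_one k τ hw) n m).meromorphicAt).exists_hasPolarPart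

end Wavenumber

/-! ### Simple eigenvalues -/

section Simple

variable {k : V} {τ : ℝ} {Q : Matrix (Fin 3) (Fin 3) ℝ} {w : ℂ}

theorem greenS_sub_one_mulVec (hτ : 0 < τ) (hk : 0 < ‖k‖)
    (hQ : Q ∈ Matrix.orthogonalGroup (Fin 3) ℝ) (hQk : ∀ i, (Q *ᵥ ![‖k‖, 0, 0]) i = k i)
    (hw : (zOf τ w).re < 0) (a : Fin 5 → ℂ) :
    (greenS k τ (zOf τ w) - 1) *ᵥ (tildeQ Q *ᵥ a) = (Complex.I * τ * ‖k‖)⁻¹ • (tildeQ Q *ᵥ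
      (shiftedMat (Complex.I * τ * ‖k‖) (zetaOf ‖k‖ τ w) (Z (zetaOf ‖k‖ τ w)) *ᵥ a)) := by
  rw [greenS_sub_one hτ hk hQ hQk hw, zetaOf_eq hτ hk, shiftedG_eq, Matrix.smul_mulVec,
    Matrix.mulVec_mulVec, Matrix.mul_assoc, tildeQ_transpose_mul_self hQ, Matrix.mul_one,
    Matrix.mulVec_mulVec]

theorem tildeQ_mulVec_injective (hQ : Q ∈ Matrix.orthogonalGroup (Fin 3) ℝ) :
    Function.Injective (tildeQ Q *ᵥ ·) := fun a b hab => by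
  have := congrArg ((tildeQ Q)ᵀ *ᵥ ·) hab
  simpa only [Matrix.mulVec_mulVec, tildeQ_transpose_mul_self hQ, Matrix.one_mulVec] using this

theorem mulVec_eq_zero_iff (hτ : 0 < τ) (hk : 0 < ‖k‖)
    (hQ : Q ∈ Matrix.orthogonalGroup (Fin 3) ℝ) (hQk : ∀ i, (Q *ᵥ ![‖k‖, 0, 0]) i = k i)
    (hw : (zOf τ w).re < 0) (a : Fin 5 → ℂ) :
    (greenS k τ (zOf τ w) - 1) *ᵥ (tildeQ Q *ᵥ a) = 0 ↔
      shiftedMat (Complex.I * τ * ‖k‖) (zetaOf ‖k‖ τ w) (Z (zetaOf ‖k‖ τ w)) *ᵥ a = 0 := by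
  rw [greenS_sub_one_mulVec hτ hk hQ hQk hw,
    smul_eq_zero_iff_right (inv_ne_zero (I_mul_ne_zero hτ hk))]
  constructor
  · intro h
    exact tildeQ_mulVec_injective hQ (by simpa using h)
  · intro h
    rw [h, Matrix.mulVec_zero]

theorem shiftedMat_self_mulVec_two (x ζ : ℂ) : shiftedMat x ζ x *ᵥ ![0, 0, 1, 0, 0] = 0 := by
  funext i
  fin_cases i <;> simp [shiftedMat, blockMat, Matrix.mulVec, dotProduct, Fin.sum_univ_five]

theorem shiftedMat_self_mulVec_three (x ζ : ℂ) : shiftedMat x ζ x *ᵥ ![0, 0, 0, 1, 0] = 0 := by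
  funext i
  fin_cases i <;> simp [shiftedMat, blockMat, Matrix.mulVec, dotProduct, Fin.sum_univ_five]

/-- If Z = x, the two transverse directions give linearly independent kernel vectors. -/
theorem IsSimpleEigenvalue.Z_ne (hs : IsSimpleEigenvalue (bgk k τ) w) (hτ : 0 < τ) (hk : 0 < ‖k‖)
    (hQ : Q ∈ Matrix.orthogonalGroup (Fin 3) ℝ) (hQk : ∀ i, (Q *ᵥ ![‖k‖, 0, 0]) i = k i)
    (hw : (zOf τ w).re < 0) : Z (zetaOf ‖k‖ τ w) ≠ Complex.I * τ * ‖k‖ := by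
  intro hZ
  have h2 : (greenS k τ (zOf τ w) - 1) *ᵥ (tildeQ Q *ᵥ ![0, 0, 1, 0, 0]) = 0 := by
    rw [mulVec_eq_zero_iff hτ hk hQ hQk hw, hZ]
    exact shiftedMat_self_mulVec_two _ _
  have h3 : (greenS k τ (zOf τ w) - 1) *ᵥ (tildeQ Q *ᵥ ![0, 0, 0, 1, 0]) = 0 := by
    rw [mulVec_eq_zero_iff hτ hk hQ hQk hw, hZ]
    exact shiftedMat_self_mulVec_three _ _
  have hne : tildeQ Q *ᵥ (![0, 0, 1, 0, 0] : Fin 5 → ℂ) ≠ 0 := fun h0 => by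
    have := tildeQ_mulVec_injective hQ (a₁ := ![0, 0, 1, 0, 0]) (a₂ := 0) (by simpa using h0)
    simpa using congrFun this 2
  obtain ⟨c, hc⟩ := hs.exists_smul hτ hw hne h2 h3
  rw [← Matrix.mulVec_smul] at hc
  have := congrFun (tildeQ_mulVec_injective hQ hc) 3
  simp at this

theorem one_add_mul_zetaOf (hτ : 0 < τ) (hk : 0 < ‖k‖) (w : ℂ) :
    1 + Complex.I * τ * ‖k‖ * zetaOf ‖k‖ τ w = -(τ * w) := by
  have hτ' : (τ : ℂ) ≠ 0 := by exact_mod_cast hτ.ne'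
  have hκ' : (‖k‖ : ℂ) ≠ 0 := by exact_mod_cast hk.ne'
  rw [zetaOf]
  field_simp
  linear_combination (τ * w + 1) * Complex.I_sq

/-- Since 1 + xζ = -τw, the exceptional case of `heatFun_ne_zero` reads w² = -‖k‖², a purely
imaginary eigenvalue, which dissipation rules out. -/
theorem heatFun_zetaOf_ne_zero (hτ : 0 < τ) (hk : 0 < ‖k‖) (hw : (zOf τ w).re < 0)
    (hsp : (greenS k τ (zOf τ w) - 1).det = 0)
    (hlong : longDet (Complex.I * τ * ‖k‖) (zetaOf ‖k‖ τ w) (Z (zetaOf ‖k‖ τ w)) = 0) :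
    heatFun (zetaOf ‖k‖ τ w) (Z (zetaOf ‖k‖ τ w)) ≠ 0 := by
  have hx : Complex.I * ((τ * ‖k‖ : ℝ) : ℂ) = Complex.I * τ * ‖k‖ := by push_cast; ring
  refine heatFun_ne_zero (y := τ * ‖k‖) (zetaOf_im_pos hτ hk hw) (by rw [hx]; exact hlong) ?_
  rw [hx, one_add_mul_zetaOf hτ hk]
  intro hsq
  have hτ' : (τ : ℂ) ≠ 0 := by exact_mod_cast hτ.ne'
  have hw2 : w ^ 2 = -(‖k‖ : ℂ) ^ 2 := by
    have : (τ : ℂ) ^ 2 * w ^ 2 = τ ^ 2 * -(‖k‖ : ℂ) ^ 2 := by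
      linear_combination -hsq + τ ^ 2 * (‖k‖ : ℂ) ^ 2 * Complex.I_sq
    exact mul_left_cancel₀ (pow_ne_zero 2 hτ') this
  have hre0 : w.re = 0 := by
    have h1 := congrArg Complex.re hw2
    have h2 := congrArg Complex.im hw2
    simp [pow_two] at h1 h2
    have h3 : w.re * w.im = 0 := by linarith
    rcases mul_eq_zero.1 h3 with h | h
    · exact h
    · rw [h] at h1
      nlinarith [mul_pos hk hk, mul_self_nonneg w.re]
  obtain ⟨α, hα, h0⟩ := Matrix.exists_mulVec_eq_zero_iff.2 hsp
  obtain ⟨hE, hm⟩ := inEigenspace_freeRes_embL (k := k) hτ hw h0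
  rw [eq_zero_of_inEigenspace hτ hk hre0 hE] at hm
  exact hα (hm ▸ (map_zero momentsL))

/-- Let p be a column of the adjugate that is nonzero at the eigenvalue, so that (G_S - 1)p is the
determinant times a basis vector. If the determinant vanished to second order, differentiation would
give (G_S - 1)p' + G_S' p = 0, a Jordan chain. -/
theorem IsSimpleEigenvalue.deriv_det_ne_zero (hs : IsSimpleEigenvalue (bgk k τ) w) (hτ : 0 < τ)
    (hw : (zOf τ w).re < 0) (hdet : (greenS k τ (zOf τ w) - 1).det = 0)
    (hadj : (greenS k τ (zOf τ w) - 1).adjugate ≠ 0) {D' : ℂ}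
    (hD : HasDerivAt (fun z => (greenS k τ z - 1).det) D' (zOf τ w)) : D' ≠ 0 := by
  rintro rfl
  set z₀ := zOf τ w with hz₀
  obtain ⟨i, j, hij⟩ : ∃ i j, (greenS k τ z₀ - 1).adjugate i j ≠ 0 := by
    by_contra! hcon
    exact hadj (Matrix.ext hcon)
  set p : Fin 5 → ℂ → ℂ := fun m z => (greenS k τ z - 1).adjugate m j with hp
  have hpd : ∀ m, HasDerivAt (p m) (deriv (p m) z₀) z₀ := fun m =>
    (analyticAt_adjugate (analyticAt_greenS_sub_one k τ hw) m j).differentiableAt.hasDerivAt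
  have hMp : ∀ n z, ∑ m, (greenS k τ z - 1) n m * p m z =
      (greenS k τ z - 1).det * (1 : Matrix (Fin 5) (Fin 5) ℂ) n j := fun n z => by
    have := congrFun (congrFun (Matrix.mul_adjugate (greenS k τ z - 1)) n) j
    rw [Matrix.mul_apply] at this
    simpa using this
  refine not_isSimpleEigenvalue_of_chain (k := k) (u₀ := fun m => p m z₀)
    (u₁ := fun m => deriv (p m) z₀) hτ hw (fun h => hij (congrFun h i)) ?_ ?_ hs
  · funext n
    have := hMp n z₀
    rw [hdet, zero_mul] at this
    exact this
  · funext n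
    have h1 : HasDerivAt (fun z => ∑ m, (greenS k τ z - 1) n m * p m z)
        (∑ m, (inner ℂ (eL n) (freeRes k τ z₀ (freeRes k τ z₀ (eL m))) * p m z₀ +
          (greenS k τ z₀ - 1) n m * deriv (p m) z₀)) z₀ :=
      HasDerivAt.fun_sum fun m _ =>
        ((hasDerivAt_greenS (k := k) hw n m).sub_const _).mul (hpd m)
    have h2 := hD.mul_const ((1 : Matrix (Fin 5) (Fin 5) ℂ) n j)
    simp only [hMp] at h1
    have h3 := h1.unique h2
    rw [zero_mul, Finset.sum_add_distrib] at h3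
    have h4 : moments (freeRes k τ z₀ (freeRes k τ z₀ (embL fun m => p m z₀))) n =
        ∑ m, inner ℂ (eL n) (freeRes k τ z₀ (freeRes k τ z₀ (eL m))) * p m z₀ := by
      rw [embL_apply, moments]
      simp only [map_sum, map_smul, inner_sum, inner_smul_right]
      exact Finset.sum_congr rfl fun m _ => mul_comm _ _
    rw [Pi.add_apply, h4, Pi.zero_apply, add_comm]
    exact h3

theorem meromorphicOrderAt_inv_of_simple_zero {D : ℂ → ℂ} {s D' : ℂ} (hD : AnalyticAt ℂ D s)
    (h0 : D s = 0) (h1 : HasDerivAt D D' s) (hD' : D' ≠ 0) :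
    meromorphicOrderAt (fun z => (D z)⁻¹) s = ((-1 : ℤ) : WithTop ℤ) := by
  have hs : dslope D s s ≠ 0 := by rwa [dslope_same, h1.deriv]
  refine (meromorphicOrderAt_eq_int_iff (f := fun z => (D z)⁻¹) hD.meromorphicAt.inv).2 ?_
  refine ⟨fun z => (dslope D s z)⁻¹, (analyticAt_dslope hD).inv hs, inv_ne_zero hs, ?_⟩
  filter_upwards with z
  have h2 := sub_smul_dslope D s z
  rw [smul_eq_mul, h0, sub_zero] at h2
  rw [← h2, mul_inv, zpow_neg_one, smul_eq_mul]

theorem greenS_symm (k : V) (τ : ℝ) (z : ℂ) (n m : Fin 5) :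
    greenS k τ z n m = greenS k τ z m n := by
  simp only [greenS, Matrix.of_apply, mul_right_comm]

theorem tildeQ_mulVec (Q : Matrix (Fin 3) (Fin 3) ℝ) (a b c : ℂ) :
    tildeQ Q *ᵥ ![a, b, 0, 0, c] =
      ![a, (Q 0 0 : ℂ) * b, (Q 1 0 : ℂ) * b, (Q 2 0 : ℂ) * b, c] := by
  funext i
  fin_cases i <;> simp [tildeQ, Matrix.mulVec, dotProduct, Fin.sum_univ_five]

theorem norm_mul_apply_zero (hQk : ∀ i, (Q *ᵥ ![‖k‖, 0, 0]) i = k i) (i : Fin 3) :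
    (Q i 0 : ℂ) * (‖k‖ : ℂ) = (k i : ℂ) := by
  have := hQk i
  simp [Matrix.mulVec, dotProduct, Fin.sum_univ_three] at this
  exact_mod_cast this

theorem spectralTemperature_eq (hτ : 0 < τ) (hk : 0 < ‖k‖)
    (hQ : Q ∈ Matrix.orthogonalGroup (Fin 3) ℝ) (hQk : ∀ i, (Q *ᵥ ![‖k‖, 0, 0]) i = k i)
    (hw : (zOf τ w).re < 0) : spectralTemperature k τ w =
      (greenS k τ (zOf τ w) 0 4 + Complex.I * w / (‖k‖ : ℂ) ^ 2 *
        ((k 0 : ℂ) * greenS k τ (zOf τ w) 1 4 + (k 1 : ℂ) * greenS k τ (zOf τ w) 2 4 +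
          (k 2 : ℂ) * greenS k τ (zOf τ w) 3 4)) / (1 - greenS k τ (zOf τ w) 4 4) := by
  have hκ' : (‖k‖ : ℂ) ≠ 0 := by exact_mod_cast hk.ne'
  have hden : ∀ v, den k τ w v = Complex.I * τ * (inner ℝ v k : ℝ) - zOf τ w := fun v => by
    rw [den, zOf]; ring
  have hI : ∀ n m, HasInt maxwellian (fun v => (Complex.I * τ * (inner ℝ v k : ℝ) - zOf τ w)⁻¹ *
      (e n v : ℂ) * (e m v : ℂ)) (greenS k τ (zOf τ w) n m) := fun n m =>
    ⟨(hasInt_greenS hτ hk hQ hQk hw n m).1, rfl⟩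
  have hnum := (((hI 0 4).const_mul ((‖k‖ : ℂ) ^ 2)).add ((((hI 1 4).const_mul (k 0 : ℂ)).add
    ((hI 2 4).const_mul (k 1 : ℂ))).add ((hI 3 4).const_mul (k 2 : ℂ)) |>.const_mul
      (Complex.I * w)))
  have hnum' := hnum.congr (g := fun v => ((‖k‖ : ℂ) ^ 2 + Complex.I * w * (inner ℝ v k : ℝ)) /
      den k τ w v * (e 4 v : ℂ)) (fun v => by
    have hin : ((inner ℝ v k : ℝ) : ℂ) = k 0 * v 0 + k 1 * v 1 + k 2 * v 2 := by
      rw [PiLp.inner_apply, Fin.sum_univ_three]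
      simp
    have e0 : (e 0 v : ℂ) = 1 := by simp [e]
    have e1 : (e 1 v : ℂ) = v 0 := by simp [e]
    have e2 : (e 2 v : ℂ) = v 1 := by simp [e]
    have e3 : (e 3 v : ℂ) = v 2 := by simp [e]
    rw [e0, e1, e2, e3, hden, div_eq_mul_inv]
    set d := (Complex.I * τ * (inner ℝ v k : ℝ) - zOf τ w)⁻¹
    rw [hin]
    ring) rfl
  have h44 := (hI 4 4).congr (g := fun v => (e 4 v : ℂ) / den k τ w v * (e 4 v : ℂ))
    (fun v => by rw [hden, div_eq_mul_inv]; ring) rfl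
  rw [spectralTemperature, hnum'.2, h44.2]
  congr 1
  field_simp

theorem greenS_four_four_ne_one (hτ : 0 < τ) (hk : 0 < ‖k‖)
    (hQ : Q ∈ Matrix.orthogonalGroup (Fin 3) ℝ) (hQk : ∀ i, (Q *ᵥ ![‖k‖, 0, 0]) i = k i)
    (hw : (zOf τ w).re < 0)
    (hlong : longDet (Complex.I * τ * ‖k‖) (zetaOf ‖k‖ τ w) (Z (zetaOf ‖k‖ τ w)) = 0)
    (hZ : Z (zetaOf ‖k‖ τ w) ≠ Complex.I * τ * ‖k‖)
    (hq : heatFun (zetaOf ‖k‖ τ w) (Z (zetaOf ‖k‖ τ w)) ≠ 0) :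
    1 - greenS k τ (zOf τ w) 4 4 ≠ 0 := by
  have hx : Complex.I * ((τ * ‖k‖ : ℝ) : ℂ) = Complex.I * τ * ‖k‖ := by push_cast; ring
  have h1 := thermal_ne_zero (y := τ * ‖k‖) (mul_pos hτ hk) (zetaOf_im_pos hτ hk hw)
    (by rw [hx]; exact hlong) (by rw [hx]; exact hZ) hq
  rw [hx] at h1
  have h2 := congrFun (greenS_sub_one_mulVec (Q := Q) hτ hk hQ hQk hw ![0, 0, 0, 0, 1]) 4
  have h3 : tildeQ Q *ᵥ ![0, 0, 0, 0, 1] = ![0, 0, 0, 0, 1] := by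
    rw [tildeQ_mulVec]; simp
  rw [h3] at h2
  have h4 : (greenS k τ (zOf τ w) - 1) 4 4 = (Complex.I * τ * ‖k‖)⁻¹ *
      (((zetaOf ‖k‖ τ w ^ 2 - 1) * heatFun (zetaOf ‖k‖ τ w) (Z (zetaOf ‖k‖ τ w)) +
        4 * Z (zetaOf ‖k‖ τ w)) / 6 - Complex.I * τ * ‖k‖) := by
    simpa [shiftedMat, blockMat, tildeQ, Matrix.mulVec, dotProduct, Fin.sum_univ_five] using h2
  have h5 := mul_ne_zero (inv_ne_zero (I_mul_ne_zero hτ hk)) h1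
  rw [← h4, Matrix.sub_apply, Matrix.one_apply_eq] at h5
  intro h
  exact h5 (by linear_combination -h)

/-- The left side is a kernel vector with first entry 1. Its velocity part is read off from a by 1 +
xζ = -τw, and the last row of the kernel equation, solvable because 1 - G_S(4,4) ≠ 0, forces the
fifth entry to be θ. -/
theorem inv_smul_tildeQ_aVec (hτ : 0 < τ) (hk : 0 < ‖k‖)
    (hQ : Q ∈ Matrix.orthogonalGroup (Fin 3) ℝ) (hQk : ∀ i, (Q *ᵥ ![‖k‖, 0, 0]) i = k i)
    (hw : (zOf τ w).re < 0)
    (hlong : longDet (Complex.I * τ * ‖k‖) (zetaOf ‖k‖ τ w) (Z (zetaOf ‖k‖ τ w)) = 0)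
    (hZ : Z (zetaOf ‖k‖ τ w) ≠ Complex.I * τ * ‖k‖)
    (hq : heatFun (zetaOf ‖k‖ τ w) (Z (zetaOf ‖k‖ τ w)) ≠ 0) :
    (aVec ‖k‖ τ (zetaOf ‖k‖ τ w) 0)⁻¹ • (tildeQ Q *ᵥ aVec ‖k‖ τ (zetaOf ‖k‖ τ w)) =
      alignedBasis k τ w := by
  have hx := I_mul_ne_zero hτ hk
  have hτ' : (τ : ℂ) ≠ 0 := by exact_mod_cast hτ.ne'
  have hκ' : (‖k‖ : ℂ) ≠ 0 := by exact_mod_cast hk.ne'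
  have h6 := ofReal_sqrt_six_ne_zero
  set ζ := zetaOf ‖k‖ τ w with hζ
  set x := Complex.I * (τ : ℂ) * (‖k‖ : ℂ) with hxdef
  set q := heatFun ζ (Z ζ) with hqdef
  have hker := shiftedMat_mulVec_kerVec x ζ (Z ζ) hlong hZ
  have hb0 : (x / (√6 : ℝ) * q) ≠ 0 := mul_ne_zero (div_ne_zero hx h6) hq
  have hb1 : (x / (√6 : ℝ) * q)⁻¹ * (1 / (√6 : ℝ) * (1 + x * ζ) * q) = Complex.I * w / ‖k‖ := by
    rw [one_add_mul_zetaOf hτ hk, hxdef]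
    have hI := Complex.I_ne_zero
    field_simp
    linear_combination -w * Complex.I_sq
  set η := (x / (√6 : ℝ) * q)⁻¹ • (tildeQ Q *ᵥ kerVec x ζ (Z ζ)) with hη
  have hMη : (greenS k τ (zOf τ w) - 1) *ᵥ η = 0 := by
    rw [hη, Matrix.mulVec_smul, (mulVec_eq_zero_iff hτ hk hQ hQk hw _).2 hker, smul_zero]
  have hη0 : η 0 = 1 := by
    rw [hη, kerVec, tildeQ_mulVec]
    exact inv_mul_cancel₀ hb0
  have hηi : ∀ i : Fin 3, (x / (√6 : ℝ) * q)⁻¹ * ((Q i 0 : ℂ) * (1 / (√6 : ℝ) * (1 + x * ζ) * q)) =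
      Complex.I * w / (‖k‖ : ℂ) ^ 2 * (k i : ℂ) := fun i => by
    rw [mul_left_comm, hb1, ← norm_mul_apply_zero hQk i]
    field_simp
  have hη1 : η 1 = Complex.I * w / (‖k‖ : ℂ) ^ 2 * (k 0 : ℂ) := by
    rw [hη, kerVec, tildeQ_mulVec]
    exact hηi 0
  have hη2 : η 2 = Complex.I * w / (‖k‖ : ℂ) ^ 2 * (k 1 : ℂ) := by
    rw [hη, kerVec, tildeQ_mulVec]
    exact hηi 1
  have hη3 : η 3 = Complex.I * w / (‖k‖ : ℂ) ^ 2 * (k 2 : ℂ) := by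
    rw [hη, kerVec, tildeQ_mulVec]
    exact hηi 2
  have hη4 : η 4 = spectralTemperature k τ w := by
    have hrow := congrFun hMη 4
    simp only [Matrix.mulVec, dotProduct, Fin.sum_univ_five, Matrix.sub_apply, Pi.zero_apply,
      hη0, hη1, hη2, hη3] at hrow
    rw [Matrix.one_apply_eq, Matrix.one_apply_ne (by decide), Matrix.one_apply_ne (by decide),
      Matrix.one_apply_ne (by decide), Matrix.one_apply_ne (by decide),
      greenS_symm k τ _ 4 0, greenS_symm k τ _ 4 1, greenS_symm k τ _ 4 2,
      greenS_symm k τ _ 4 3] at hrow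
    rw [spectralTemperature_eq hτ hk hQ hQk hw,
      eq_div_iff (greenS_four_four_ne_one hτ hk hQ hQk hw hlong hZ hq)]
    linear_combination -hrow
  have ha0 : aVec ‖k‖ τ ζ 0 = x / (√6 : ℝ) * q := by rw [aVec_eq_kerVec]; rfl
  rw [ha0, aVec_eq_kerVec, ← hη]
  funext i
  fin_cases i
  · exact hη0
  · exact hη1
  · exact hη2
  · exact hη3
  · exact hη4

theorem IsSimpleEigenvalue.description (hs : IsSimpleEigenvalue (bgk k τ) w) (hτ : 0 < τ)
    (hk : 0 < ‖k‖) (hQ : Q ∈ Matrix.orthogonalGroup (Fin 3) ℝ)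
    (hQk : ∀ i, (Q *ᵥ ![‖k‖, 0, 0]) i = k i)
    (hw : w ∈ hydroSpectrum k τ) {R : Matrix (Fin 5) (Fin 5) ℂ}
    (hR : ∀ n m, HasResidueAt
      (fun z => (spectralFunction ‖k‖ τ z)⁻¹ * (greenS k τ z - 1).adjugate n m)
      (zOf τ w) (R n m)) :
    meromorphicOrderAt (fun z => (spectralFunction ‖k‖ τ z)⁻¹) (zOf τ w)
        = ((-1 : ℤ) : WithTop ℤ) ∧
      (∃ g : ℂ, g ≠ 0 ∧ (shiftedG ‖k‖ τ (zetaOf ‖k‖ τ w)).adjugate =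
        g • Matrix.vecMulVec (aVec ‖k‖ τ (zetaOf ‖k‖ τ w)) (aVec ‖k‖ τ (zetaOf ‖k‖ τ w))) ∧
      (∃ c : ℂ, c ≠ 0 ∧ R = c • Matrix.vecMulVec (tildeQ Q *ᵥ aVec ‖k‖ τ (zetaOf ‖k‖ τ w))
        (tildeQ Q *ᵥ aVec ‖k‖ τ (zetaOf ‖k‖ τ w))) ∧
      aVec ‖k‖ τ (zetaOf ‖k‖ τ w) 0 ≠ 0 ∧
      (aVec ‖k‖ τ (zetaOf ‖k‖ τ w) 0)⁻¹ • (tildeQ Q *ᵥ aVec ‖k‖ τ (zetaOf ‖k‖ τ w)) =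
        alignedBasis k τ w ∧
      moments '' {f | InEigenspace (bgk k τ) w f} =
        (Submodule.span ℂ {alignedBasis k τ w} : Set (Fin 5 → ℂ)) := by
  have hx := I_mul_ne_zero hτ hk
  have hz := (zOf_re hτ w).2 hw.2
  have hdet := (mem_opSpectrum_iff hτ hz).1 hw.1
  have hZ := hs.Z_ne hτ hk hQ hQk hz
  have hlong : longDet (Complex.I * τ * ‖k‖) (zetaOf ‖k‖ τ w) (Z (zetaOf ‖k‖ τ w)) = 0 := by
    have h := hdet
    rw [det_greenS_sub_one hτ hk hQ hQk hz, zetaOf_eq hτ hk, det_shiftedMat] at h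
    simpa [hx, sub_ne_zero.2 hZ, hτ.ne', hk.ne'] using h
  have hq := heatFun_zetaOf_ne_zero hτ hk hz hdet hlong
  have ha0 : kerVec (Complex.I * τ * ‖k‖) (zetaOf ‖k‖ τ w) (Z (zetaOf ‖k‖ τ w)) 0 ≠ 0 :=
    mul_ne_zero (div_ne_zero hx ofReal_sqrt_six_ne_zero) hq
  obtain ⟨g, hg, hadj⟩ := adjugate_shiftedMat_eq_smul _ _ _ hZ hlong ha0
  rw [← shiftedG_eq, ← aVec_eq_kerVec] at hadj
  rw [← aVec_eq_kerVec] at ha0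
  set a := aVec ‖k‖ τ (zetaOf ‖k‖ τ w) with ha
  have hadjS : (greenS k τ (zOf τ w) - 1).adjugate = (1 / (Complex.I * τ * ‖k‖) ^ 4 * g) •
      Matrix.vecMulVec (tildeQ Q *ᵥ a) (tildeQ Q *ᵥ a) := by
    rw [adjugate_greenS_sub_one hτ hk hQ hQk hz, zetaOf_eq hτ hk, hadj, mul_smul,
      Matrix.mul_smul, Matrix.smul_mul, Matrix.mul_vecMulVec, Matrix.vecMulVec_mul,
      Matrix.vecMul_transpose]
  have hc0 : 1 / (Complex.I * τ * ‖k‖) ^ 4 * g ≠ 0 :=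
    mul_ne_zero (one_div_ne_zero (pow_ne_zero 4 hx)) hg
  have hQa0 : (tildeQ Q *ᵥ a) 0 = a 0 := by
    simp [tildeQ, Matrix.mulVec, dotProduct, Fin.sum_univ_five]
  have hadj0 : (greenS k τ (zOf τ w) - 1).adjugate ≠ 0 := fun h0 => by
    rw [hadjS] at h0
    have := congrFun (congrFun h0 0) 0
    simp only [Matrix.smul_apply, Matrix.vecMulVec_apply, hQa0, Matrix.zero_apply, smul_eq_mul,
      mul_eq_zero, ha0, or_false] at this
    exact hc0 (by simpa using this)
  have hDan := analyticAt_det (analyticAt_greenS_sub_one k τ hz)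
  have hD' := hs.deriv_det_ne_zero hτ hz hdet hadj0 hDan.differentiableAt.hasDerivAt
  set D' := deriv (fun z => (greenS k τ z - 1).det) (zOf τ w) with hD'def
  have hSpan := analyticAt_spectralFunction hτ hk hQ hQk hz
  have hSp0 : spectralFunction ‖k‖ τ (zOf τ w) = 0 := by
    rw [spectralFunction_eq_det hτ hk hQ hQk hz, hdet]
  have hSpd : HasDerivAt (spectralFunction ‖k‖ τ) D' (zOf τ w) := by
    refine hDan.differentiableAt.hasDerivAt.congr_of_eventuallyEq ?_
    filter_upwards [isOpen_re_neg.mem_nhds hz] with u hu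
    exact spectralFunction_eq_det hτ hk hQ hQk hu
  have hbasis := inv_smul_tildeQ_aVec hτ hk hQ hQk hz hlong hZ hq
  refine ⟨meromorphicOrderAt_inv_of_simple_zero hSpan hSp0 hSpd hD', ⟨g, hg, hadj⟩,
    ⟨D'⁻¹ * (1 / (Complex.I * τ * ‖k‖) ^ 4 * g), mul_ne_zero (inv_ne_zero hD') hc0, ?_⟩,
    ha0, hbasis, ?_⟩
  · ext n m
    have h1 := hasResidueAt_of_hasPolarPart hτ hk hQ hQk hz
      (hasPolarPart_inv_mul_of_simple_zero hSpan
        (analyticAt_adjugate (analyticAt_greenS_sub_one k τ hz) n m) hSp0 hSpd hD')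
    rw [(hR n m).unique h1, hadjS]
    simp only [Matrix.smul_apply, smul_eq_mul, mul_assoc]
  · rw [moments_image_eigenspace hτ hz]
    have hker : (greenS k τ (zOf τ w) - 1) *ᵥ alignedBasis k τ w = 0 := by
      rw [← hbasis, Matrix.mulVec_smul, (mulVec_eq_zero_iff hτ hk hQ hQk hz _).2, smul_zero]
      rw [aVec_eq_kerVec]
      exact shiftedMat_mulVec_kerVec _ _ _ hlong hZ
    have hne : alignedBasis k τ w ≠ 0 := fun h => by
      have := congrFun h 0
      simp [alignedBasis] at this
    ext α
    simp only [mem_ofPred_eq, SetLike.mem_coe, Submodule.mem_span_singleton]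
    constructor
    · intro h
      obtain ⟨c, hc⟩ := hs.exists_smul hτ hz hne hker h
      exact ⟨c, hc.symm⟩
    · rintro ⟨c, rfl⟩
      rw [Matrix.mulVec_smul, hker, smul_zero]

end Simple

/-! ### The shear eigenvalue -/

section Shear

theorem blockMat_mulVec_eq_zero {a b c d f h t : ℂ} (hD : blockDet a b c d f h ≠ 0)
    {β : Fin 5 → ℂ} (hβ : blockMat a b c d f h t *ᵥ β = 0) : β 0 = 0 ∧ β 1 = 0 ∧ β 4 = 0 := by
  have h0 := congrFun hβ 0
  have h1 := congrFun hβ 1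
  have h4 := congrFun hβ 4
  simp [blockMat, Matrix.mulVec, dotProduct, Fin.sum_univ_five] at h0 h1 h4
  refine ⟨(mul_eq_zero.1 ?_).resolve_left hD, (mul_eq_zero.1 ?_).resolve_left hD,
    (mul_eq_zero.1 ?_).resolve_left hD⟩
  · rw [blockDet]
    linear_combination (d * h - f * f) * h0 + (f * c - b * h) * h1 + (b * f - d * c) * h4
  · rw [blockDet]
    linear_combination (f * c - b * h) * h0 + (a * h - c * c) * h1 + (b * c - a * f) * h4
  · rw [blockDet]
    linear_combination (b * f - d * c) * h0 + (b * c - a * f) * h1 + (a * d - b * b) * h4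

/-- The adjugate of `shiftedMat x ζ W` divided by `W - x`. -/
def adjQuot (x ζ W : ℂ) : Matrix (Fin 5) (Fin 5) ℂ :=
  let a := W - x
  let b := 1 + ζ * W
  let c := heatFun ζ W / √6
  let d := ζ + ζ ^ 2 * W - x
  let f := ζ * heatFun ζ W / √6
  let h := ((ζ ^ 2 - 1) * heatFun ζ W + 4 * W) / 6 - x
  blockMat (a * (d * h - f * f)) (a * (f * c - b * h)) (a * (b * f - d * c))
    (a * (a * h - c * c)) (a * (b * c - a * f)) (a * (a * d - b * b)) (blockDet a b c d f h)

theorem smul_blockMat {R : Type*} [CommRing R] (r a b c d f h t : R) :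
    r • blockMat a b c d f h t =
      blockMat (r * a) (r * b) (r * c) (r * d) (r * f) (r * h) (r * t) := by
  ext i j
  fin_cases i <;> fin_cases j <;> simp [blockMat]

theorem adjugate_shiftedMat_eq_smul_adjQuot (x ζ W : ℂ) :
    (shiftedMat x ζ W).adjugate = (W - x) • adjQuot x ζ W := by
  simp only [shiftedMat, adjugate_blockMat, adjQuot, smul_blockMat]
  congr 1 <;> ring

theorem adjQuot_self (x ζ : ℂ) : adjQuot x ζ x =
    Matrix.diagonal ![0, 0, longDet x ζ x, longDet x ζ x, 0] := by
  simp only [adjQuot, longDet, sub_self, zero_mul]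
  ext i j
  fin_cases i <;> fin_cases j <;> simp [blockMat]

theorem analyticAt_blockMat {a b c d f h t : ℂ → ℂ} {z : ℂ} (ha : AnalyticAt ℂ a z)
    (hb : AnalyticAt ℂ b z) (hc : AnalyticAt ℂ c z) (hd : AnalyticAt ℂ d z)
    (hf : AnalyticAt ℂ f z) (hh : AnalyticAt ℂ h z) (ht : AnalyticAt ℂ t z) (n m : Fin 5) :
    AnalyticAt ℂ (fun z => blockMat (a z) (b z) (c z) (d z) (f z) (h z) (t z) n m) z := by
  have h0 : AnalyticAt ℂ (fun _ : ℂ => (0 : ℂ)) z := analyticAt_const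
  fin_cases n <;> fin_cases m <;> assumption

theorem analyticAt_Z {ζ : ℂ} (hζ : 0 < ζ.im) : AnalyticAt ℂ Z ζ := by
  have : DifferentiableOn ℂ Z {ζ : ℂ | 0 < ζ.im} := fun u hu =>
    (hasDerivAt_Z hu).differentiableAt.differentiableWithinAt
  exact this.analyticAt (isOpen_im_pos.mem_nhds hζ)

theorem analyticAt_adjQuot (x : ℂ) {ζ : ℂ} (hζ : 0 < ζ.im) (n m : Fin 5) :
    AnalyticAt ℂ (fun ζ => adjQuot x ζ (Z ζ) n m) ζ := by
  have hZ := analyticAt_Z hζ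
  have hh : AnalyticAt ℂ (fun ζ => heatFun ζ (Z ζ)) ζ := by
    unfold heatFun
    fun_prop
  simp only [adjQuot, blockDet, div_eq_mul_inv]
  apply analyticAt_blockMat <;> fun_prop

theorem analyticAt_longDet (x : ℂ) {ζ : ℂ} (hζ : 0 < ζ.im) :
    AnalyticAt ℂ (fun ζ => longDet x ζ (Z ζ)) ζ := by
  have hZ := analyticAt_Z hζ
  simp only [longDet, blockDet, heatFun, div_eq_mul_inv]
  fun_prop

variable {k : V} {τ : ℝ} {Q : Matrix (Fin 3) (Fin 3) ℝ}

theorem zetaOf_injective (hτ : 0 < τ) (hk : 0 < ‖k‖) : Function.Injective (zetaOf ‖k‖ τ) := by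
  have hτ' : (τ : ℂ) ≠ 0 := by exact_mod_cast hτ.ne'
  intro w w' h
  have h1 := one_add_mul_zetaOf (k := k) hτ hk w
  rw [h, one_add_mul_zetaOf (k := k) hτ hk w'] at h1
  exact mul_left_cancel₀ hτ' (by linear_combination h1)

/-- The shear eigenvalue: existence, uniqueness and non-degeneracy. -/
theorem exists_shear (hτ : 0 < τ) (hk : 0 < ‖k‖) (hcrit : ‖k‖ < √(Real.pi / 2) * (1 / τ)) :
    ∃ s : ℂ, -(1 / τ) < s.re ∧
      (∀ w : ℂ, -(1 / τ) < w.re →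
        (Z (zetaOf ‖k‖ τ w) = Complex.I * τ * ‖k‖ ↔ w = s)) ∧ s ≠ 0 ∧
      longDet (Complex.I * τ * ‖k‖) (zetaOf ‖k‖ τ s) (Complex.I * τ * ‖k‖) ≠ 0 := by
  have hτ' : (τ : ℂ) ≠ 0 := by exact_mod_cast hτ.ne'
  have hκ' : (‖k‖ : ℂ) ≠ 0 := by exact_mod_cast hk.ne'
  have hx : Complex.I * ((τ * ‖k‖ : ℝ) : ℂ) = Complex.I * τ * ‖k‖ := by push_cast; ring
  have hy : τ * ‖k‖ < √(Real.pi / 2) := by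
    rw [mul_one_div, lt_div_iff₀ hτ] at hcrit
    linarith
  obtain ⟨σ, hσ, hσy⟩ := exists_rlap_eq (mul_pos hτ hk) hy
  -- The eigenvalue parameter for which ζ = iσ.
  set s : ℝ := ‖k‖ * σ - 1 / τ with hs
  have hζ : zetaOf ‖k‖ τ s = Complex.I * σ := by
    rw [zetaOf, hs]
    push_cast
    field_simp
    ring
  have hsre : -(1 / τ) < (s : ℂ).re := by
    rw [Complex.ofReal_re, hs]
    linarith [mul_pos hk hσ]
  refine ⟨s, hsre, fun w hw => ⟨fun h => ?_, ?_⟩, ?_, ?_⟩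
  · rw [← hx] at h
    obtain ⟨h1, h2, h3⟩ := exists_I_mul_of_Z_eq (zetaOf_im_pos hτ hk ((zOf_re hτ w).2 hw)) h
    have h4 : (zetaOf ‖k‖ τ w).im = σ := (strictAnti_rlap 0).injective (h3.trans hσy.symm)
    apply zetaOf_injective hτ hk
    rw [h2, h4, hζ]
  · rintro rfl
    rw [hζ, Z_I_mul hσ, hσy, hx]
  · have h1 : τ * s = -rlap 1 σ := by
      rw [rlap_one, hσy, hs]
      field_simp
      ring
    have h2 := rlap_pos 1 σ
    intro h0
    have h3 : s = 0 := by exact_mod_cast h0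
    rw [h3] at h1
    linarith
  · have := longDet_shear_ne_zero hσ
    rwa [hσy, ← hζ, hx] at this

/-- At the shear mode τs is the derivative of Z, so A is that derivative times the longitudinal
determinant, and A ≠ 0 splits into two separate facts. -/
theorem shearCoeff_eq (hτ : 0 < τ) (hk : 0 < ‖k‖) (s : ℂ) :
    shearCoeff ‖k‖ τ s = τ * s *
      longDet (Complex.I * τ * ‖k‖) (zetaOf ‖k‖ τ s) (Complex.I * τ * ‖k‖) := by
  have hτ' : (τ : ℂ) ≠ 0 := by exact_mod_cast hτ.ne'
  have hκ' : (‖k‖ : ℂ) ≠ 0 := by exact_mod_cast hk.ne'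
  have h1 := one_add_mul_zetaOf (k := k) hτ hk s
  have h2 := longDet_self (Complex.I * τ * ‖k‖) (zetaOf ‖k‖ τ s) (τ * s)
    (by linear_combination h1)
  set D := longDet (Complex.I * τ * ‖k‖) (zetaOf ‖k‖ τ s) (Complex.I * τ * ‖k‖)
  have h3 : Complex.I * 6 * τ * ‖k‖ * D = (‖k‖ : ℂ) ^ 4 * τ ^ 4 + (s * τ) ^ 4 + (τ * s) ^ 3 +
      s * τ ^ 3 * (‖k‖ : ℂ) ^ 2 := by
    linear_combination h2 + (τ ^ 4 * (‖k‖ : ℂ) ^ 4 * (Complex.I ^ 2 - 1)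
      - τ ^ 3 * s * (‖k‖ : ℂ) ^ 2) * Complex.I_sq
  rw [shearCoeff, ← h3]
  field_simp
  linear_combination -s * D * Complex.I_sq

theorem hasDerivAt_Z_zetaOf (hτ : 0 < τ) (hk : 0 < ‖k‖) {s : ℂ} (hs : (zOf τ s).re < 0)
    (hZ : Z (zetaOf ‖k‖ τ s) = Complex.I * τ * ‖k‖) :
    HasDerivAt Z (τ * s) (zetaOf ‖k‖ τ s) := by
  refine (hasDerivAt_Z (zetaOf_im_pos hτ hk hs)).congr_deriv ?_
  have h1 := one_add_mul_zetaOf (k := k) hτ hk s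
  rw [hZ]
  linear_combination -h1

/-- The adjugate is (Z - x) `adjQuot` and the first factor vanishes here, so the product rule needs
only the value of `adjQuot`, which is diagonal. -/
theorem hasDerivAt_adjugate_shear (hτ : 0 < τ) (hk : 0 < ‖k‖) {s : ℂ} (hs : (zOf τ s).re < 0)
    (hZ : Z (zetaOf ‖k‖ τ s) = Complex.I * τ * ‖k‖) (n m : Fin 5) :
    HasDerivAt (fun ζ => (shiftedG ‖k‖ τ ζ).adjugate n m)
      (Matrix.diagonal ![0, 0, shearCoeff ‖k‖ τ s, shearCoeff ‖k‖ τ s, 0] n m)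
      (zetaOf ‖k‖ τ s) := by
  have hN := (analyticAt_adjQuot (Complex.I * τ * ‖k‖) (zetaOf_im_pos hτ hk hs) n m)
  have h1 := ((hasDerivAt_Z_zetaOf hτ hk hs hZ).sub_const (Complex.I * τ * ‖k‖)).mul
    hN.differentiableAt.hasDerivAt
  have h2 : (fun ζ => (shiftedG ‖k‖ τ ζ).adjugate n m) = fun ζ =>
      (Z ζ - Complex.I * τ * ‖k‖) * adjQuot (Complex.I * τ * ‖k‖) ζ (Z ζ) n m := by
    funext ζ
    rw [shiftedG_eq, adjugate_shiftedMat_eq_smul_adjQuot]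
    rfl
  rw [h2]
  refine h1.congr_deriv ?_
  rw [hZ, sub_self, zero_mul, add_zero, adjQuot_self, shearCoeff_eq hτ hk]
  simp only [Matrix.diagonal_apply]
  split_ifs with h
  · fin_cases n <;> simp
  · simp

theorem mul_diagonal_mulVec (Q : Matrix (Fin 3) (Fin 3) ℝ) (A : ℂ) (α : Fin 5 → ℂ) :
    (tildeQ Q * Matrix.diagonal ![0, 0, A, A, 0] * (tildeQ Q)ᵀ) *ᵥ α =
      (A * ((tildeQ Q)ᵀ *ᵥ α) 2) • shearBasis₁ Q + (A * ((tildeQ Q)ᵀ *ᵥ α) 3) • shearBasis₂ Q := by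
  rw [← Matrix.mulVec_mulVec, ← Matrix.mulVec_mulVec, shearBasis₁, shearBasis₂,
    ← Matrix.mulVec_smul, ← Matrix.mulVec_smul, ← Matrix.mulVec_add]
  congr 1
  funext i
  rw [Matrix.mulVec_diagonal]
  fin_cases i <;> simp

theorem range_shear (hQ : Q ∈ Matrix.orthogonalGroup (Fin 3) ℝ) {c A : ℂ} (hc : c ≠ 0)
    (hA : A ≠ 0) :
    LinearMap.range (c • (tildeQ Q * Matrix.diagonal ![0, 0, A, A, 0] * (tildeQ Q)ᵀ)).mulVecLin =
      Submodule.span ℂ {shearBasis₁ Q, shearBasis₂ Q} := by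
  ext v
  rw [LinearMap.mem_range, Submodule.mem_span_pair]
  constructor
  · rintro ⟨α, rfl⟩
    rw [Matrix.mulVecLin_apply, Matrix.smul_mulVec, mul_diagonal_mulVec, smul_add, smul_smul,
      smul_smul]
    exact ⟨_, _, rfl⟩
  · rintro ⟨a, b, rfl⟩
    refine ⟨tildeQ Q *ᵥ ![0, 0, (c * A)⁻¹ * a, (c * A)⁻¹ * b, 0], ?_⟩
    rw [Matrix.mulVecLin_apply, Matrix.smul_mulVec, mul_diagonal_mulVec, smul_add, smul_smul,
      smul_smul, Matrix.mulVec_mulVec, tildeQ_transpose_mul_self hQ, Matrix.one_mulVec]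
    congr 2
    · simp
      field_simp
    · simp
      field_simp

theorem moments_shear (hτ : 0 < τ) (hk : 0 < ‖k‖)
    (hQ : Q ∈ Matrix.orthogonalGroup (Fin 3) ℝ) (hQk : ∀ i, (Q *ᵥ ![‖k‖, 0, 0]) i = k i)
    {s : ℂ} (hs : (zOf τ s).re < 0) (hZ : Z (zetaOf ‖k‖ τ s) = Complex.I * τ * ‖k‖)
    (hD : longDet (Complex.I * τ * ‖k‖) (zetaOf ‖k‖ τ s) (Complex.I * τ * ‖k‖) ≠ 0) :
    moments '' {f | InEigenspace (bgk k τ) s f} =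
      (Submodule.span ℂ {shearBasis₁ Q, shearBasis₂ Q} : Set (Fin 5 → ℂ)) := by
  rw [moments_image_eigenspace hτ hs]
  ext α
  rw [SetLike.mem_coe, Submodule.mem_span_pair, mem_ofPred_eq]
  have hα : α = tildeQ Q *ᵥ ((tildeQ Q)ᵀ *ᵥ α) := by
    rw [Matrix.mulVec_mulVec, tildeQ_mul_transpose_self hQ, Matrix.one_mulVec]
  constructor
  · intro h
    rw [hα, mulVec_eq_zero_iff hτ hk hQ hQk hs, hZ] at h
    obtain ⟨h0, h1, h4⟩ := blockMat_mulVec_eq_zero hD h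
    set β := (tildeQ Q)ᵀ *ᵥ α
    refine ⟨β 2, β 3, ?_⟩
    rw [hα, shearBasis₁, shearBasis₂, ← Matrix.mulVec_smul, ← Matrix.mulVec_smul,
      ← Matrix.mulVec_add]
    congr 1
    funext i
    fin_cases i <;> simp [h0, h1, h4]
  · rintro ⟨a, b, rfl⟩
    rw [Matrix.mulVec_add, Matrix.mulVec_smul, Matrix.mulVec_smul, shearBasis₁, shearBasis₂,
      (mulVec_eq_zero_iff hτ hk hQ hQk hs _).2, (mulVec_eq_zero_iff hτ hk hQ hQk hs _).2,
      smul_zero, smul_zero, add_zero]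
    · rw [hZ]
      exact shiftedMat_self_mulVec_three _ _
    · rw [hZ]
      exact shiftedMat_self_mulVec_two _ _

theorem hasDerivAt_Z_comp (hτ : 0 < τ) (hk : 0 < ‖k‖) {s : ℂ} (hs : (zOf τ s).re < 0)
    (hZ : Z (zetaOf ‖k‖ τ s) = Complex.I * τ * ‖k‖) :
    HasDerivAt (fun z => Z (z / (Complex.I * ‖k‖ * τ)) - Complex.I * τ * ‖k‖)
      (τ * s / (Complex.I * τ * ‖k‖)) (zOf τ s) := by
  have h1 := hasDerivAt_Z_zetaOf hτ hk hs hZ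
  rw [← zetaOf_eq hτ hk] at h1
  have h2 := (HasDerivAt.comp (h := fun z : ℂ => z / (Complex.I * ‖k‖ * τ)) (zOf τ s) h1
    ((hasDerivAt_id _).div_const (Complex.I * ‖k‖ * τ))).sub_const (Complex.I * τ * ‖k‖)
  refine h2.congr_deriv ?_
  rw [mul_one_div, mul_right_comm]

theorem analyticAt_comp_zeta (hτ : 0 < τ) (hk : 0 < ‖k‖) {s : ℂ}
    {F : ℂ → ℂ} (hF : AnalyticAt ℂ F (zetaOf ‖k‖ τ s)) :
    AnalyticAt ℂ (fun z => F (z / (Complex.I * ‖k‖ * τ))) (zOf τ s) := by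
  rw [← zetaOf_eq hτ hk] at hF
  have h : AnalyticAt ℂ (fun z : ℂ => z / (Complex.I * ‖k‖ * τ)) (zOf τ s) := by
    simp only [div_eq_mul_inv]
    fun_prop
  exact AnalyticAt.comp (f := fun z : ℂ => z / (Complex.I * ‖k‖ * τ)) hF h

/-- The spectral function is x⁻⁵(Z - x)² times the longitudinal determinant; Z - x has a simple zero
as its derivative τs is nonzero, and the last factor does not vanish. -/
theorem meromorphicOrderAt_shear (hτ : 0 < τ) (hk : 0 < ‖k‖)
    (hQ : Q ∈ Matrix.orthogonalGroup (Fin 3) ℝ) (hQk : ∀ i, (Q *ᵥ ![‖k‖, 0, 0]) i = k i)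
    {s : ℂ} (hs : (zOf τ s).re < 0) (hs0 : s ≠ 0)
    (hZ : Z (zetaOf ‖k‖ τ s) = Complex.I * τ * ‖k‖)
    (hD : longDet (Complex.I * τ * ‖k‖) (zetaOf ‖k‖ τ s) (Complex.I * τ * ‖k‖) ≠ 0) :
    meromorphicOrderAt (fun z => (spectralFunction ‖k‖ τ z)⁻¹) (zOf τ s)
      = ((-2 : ℤ) : WithTop ℤ) := by
  have hx := I_mul_ne_zero hτ hk
  have hτ' : (τ : ℂ) ≠ 0 := by exact_mod_cast hτ.ne'
  have hζ := zetaOf_im_pos hτ hk hs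
  set x := Complex.I * (τ : ℂ) * (‖k‖ : ℂ) with hxdef
  set z₀ := zOf τ s with hz₀
  set u : ℂ → ℂ := fun z => Z (z / (Complex.I * ‖k‖ * τ)) - x with hu
  set L : ℂ → ℂ := fun z => longDet x (z / (Complex.I * ‖k‖ * τ)) (Z (z / (Complex.I * ‖k‖ * τ)))
    with hL
  have huan : AnalyticAt ℂ u z₀ :=
    (analyticAt_comp_zeta hτ hk (analyticAt_Z hζ)).sub analyticAt_const
  have hLan : AnalyticAt ℂ L z₀ := analyticAt_comp_zeta hτ hk (analyticAt_longDet x hζ)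
  have hu0 : u z₀ = 0 := by
    rw [hu]
    simp only [hz₀, zetaOf_eq hτ hk, hZ, sub_self]
  have hL0 : L z₀ ≠ 0 := by
    rw [hL]
    simpa only [hz₀, zetaOf_eq hτ hk, hZ] using hD
  have hds : dslope u z₀ z₀ ≠ 0 := by
    rw [dslope_same, (hasDerivAt_Z_comp hτ hk hs hZ).deriv]
    exact div_ne_zero (mul_ne_zero hτ' hs0) hx
  have hmer : MeromorphicAt (fun z => (spectralFunction ‖k‖ τ z)⁻¹) z₀ :=
    (analyticAt_spectralFunction hτ hk hQ hQk hs).meromorphicAt.inv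
  refine (meromorphicOrderAt_eq_int_iff hmer).2
    ⟨fun z => x ^ 5 * ((dslope u z₀ z) ^ 2 * L z)⁻¹, ?_, ?_, ?_⟩
  · exact analyticAt_const.mul ((((analyticAt_dslope huan).pow 2).mul hLan).inv
      (mul_ne_zero (pow_ne_zero 2 hds) hL0))
  · exact mul_ne_zero (pow_ne_zero 5 hx) (inv_ne_zero (mul_ne_zero (pow_ne_zero 2 hds) hL0))
  · filter_upwards with z
    have h1 := sub_smul_dslope u z₀ z
    rw [smul_eq_mul, hu0, sub_zero] at h1
    have h2 : spectralFunction ‖k‖ τ z = 1 / x ^ 5 * (u z ^ 2 * L z) := by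
      rw [spectralFunction, spectralFunctionZeta_eq, det_shiftedMat]
    rw [h2, ← h1]
    simp only [mul_inv, mul_pow, smul_eq_mul, one_div, inv_inv, zpow_neg]
    norm_cast
    ring

/-- One of the two factors Z - x cancels against the adjugate. What remains is x (Z - x)⁻¹
`longDet`⁻¹ Q̃ `adjQuot` Q̃ᵀ, with a simple pole. -/
theorem residue_shear (hτ : 0 < τ) (hk : 0 < ‖k‖)
    (hQ : Q ∈ Matrix.orthogonalGroup (Fin 3) ℝ) (hQk : ∀ i, (Q *ᵥ ![‖k‖, 0, 0]) i = k i)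
    {s : ℂ} (hs : (zOf τ s).re < 0) (hs0 : s ≠ 0)
    (hZ : Z (zetaOf ‖k‖ τ s) = Complex.I * τ * ‖k‖)
    (hD : longDet (Complex.I * τ * ‖k‖) (zetaOf ‖k‖ τ s) (Complex.I * τ * ‖k‖) ≠ 0)
    {R : Matrix (Fin 5) (Fin 5) ℂ} (hR : ∀ n m, HasResidueAt
      (fun z => (spectralFunction ‖k‖ τ z)⁻¹ * (greenS k τ z - 1).adjugate n m)
      (zOf τ s) (R n m)) :
    ∃ c : ℂ, c ≠ 0 ∧ R = c • (tildeQ Q *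
      Matrix.diagonal ![0, 0, shearCoeff ‖k‖ τ s, shearCoeff ‖k‖ τ s, 0] * (tildeQ Q)ᵀ) := by
  have hx := I_mul_ne_zero hτ hk
  have hτ' : (τ : ℂ) ≠ 0 := by exact_mod_cast hτ.ne'
  have hζ := zetaOf_im_pos hτ hk hs
  have hA := shearCoeff_eq hτ hk s
  set x := Complex.I * (τ : ℂ) * (‖k‖ : ℂ) with hxdef
  set z₀ := zOf τ s with hz₀
  set u : ℂ → ℂ := fun z => Z (z / (Complex.I * ‖k‖ * τ)) - x with hu
  set L : ℂ → ℂ := fun z => longDet x (z / (Complex.I * ‖k‖ * τ)) (Z (z / (Complex.I * ‖k‖ * τ)))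
    with hL
  set N : ℂ → Matrix (Fin 5) (Fin 5) ℂ := fun z =>
    adjQuot x (z / (Complex.I * ‖k‖ * τ)) (Z (z / (Complex.I * ‖k‖ * τ))) with hN
  have huan : AnalyticAt ℂ u z₀ :=
    (analyticAt_comp_zeta hτ hk (analyticAt_Z hζ)).sub analyticAt_const
  have hLan : AnalyticAt ℂ L z₀ := analyticAt_comp_zeta hτ hk (analyticAt_longDet x hζ)
  have hNan : ∀ n m, AnalyticAt ℂ (fun z => N z n m) z₀ := fun n m =>
    analyticAt_comp_zeta hτ hk (analyticAt_adjQuot x hζ n m)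
  have hQNan : ∀ n m, AnalyticAt ℂ (fun z => (tildeQ Q * N z * (tildeQ Q)ᵀ) n m) z₀ := by
    intro n m
    simp only [Matrix.mul_apply]
    exact Finset.analyticAt_fun_sum _ fun j _ => (Finset.analyticAt_fun_sum _ fun i _ =>
      analyticAt_const.mul (hNan i j)).mul analyticAt_const
  have hu0 : u z₀ = 0 := by
    rw [hu]
    simp only [hz₀, zetaOf_eq hτ hk, hZ, sub_self]
  have hL0 : L z₀ = longDet x (zetaOf ‖k‖ τ s) x := by
    rw [hL]
    simp only [hz₀, zetaOf_eq hτ hk, hZ]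
  set D := longDet x (zetaOf ‖k‖ τ s) x with hDdef
  have hN0 : N z₀ = Matrix.diagonal ![0, 0, D, D, 0] := by
    rw [hN]
    simp only [hz₀, zetaOf_eq hτ hk, hZ]
    exact adjQuot_self _ _
  have hdiag : Matrix.diagonal ![0, 0, shearCoeff ‖k‖ τ s, shearCoeff ‖k‖ τ s, 0] =
      (τ * s) • Matrix.diagonal ![0, 0, D, D, 0] := by
    rw [hA, ← Matrix.diagonal_smul]
    congr 1
    funext i
    fin_cases i <;> simp
  have hts : (τ : ℂ) * s ≠ 0 := mul_ne_zero hτ' hs0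
  -- The residue is x (τs/x)⁻¹ D⁻¹ times the conjugated diag(0,0,D,D,0), and A = τsD accounts for
  -- the second factor τs.
  refine ⟨x ^ 2 / ((τ * s) ^ 2 * D), div_ne_zero (pow_ne_zero 2 hx)
    (mul_ne_zero (pow_ne_zero 2 hts) hD), ?_⟩
  ext n m
  have hpol := hasPolarPart_inv_mul_of_simple_zero huan
    ((analyticAt_const (v := x)).mul ((hLan.inv (by rwa [hL0])).mul (hQNan n m))) hu0
    (hasDerivAt_Z_comp hτ hk hs hZ) (div_ne_zero hts hx)
  have hpol' := hpol.congr (f' := fun z => (spectralFunction ‖k‖ τ z)⁻¹ *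
      (greenS k τ z - 1).adjugate n m) (by
    filter_upwards [mem_nhdsWithin_of_mem_nhds (isOpen_re_neg.mem_nhds hs)] with z hz
    have h2 : spectralFunction ‖k‖ τ z = 1 / x ^ 5 * (u z ^ 2 * L z) := by
      rw [spectralFunction, spectralFunctionZeta_eq, det_shiftedMat]
    have h3 : (greenS k τ z - 1).adjugate n m =
        1 / x ^ 4 * (u z * (tildeQ Q * N z * (tildeQ Q)ᵀ) n m) := by
      rw [adjugate_greenS_sub_one hτ hk hQ hQk hz, shiftedG_eq,
        adjugate_shiftedMat_eq_smul_adjQuot, Matrix.mul_smul, Matrix.smul_mul]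
      rfl
    rw [h2, h3]
    simp only [Pi.mul_apply, Pi.inv_apply]
    -- Zeros of u and L need not be excluded: with 0⁻¹ = 0 both sides vanish there.
    rcases eq_or_ne (u z) 0 with h0 | h0
    · simp [h0]
    · rcases eq_or_ne (L z) 0 with h1 | h1
      · simp [h1]
      · field_simp)
  rw [(hR n m).unique (hasResidueAt_of_hasPolarPart hτ hk hQ hQk hs hpol'), hdiag]
  simp only [Pi.mul_apply, Pi.inv_apply, hL0, hN0, Matrix.mul_smul, Matrix.smul_mul,
    Matrix.smul_apply, smul_eq_mul]
  field_simp
  rw [hxdef]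
  ring

end Shear

end BGK

end

theorem mainTheorem4 (τ : ℝ) (hτ : 0 < τ) (k : BGK.V) (hk : 0 < ‖k‖)
    (hcrit : ‖k‖ < √(Real.pi / 2) * (1 / τ))
    (Q : Matrix (Fin 3) (Fin 3) ℝ) (hQ : Q ∈ Matrix.orthogonalGroup (Fin 3) ℝ)
    (hQk : ∀ i, (Q *ᵥ ![‖k‖, 0, 0]) i = k i) :
    -- the spectral function is the determinant, and the adjugate is conjugated by the rotation
    (∀ z : ℂ, z.re < 0 →
      BGK.spectralFunction ‖k‖ τ z = (BGK.greenS k τ z - 1).det ∧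
      (BGK.greenS k τ z - 1).adjugate =
        (1 / (Complex.I * τ * ‖k‖) ^ 4) • (BGK.tildeQ Q *
          (BGK.shiftedG ‖k‖ τ (z / (Complex.I * ‖k‖ * τ))).adjugate * (BGK.tildeQ Q)ᵀ)) ∧
    ∃ (S : Finset ℂ) (R : ℂ → Matrix (Fin 5) (Fin 5) ℂ),
      -- `S` is the hydrodynamic spectrum
      (S : Set ℂ) = BGK.hydroSpectrum k τ ∧
      -- `R w` is the residue of `Σ⁻¹ adj(G_S - Id)` at the shifted eigenvalue
      (∀ w ∈ S, ∀ n m, BGK.HasResidueAt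
        (fun z => (BGK.spectralFunction ‖k‖ τ z)⁻¹ * (BGK.greenS k τ z - 1).adjugate n m)
        (BGK.zOf τ w) (R w n m)) ∧
      -- the compression of the Riesz projection is the sum of the residues
      (∀ γ : ℝ → ℂ,
        BGK.Encircles γ (BGK.hydroSpectrum k τ) (BGK.opSpectrum (BGK.bgk k τ)) → ∀ n m,
          inner ℂ (BGK.eL n) (BGK.rieszProjection (BGK.bgk k τ) γ (BGK.eL m)) =
            (2 * Real.pi * Complex.I)⁻¹ * BGK.contourIntegral (fun t => BGK.zOf τ (γ t))
              (fun z => (BGK.greenS k τ z - 1)⁻¹ n m) ∧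
          inner ℂ (BGK.eL n) (BGK.rieszProjection (BGK.bgk k τ) γ (BGK.eL m)) =
            (2 * Real.pi * Complex.I)⁻¹ * BGK.contourIntegral (fun t => BGK.zOf τ (γ t))
              (fun z => (BGK.spectralFunction ‖k‖ τ z)⁻¹ *
                (BGK.greenS k τ z - 1).adjugate n m) ∧
          inner ℂ (BGK.eL n) (BGK.rieszProjection (BGK.bgk k τ) γ (BGK.eL m)) =
            ∑ w ∈ S, R w n m) ∧
      -- simple eigenvalues
      (∀ w ∈ S, BGK.IsSimpleEigenvalue (BGK.bgk k τ) w →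
        meromorphicOrderAt (fun z => (BGK.spectralFunction ‖k‖ τ z)⁻¹) (BGK.zOf τ w)
          = ((-1 : ℤ) : WithTop ℤ) ∧
        (∃ g : ℂ, g ≠ 0 ∧ (BGK.shiftedG ‖k‖ τ (BGK.zetaOf ‖k‖ τ w)).adjugate =
          g • Matrix.vecMulVec (BGK.aVec ‖k‖ τ (BGK.zetaOf ‖k‖ τ w))
            (BGK.aVec ‖k‖ τ (BGK.zetaOf ‖k‖ τ w))) ∧
        (∃ c : ℂ, c ≠ 0 ∧ R w =
          c • Matrix.vecMulVec (BGK.tildeQ Q *ᵥ BGK.aVec ‖k‖ τ (BGK.zetaOf ‖k‖ τ w))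
            (BGK.tildeQ Q *ᵥ BGK.aVec ‖k‖ τ (BGK.zetaOf ‖k‖ τ w))) ∧
        -- division of `a` by its first entry gives the basis vector of the direct computation
        BGK.aVec ‖k‖ τ (BGK.zetaOf ‖k‖ τ w) 0 ≠ 0 ∧
        (BGK.aVec ‖k‖ τ (BGK.zetaOf ‖k‖ τ w) 0)⁻¹ •
            (BGK.tildeQ Q *ᵥ BGK.aVec ‖k‖ τ (BGK.zetaOf ‖k‖ τ w)) = BGK.alignedBasis k τ w ∧
        BGK.moments '' {f | BGK.InEigenspace (BGK.bgk k τ) w f} =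
          (Submodule.span ℂ {BGK.alignedBasis k τ w} : Set (Fin 5 → ℂ))) ∧
      -- the double shear eigenvalue
      ∃ s ∈ S, (∀ w : ℂ, -(1 / τ) < w.re →
          (BGK.Z (BGK.zetaOf ‖k‖ τ w) = Complex.I * τ * ‖k‖ ↔ w = s)) ∧
        meromorphicOrderAt (fun z => (BGK.spectralFunction ‖k‖ τ z)⁻¹) (BGK.zOf τ s)
          = ((-2 : ℤ) : WithTop ℤ) ∧
        BGK.shearCoeff ‖k‖ τ s ≠ 0 ∧
        (∀ n m, HasDerivAt (fun ζ => (BGK.shiftedG ‖k‖ τ ζ).adjugate n m)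
          (Matrix.diagonal ![0, 0, BGK.shearCoeff ‖k‖ τ s, BGK.shearCoeff ‖k‖ τ s, 0] n m)
          (BGK.zetaOf ‖k‖ τ s)) ∧
        (∃ c : ℂ, c ≠ 0 ∧ R s = c • (BGK.tildeQ Q *
          Matrix.diagonal ![0, 0, BGK.shearCoeff ‖k‖ τ s, BGK.shearCoeff ‖k‖ τ s, 0] *
            (BGK.tildeQ Q)ᵀ)) ∧
        -- its range is the shear basis of the direct computation
        LinearMap.range (R s).mulVecLin =
          Submodule.span ℂ {BGK.shearBasis₁ Q, BGK.shearBasis₂ Q} ∧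
        BGK.moments '' {f | BGK.InEigenspace (BGK.bgk k τ) s f} =
          (Submodule.span ℂ {BGK.shearBasis₁ Q, BGK.shearBasis₂ Q} : Set (Fin 5 → ℂ)) := by
  refine ⟨fun z hz => ⟨BGK.spectralFunction_eq_det hτ hk hQ hQk hz,
    BGK.adjugate_greenS_sub_one hτ hk hQ hQk hz⟩, ?_⟩
  have hfin := BGK.finite_hydroSpectrum hτ hk hQ hQk
  obtain ⟨s, hsre, hsiff, hs0, hD⟩ := BGK.exists_shear hτ hk hcrit
  have hsz := (BGK.zOf_re hτ s).2 hsre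
  have hsZ := (hsiff s hsre).2 rfl
  have hsmem : s ∈ BGK.hydroSpectrum k τ := by
    refine ⟨?_, hsre⟩
    rw [BGK.mem_opSpectrum_iff hτ hsz, BGK.det_greenS_sub_one hτ hk hQ hQk hsz,
      BGK.zetaOf_eq hτ hk, BGK.det_shiftedMat, hsZ]
    simp
  have hmem : ∀ w, w ∈ hfin.toFinset → w ∈ BGK.hydroSpectrum k τ := fun w hw =>
    hfin.mem_toFinset.1 hw
  have hre : ∀ w ∈ hfin.toFinset, (BGK.zOf τ w).re < 0 := fun w hw =>
    (BGK.zOf_re hτ w).2 (hmem w hw).2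
  -- Stated for all w so that `choose` yields a total function; the value 0 off the spectrum is
  -- never used.
  have hex : ∀ w n m, ∃ ρ, w ∈ hfin.toFinset → BGK.HasPolarPart
      (fun z => (BGK.spectralFunction ‖k‖ τ z)⁻¹ * (BGK.greenS k τ z - 1).adjugate n m)
      (BGK.zOf τ w) ρ := fun w n m => by
    by_cases hw : w ∈ hfin.toFinset
    · obtain ⟨ρ, hρ⟩ := BGK.exists_hasPolarPart hτ hk hQ hQk (hre w hw) n m
      exact ⟨ρ, fun _ => hρ⟩
    · exact ⟨0, fun h => absurd h hw⟩
  choose R hR using hex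
  have hres : ∀ w ∈ hfin.toFinset, ∀ n m, BGK.HasResidueAt
      (fun z => (BGK.spectralFunction ‖k‖ τ z)⁻¹ * (BGK.greenS k τ z - 1).adjugate n m)
      (BGK.zOf τ w) (R w n m) := fun w hw n m =>
    BGK.hasResidueAt_of_hasPolarPart hτ hk hQ hQk (hre w hw) (hR w n m hw)
  have hsS : s ∈ hfin.toFinset := hfin.mem_toFinset.2 hsmem
  refine ⟨hfin.toFinset, R, hfin.coe_toFinset, hres, fun γ hγ n m => ?_, fun w hw hsimple => ?_,
    s, hsS, hsiff, ?_⟩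
  -- The shear eigenvalue supplies the nonemptiness that confines the contour to the half-plane.
  · exact hγ.inner_rieszProjection hτ hk hQ hQk hfin.coe_toFinset ⟨s, hsS⟩
      fun w hw => hR w n m hw
  · exact hsimple.description hτ hk hQ hQk (hmem w hw) (hres w hw)
  · have hA : BGK.shearCoeff ‖k‖ τ s ≠ 0 := by
      rw [BGK.shearCoeff_eq hτ hk]
      exact mul_ne_zero (mul_ne_zero (by exact_mod_cast hτ.ne') hs0) hD
    obtain ⟨c, hc, hRs⟩ := BGK.residue_shear hτ hk hQ hQk hsz hs0 hsZ hD (hres s hsS)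
    refine ⟨BGK.meromorphicOrderAt_shear hτ hk hQ hQk hsz hs0 hsZ hD, hA,
      BGK.hasDerivAt_adjugate_shear hτ hk hsz hsZ, ⟨c, hc, hRs⟩, ?_,
      BGK.moments_shear hτ hk hQ hQk hsz hsZ hD⟩
    rw [show R s = _ from hRs]
    exact BGK.range_shear hQ hc hA
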